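/- A \emph{full conjunctive query} $q$ is a finite conjunction (set) of atoms $R(\bar z)$ over a finite relational schema, with no quantified variable; its solutions $q(D)$ over a database $D$ are the assignments of its variables to domain elements that make every atom of $q$ a fact of $D$. The query $q$ is \emph{acyclic} if it has no atoms or has a join tree, i.e. a tree whose nodes are the atoms of $q$ such that, for every variable $x$, the atoms containing $x$ are connected in the tree. An \emph{endomorphism} of $q$ is a map $\nu$ from variables to variables that maps atoms of $q$ to atoms of $q$. An \emph{image} of $q$ is a subquery $I$ of $q$ induced by the image of $q$ under an endomorphism $\nu$: a set $I$ of atoms of $q$ that contains $R(\nu(\bar z))$ for every atom $R(\bar z)$ of $q$, and all of whose variables are of the form $\nu(x)$. (So $I$ may be the set of all atoms $R(\nu(\bar z))$, or the set of all atoms of $q$ on the variables $\nu(x)$, or lie between the two.) The \emph{untangling step} applied to $q$ and an image $I$ of $q$ produces the following query: remove from $q$ all atoms of $I$; then replace each remaining atom $R(\bar z)$ by $R_{p}(\bar z')$, where $\bar z'$ is $\bar z$ with all occurrences of variables of $I$ removed and $R_{p}$ is a fresh symbol determined by $R$, the set of removed positions, and the variable that stood at each of these positions. The query $q$ \emph{can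 be untangled} if there is a sequence $q_0,\dots,q_l=q$ such that $q_0$ is acyclic and, for every $i>0$, there is an image $I$ of $q_i$ such that, with $q'$ the result of the untangling step applied to $q_i$ and $I$, either $I=q_{i-1}$ and $q'$ is acyclic, or $I$ is acyclic and $q'=q_{i-1}$. \textbf{Proposition.} Let $q$ be a full conjunctive query that can be untangled. Then $q$ can be enumerated with linear delay after linear preprocessing time: there are a program for the random access machine with unit-cost addition, (truncated) subtraction, multiplication, comparison and indirect memory access, and a constant $c$ (both depending only on $q$, its schema, and the numbering of relation symbols and ordering of variables used for input and output), such that on every database $D$ with domain $\{0,\dots,n-1\}$ and with $\|D\|$ facts, given as an arbitrary list of its facts, the program, after a preprocessing phase of at most $c(\|D\|+1)$ steps, outputs every solution in $q(D)$ exactly once and nothing else, and then halts, where the time to the first output, the time between two consecutive outputs, and the time from the last output to the halt are each at most $c(\|D\|+1)$; moreover all contents and addresses of registers and memory cells in use are at most $c(\|D\|+n+1)^c$. -/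

import Mathlib

/-! ### Schemas, full conjunctive queries, databases -/

/-- A relational schema: relation symbols with their arities. -/
structure Schema where
  Sym : Type
  [decEq : DecidableEq Sym]
  arity : Sym → ℕ

attribute [instance] Schema.decEq

/-- An atom `R(z₁, …, z_r)` over the schema `σ` whose arguments are taken from `X`.
With `X` a type of variables these are the atoms of queries; with `X = ℕ` they are facts. -/
abbrev Atom (σ : Schema) (X : Type) : Type := Σ R : σ.Sym, (Fin (σ.arity R) → X)

/-- `R(z₁, …, z_r) ↦ R(f z₁, …, f z_r)`. -/
def Atom.map {σ : Schema} {X Y : Type} (f : X → Y) (a : Atom σ X) : Atom σ Y :=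
  ⟨a.1, fun i => f (a.2 i)⟩

/-- A full conjunctive query: a finite conjunction of atoms in which no variable is quantified. -/
abbrev FullCQ (σ : Schema) (X : Type) : Type := Finset (Atom σ X)

/-- The variables of `q`, i.e. those occurring in its atoms (all of them are free). -/
def FullCQ.vars {σ : Schema} {X : Type} [DecidableEq X] (q : FullCQ σ X) : Finset X :=
  q.biUnion fun a => Finset.univ.image a.2

/-- A database: a finite domain `{0, …, dom - 1}` and a finite set of facts over it. -/
structure Database (σ : Schema) where
  dom : ℕ
  facts : Finset (Atom σ ℕ)
  facts_lt : ∀ f ∈ facts, ∀ i, f.2 i < dom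

/-- The size of a database: its number of facts. -/
def Database.size {σ : Schema} (D : Database σ) : ℕ := D.facts.card

/-- The answers `q(D)`, as tuples ordered by the listing `xs` of the variables of `q`.
The atoms force the value `h x` of each variable `x` of `q` into the domain of `D`. -/
def FullCQ.answers {σ : Schema} {X : Type} (q : FullCQ σ X) (xs : List X) (D : Database σ) :
    Set (List ℕ) :=
  {t | ∃ h : X → ℕ, (∀ a ∈ q, Atom.map h a ∈ D.facts) ∧ t = xs.map h}

/-! ### Acyclicity, images, untangling -/

/-- Acyclicity: `q` has no atom, or it has a join tree, i.e. a tree on the atoms of `q` such that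
for every variable `x` the atoms containing `x` are connected in the tree. -/
def FullCQ.IsAcyclic {σ : Schema} {X : Type} (q : FullCQ σ X) : Prop :=
  q = ∅ ∨ ∃ T : SimpleGraph {a : Atom σ X // a ∈ q}, T.IsTree ∧
    ∀ x : X, (T.induce {a | ∃ i, a.1.2 i = x}).Preconnected

/-- `ν` restricts to an endomorphism of `q`: it maps atoms of `q` to atoms of `q`. -/
def FullCQ.IsEndomorphism {σ : Schema} {X : Type} (q : FullCQ σ X) (ν : X → X) : Prop :=
  ∀ a ∈ q, Atom.map ν a ∈ q

/-- `I` is an image of `q`: a subquery of `q` containing the image of `q` under some endomorphism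
`ν` and having no variable outside `ν(vars q)`. Thus `I` may be the set of all images `ν(a)` of
atoms `a` of `q`, or the set of all atoms of `q` with variables in `ν(vars q)`, or lie between. -/
def FullCQ.IsImage {σ : Schema} {X : Type} [DecidableEq X] (I q : FullCQ σ X) : Prop :=
  ∃ ν : X → X, q.IsEndomorphism ν ∧ I ⊆ q ∧ (∀ a ∈ q, Atom.map ν a ∈ I) ∧
    I.vars ⊆ q.vars.image ν

/-- The schema of the fresh symbols of an untangling step. The symbol `⟨R, p⟩` stands for `R` with
the positions `i` such that `p i = some y` removed because they hold the variable `y`. -/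
def Schema.untangle (σ : Schema) (X : Type) [DecidableEq X] : Schema where
  Sym := Σ R : σ.Sym, (Fin (σ.arity R) → Option X)
  arity s := (Finset.univ.filter fun i => s.2 i = none).card

/-- Removes from an atom all occurrences of the variables in `Y`, and renames its symbol. -/
def Atom.strip {σ : Schema} {X : Type} [DecidableEq X] (Y : Finset X) (a : Atom σ X) :
    Atom (σ.untangle X) X :=
  let p : Fin (σ.arity a.1) → Option X := fun i => if a.2 i ∈ Y then some (a.2 i) else none
  ⟨⟨a.1, p⟩, fun j => a.2 ((Finset.univ.filter fun i => p i = none).orderEmbOfFin rfl j)⟩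

/-- The untangling step: remove the atoms of `I`, then the variables of `I`. -/
def FullCQ.untangle {σ : Schema} {X : Type} [DecidableEq X] (q I : FullCQ σ X) :
    FullCQ (σ.untangle X) X :=
  (q \ I).image (Atom.strip I.vars)

/-- `q` can be untangled: there is a sequence of queries from an acyclic query to `q`, each obtained
from its successor `p` and an image `I` of `p` either as `I`, where the result of the untangling
step is acyclic, or as the result of the untangling step, where `I` is acyclic. -/
inductive FullCQ.CanBeUntangled {X : Type} [DecidableEq X] : ∀ {σ : Schema}, FullCQ σ X → Prop
  | acyclic {σ : Schema} (q : FullCQ σ X) : q.IsAcyclic → CanBeUntangled q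
  | image {σ : Schema} (q I : FullCQ σ X) :
      I.IsImage q → (q.untangle I).IsAcyclic → CanBeUntangled I → CanBeUntangled q
  | residual {σ : Schema} (q I : FullCQ σ X) :
      I.IsImage q → I.IsAcyclic → CanBeUntangled (q.untangle I) → CanBeUntangled q

/-! ### Random access machines -/

/-- Instructions of a random access machine with labels `Λ` and registers `ρ`; the arguments of
type `Λ` are the labels to continue at. -/
inductive Instr (Λ ρ : Type)
  /-- `r := k` -/
  | const (r : ρ) (k : ℕ) (next : Λ)
  /-- `r := a + b` -/
  | add (r a b : ρ) (next : Λ)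
  /-- `r := a - b`, truncated at zero -/
  | sub (r a b : ρ) (next : Λ)
  /-- `r := a * b` -/
  | mul (r a b : ρ) (next : Λ)
  /-- `r :=` word number `a` of the input -/
  | input (r a : ρ) (next : Λ)
  /-- `r := Memory[a]` -/
  | load (r a : ρ) (next : Λ)
  /-- `Memory[a] := r` -/
  | store (a r : ρ) (next : Λ)
  /-- if `a < b` go to `yes`, else go to `no` -/
  | ifLt (a b : ρ) (yes no : Λ)
  /-- output the tuple of the contents of the registers `rs` -/
  | emit (rs : List ρ) (next : Λ)
  /-- stop -/
  | halt

/-- A program: finitely many labels and registers, and an instruction at each label. -/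
structure Program where
  Λ : Type
  ρ : Type
  finLabels : Finite Λ
  finRegisters : Finite ρ
  [decEq : DecidableEq ρ]
  start : Λ
  code : Λ → Instr Λ ρ

namespace Program

attribute [instance] Program.decEq

/-- A configuration: current label, register contents, memory contents. -/
structure Config (P : Program) where
  lab : P.Λ
  reg : P.ρ → ℕ
  mem : ℕ → ℕ

/-- The initial configuration: registers and memory hold zero. -/
def initial (P : Program) : P.Config := ⟨P.start, fun _ => 0, fun _ => 0⟩

/-- One step (of unit cost) on the read-only input `inp`. -/
def step (P : Program) (inp : List ℕ) (s : P.Config) : P.Config :=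
  match P.code s.lab with
  | .const r k l => ⟨l, Function.update s.reg r k, s.mem⟩
  | .add r a b l => ⟨l, Function.update s.reg r (s.reg a + s.reg b), s.mem⟩
  | .sub r a b l => ⟨l, Function.update s.reg r (s.reg a - s.reg b), s.mem⟩
  | .mul r a b l => ⟨l, Function.update s.reg r (s.reg a * s.reg b), s.mem⟩
  | .input r a l => ⟨l, Function.update s.reg r (inp.getD (s.reg a) 0), s.mem⟩
  | .load r a l => ⟨l, Function.update s.reg r (s.mem (s.reg a)), s.mem⟩
  | .store a r l => ⟨l, s.reg, Function.update s.mem (s.reg a) (s.reg r)⟩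
  | .ifLt a b yes no => ⟨if s.reg a < s.reg b then yes else no, s.reg, s.mem⟩
  | .emit _ l => ⟨l, s.reg, s.mem⟩
  | .halt => s

/-- The configuration after `t` steps. -/
def run (P : Program) (inp : List ℕ) (t : ℕ) : P.Config := (P.step inp)^[t] P.initial

/-- The tuple output by the step number `t`, if that step outputs one. -/
def output (P : Program) (inp : List ℕ) (t : ℕ) : Option (List ℕ) :=
  match P.code (P.run inp t).lab with
  | .emit rs _ => some (rs.map (P.run inp t).reg)
  | _ => none

/-- The program has stopped by time `t`. -/
def HaltedAt (P : Program) (inp : List ℕ) (t : ℕ) : Prop :=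
  P.code (P.run inp t).lab = .halt

/-- On input `inp`, the program enumerates the set `S` without repetition, with preprocessing time
at most `pre` and delay at most `delay`, all words in use being at most `word`. -/
structure Enumerates (P : Program) (inp : List ℕ) (S : Set (List ℕ)) (pre delay word : ℕ) :
    Prop where
  /-- only elements of `S` are output -/
  sound : ∀ t a, P.output inp t = some a → a ∈ S
  /-- every element of `S` is output exactly once -/
  complete : ∀ a ∈ S, ∃! t, P.output inp t = some a
  /-- The enumeration phase starts at some time `t₀ ≤ pre`, with no output before `t₀`. From then
  on, the next output, or the end of the computation if there is none, is always fewer than `delay`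
  steps ahead. -/
  timing : ∃ t₀ T, t₀ ≤ pre ∧ t₀ ≤ T ∧ P.HaltedAt inp T ∧
    (∀ t < t₀, P.output inp t = none) ∧
    ∀ t, t₀ ≤ t → t ≤ T →
      ∃ t', t ≤ t' ∧ t' < t + delay ∧ (t' = T ∨ (P.output inp t').isSome)
  /-- all register and memory contents (hence all addresses in use) are at most `word` -/
  bounded : ∀ t, (∀ r, (P.run inp t).reg r ≤ word) ∧ ∀ i, (P.run inp t).mem i ≤ word

end Program

/-! ### The enumeration problem -/

/-- The input words for a database whose facts are listed as `L`: the size of the domain, the number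
of facts, and then for each fact the number of its symbol followed by its elements. -/
def Database.encode {σ : Schema} (code : σ.Sym → ℕ) (D : Database σ) (L : List (Atom σ ℕ)) :
    List ℕ :=
  D.dom :: D.size :: L.flatMap fun f => code f.1 :: List.ofFn f.2

/-- `q` can be enumerated with linear delay after linear preprocessing time, in data complexity:
for any numbering `code` of the relation symbols and any ordering `xs` of the variables of `q`,
there is a program which does so on every database, in whatever order `L` its facts are listed,
with all words polynomially bounded. -/
def FullCQ.EnumerableWithLinearDelay {σ : Schema} {X : Type} [DecidableEq X] (q : FullCQ σ X) :
    Prop :=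
  ∀ code : σ.Sym → ℕ, Function.Injective code →
  ∀ xs : List X, xs.Nodup → xs.toFinset = q.vars →
  ∃ (P : Program) (c : ℕ), ∀ (D : Database σ) (L : List (Atom σ ℕ)),
    L.Nodup → L.toFinset = D.facts →
    P.Enumerates (D.encode code L) (q.answers xs D)
      (c * (D.size + 1)) (c * (D.size + 1)) (c * (D.size + D.dom + 1) ^ c)

/-! Solutions are first generated with bounded repetition, and repetitions are removed at the end.
Let `I` be an image of `q` under `ν`. Generate the solutions `h₁` of `I`; for each, produce `h₁ ∘
ν`, which solves `q`, and then all extensions of `h₁` to the atoms outside `I`. The second task is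
the residual query, with the variables of `I` acting as constants. The guaranteed result `h₁ ∘ ν`
pays for the linear time spent on the residual query even if `h₁` has no extension, so the delay
stays linear. Every variable of `I` has the form `ν z`, so `h₁` is determined by `h₁ ∘ ν`; it is
also the restriction of each of its extensions. Multiplicities `K₁` and `K₂` of the two parts
therefore combine to at most `K₁ + K₁ * K₂` (`Gen.Enumerates.of_image`). The fresh symbols of an
untangling step record the removed variables, so an endomorphism of a later query lifts to the
original atoms, fixing the constants (`Flattens`). Induction along the sequence gives
`FullCQ.CanBeUntangled.exists_gen`.

Acyclic queries are handled by semijoins along an ear order (`exists_gen_of_earOrder`): the facts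
for the ear enter a table, the parent is tested against it, and every solution of the rest then
extends to the ear. The keys of the tables include the constants, so entries stay correct when the
constants change and tables are never cleared.

If every solution occurs at most `K` times, new solutions go into a queue with a lookup table, and
one is released after every `K` events. After `K * (j + 1)` events at least `j + 1` different
solutions have been seen, so the queue can always deliver (`Impl.gap`). No separate preprocessing
phase is needed, since the first output already obeys the delay bound.

Generators are abstract programs whose runs are traces of time units and events. They are compiled
to structured code at constant cost per time unit (`Layout.exists_implements`), and the code becomes
a machine whose labels are the pieces of code still to be executed (`Code.toProgram_spec`). -/

/-! ### Ear orders of join trees -/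

/-- Each element of the list has a later element, its parent, that contains everything it shares
with the later elements. -/
def EarOrder {V X : Type} (vs : V → Set X) : List V → Prop
  | [] => True
  | v :: l => (l = [] ∨ ∃ p ∈ l, ∀ x ∈ vs v, ∀ u ∈ l, x ∈ vs u → x ∈ vs p) ∧ EarOrder vs l

theorem EarOrder.map {V W X : Type} (f : W → V) (vs : V → Set X) :
    ∀ l : List W, EarOrder (fun w => vs (f w)) l → EarOrder vs (l.map f)
  | [], _ => trivial
  | w :: l, ⟨h, hl⟩ => by
    refine ⟨?_, EarOrder.map f vs l hl⟩
    rcases h with rfl | ⟨p, hp, h⟩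
    · simp
    · refine Or.inr ⟨f p, List.mem_map_of_mem hp, fun x hx u hu hxu => ?_⟩
      obtain ⟨u', hu', rfl⟩ := List.mem_map.1 hu
      exact h x hx u' hu' hxu

/-- Induction by deleting a leaf `v`, whose neighbour `p` serves as parent. A connected set of
vertices that contains `v` and some other vertex must contain `p`, the only neighbour of `v`. -/
theorem exists_earOrder_of_isTree {X : Type} (n : ℕ) : ∀ (V : Type) [Fintype V],
    Fintype.card V = n → ∀ (T : SimpleGraph V), T.IsTree → ∀ vs : V → Set X,
    (∀ x, (T.induce {a | x ∈ vs a}).Preconnected) →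
    ∃ l : List V, l.Nodup ∧ (∀ v, v ∈ l) ∧ EarOrder vs l := by
  classical
  induction n with
  | zero =>
    intro V _ hV T hT
    have := hT.connected.nonempty
    exact absurd hV Fintype.card_ne_zero
  | succ n ih =>
    intro V _ hV T hT vs hvs
    rcases subsingleton_or_nontrivial V with hs | hn
    · obtain ⟨v⟩ := hT.connected.nonempty
      exact ⟨[v], by simp, fun w => by simp [Subsingleton.elim w v], Or.inl rfl, trivial⟩
    obtain ⟨v, hv⟩ := hT.exists_vert_degree_one_of_nontrivial
    obtain ⟨p, hvp, hp⟩ := SimpleGraph.degree_eq_one_iff_existsUnique_adj.1 hv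
    have hT' : (T.induce {v}ᶜ).IsTree :=
      ⟨hT.connected.induce_compl_singleton_of_degree_eq_one hv, hT.isAcyclic.induce _⟩
    have hcard : Fintype.card ({v}ᶜ : Set V) = n := by
      rw [Fintype.card_compl_set, hV]; simp
    obtain ⟨l, hl, hmem, hear⟩ := ih _ hcard _ hT' (fun a => vs a.1) (by
      intro x
      have h1 : ((T.induce {a | x ∈ vs a}).induce {w | w.1 ≠ v}).Preconnected := by
        -- Among the vertices containing `x`, the leaf `v` still has at most one neighbour, so its
        -- deletion does not disconnect them.
        refine (hvs x).induce_of_degree_eq_one fun w hw => ?_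
        have hw : w.1 = v := by simpa using hw
        intro a ha b hb
        have ha : T.Adj w.1 a.1 := ha
        have hb : T.Adj w.1 b.1 := hb
        rw [hw] at ha hb
        exact Subtype.ext ((hp _ ha).trans (hp _ hb).symm)
      rintro ⟨⟨a, hav⟩, ha⟩ ⟨⟨b, hbv⟩, hb⟩
      let f : ((T.induce {a | x ∈ vs a}).induce {w | w.1 ≠ v}) →g
          ((T.induce {v}ᶜ).induce {a | x ∈ vs a.1}) :=
        ⟨fun w => ⟨⟨w.1.1, w.2⟩, w.1.2⟩, fun h => h⟩
      exact (h1 ⟨⟨a, ha⟩, hav⟩ ⟨⟨b, hb⟩, hbv⟩).map f)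
    refine ⟨v :: l.map Subtype.val, ?_, ?_, ?_, EarOrder.map _ _ _ hear⟩
    · rw [List.nodup_cons]
      refine ⟨fun h => ?_, hl.map Subtype.val_injective⟩
      obtain ⟨w, -, hw⟩ := List.mem_map.1 h
      exact w.2 hw
    · intro w
      by_cases hw : w = v
      · simp [hw]
      · exact List.mem_cons_of_mem _ (List.mem_map.2 ⟨⟨w, hw⟩, hmem _, rfl⟩)
    · right
      refine ⟨p, List.mem_map.2 ⟨⟨p, hvp.ne'⟩, hmem _, rfl⟩, fun x hx u hu hxu => ?_⟩
      have huv : u ≠ v := by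
        rintro rfl
        obtain ⟨w, -, hw⟩ := List.mem_map.1 hu
        exact w.2 hw
      obtain ⟨W⟩ := hvs x ⟨v, hx⟩ ⟨u, hxu⟩
      cases W with
      | nil => exact absurd rfl huv
      | @cons _ w _ hadj _ =>
        have hw : T.Adj v w.1 := hadj
        rw [← hp _ hw]
        exact w.2

/-! ### Traces -/

/-- A trace of a computation: one entry for each unit of time, carrying the event that occurs
then, if there is one. -/
abbrev Trace (α : Type) : Type := List (Option α)

/-- With the last event `age` units of time ago, the trace never waits longer than `D` for the next
event or its end. -/
def Trace.Gap {α : Type} (D : ℕ) : ℕ → Trace α → Prop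
  | age, [] => age ≤ D
  | age, none :: tr => Trace.Gap D (age + 1) tr
  | age, some _ :: tr => age ≤ D ∧ Trace.Gap D 0 tr

namespace Trace

variable {α β : Type}

theorem Gap.mono {D D' : ℕ} (hD : D ≤ D') : ∀ {tr : Trace α} {a a' : ℕ}, a' ≤ a → Gap D a tr →
    Gap D' a' tr
  | [], _, _, ha, h => by simp only [Gap] at *; omega
  | none :: tr, _, _, ha, h => Gap.mono (tr := tr) hD (Nat.succ_le_succ ha) h
  | some _ :: tr, _, _, ha, h => ⟨(ha.trans h.1).trans hD, Gap.mono (tr := tr) hD le_rfl h.2⟩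

theorem Gap.age_le {D : ℕ} : ∀ {tr : Trace α} {a : ℕ}, Gap D a tr → a ≤ D
  | [], _, h => h
  | none :: tr, _, h => (Nat.le_succ _).trans (Gap.age_le (tr := tr) h)
  | some _ :: _, _, h => h.1

theorem gap_of_length {D : ℕ} : ∀ {tr : Trace α} {a : ℕ}, a + tr.length ≤ D → Gap D a tr
  | [], _, h => h
  | none :: tr, a, h => gap_of_length (tr := tr) (by simp only [List.length_cons] at h; omega)
  | some _ :: tr, a, h =>
    ⟨by omega, gap_of_length (tr := tr) (by simp only [List.length_cons] at h; omega)⟩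

theorem gap_silent_append {D : ℕ} {t' : Trace α} : ∀ {t : Trace α} {a : ℕ}, (∀ x, some x ∉ t) →
    Gap D (a + t.length) t' → Gap D a (t ++ t')
  | [], _, _, h => h
  | none :: t, a, hn, h => gap_silent_append (t := t) (fun x hx => hn x (List.mem_cons_of_mem _ hx))
      (by rwa [List.length_cons, Nat.add_comm t.length, ← add_assoc] at h)
  | some x :: _, _, hn, _ => absurd (List.mem_cons_self) (hn x)

/-- After a trace with an event, at most its maximal gap has passed since the last event. -/
theorem Gap.append {D₂ D b : ℕ} {t' : Trace α} (hb : b + D₂ ≤ D) (h' : Gap D D₂ t') :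
    ∀ {t : Trace α} {a : ℕ}, Gap D₂ a t → a ≤ D₂ → (∃ x, some x ∈ t) → Gap D (b + a) (t ++ t')
  | [], _, _, _, hs => by simp at hs
  | none :: t, a, h, _, hs => by
    have := Gap.append (t := t) (a := a + 1) hb h' h (Gap.age_le (tr := t) h) (by simpa using hs)
    exact this
  | some x :: t, a, h, ha, _ => by
    refine ⟨by omega, ?_⟩
    by_cases hs : ∃ x, some x ∈ t
    · exact (Gap.append (t := t) (a := 0) hb h' h.2 (Nat.zero_le _) hs).mono le_rfl (Nat.zero_le _)
    · push Not at hs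
      have hl : ∀ (t : Trace α) (a : ℕ), Gap D₂ a t → (∀ x, some x ∉ t) → a + t.length ≤ D₂ := by
        intro t
        induction t with
        | nil => exact fun a h _ => h
        | cons o t ih =>
          cases o with
          | none =>
            intro a h hn
            have := ih (a + 1) h (fun x hx => hn x (List.mem_cons_of_mem _ hx))
            simp only [List.length_cons]; omega
          | some y => exact fun a h hn => absurd (List.mem_cons_self) (hn y)
      exact gap_silent_append hs (h'.mono le_rfl (hl t 0 h.2 hs))

/-- `tr'` arises from `tr` by replacing each event `x` with a trace `t` such that `T x t`. -/
inductive Expand (T : α → Trace β → Prop) : Trace α → Trace β → Prop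
  | nil : Expand T [] []
  | tick {tr tr'} : Expand T tr tr' → Expand T (none :: tr) (none :: tr')
  | event {x t tr tr'} : T x t → Expand T tr tr' → Expand T (some x :: tr) (t ++ tr')

theorem Expand.append {T : α → Trace β → Prop} {t₁ t₂ : Trace α} {t₁' t₂' : Trace β}
    (h₁ : Expand T t₁ t₁') (h₂ : Expand T t₂ t₂') : Expand T (t₁ ++ t₂) (t₁' ++ t₂') := by
  induction h₁ with
  | nil => exact h₂
  | tick _ ih => exact .tick ih
  | event h _ ih => rw [List.append_assoc]; exact .event h ih

theorem Expand.mem_iff {T : α → Trace β → Prop} {tr : Trace α} {tr' : Trace β}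
    (h : Expand T tr tr') {Q : α → Prop} {y : β}
    (hQ : ∀ x t, some x ∈ tr → T x t → (some y ∈ t ↔ Q x)) :
    some y ∈ tr' ↔ ∃ x, some x ∈ tr ∧ Q x := by
  induction h with
  | nil => simp
  | tick _ ih => simpa using ih fun x t hx => hQ x t (List.mem_cons_of_mem _ hx)
  | @event x t tr tr' hxt _ ih =>
    rw [List.mem_append, ih fun x t hx => hQ x t (List.mem_cons_of_mem _ hx),
      hQ x t List.mem_cons_self hxt]
    simp [or_and_right, exists_or]

-- Two sources `r₁` and `r₂` of `y` are allowed because in the untangling step a solution can arise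
-- both by composition with the endomorphism and by extension of its restriction.
open Classical in
theorem Expand.count_le {T : α → Trace β → Prop} {tr : Trace α} {tr' : Trace β}
    (h : Expand T tr tr') {y : β} {r₁ r₂ : α} {k₁ k₂ : ℕ}
    (hc : ∀ x t, some x ∈ tr → T x t →
      t.count (some y) ≤ (if x = r₁ then k₁ else 0) + if x = r₂ then k₂ else 0) :
    tr'.count (some y) ≤ tr.count (some r₁) * k₁ + tr.count (some r₂) * k₂ := by
  induction h with
  | nil => simp
  | tick _ ih => simpa using ih fun x t hx => hc x t (List.mem_cons_of_mem _ hx)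
  | @event x t tr tr' hxt _ ih =>
    have h1 := ih fun x t hx => hc x t (List.mem_cons_of_mem _ hx)
    have h2 := hc x t List.mem_cons_self hxt
    rw [List.count_append, List.count_cons, List.count_cons]
    simp only [beq_iff_eq, Option.some.injEq]
    split_ifs at h2 ⊢ <;> nlinarith

/-- Every inserted trace contains an event. So between two events of `tr'` there lie at most the
tail of one inserted trace, one gap of `tr`, and the head of the next inserted trace. -/
theorem Expand.gap {T : α → Trace β → Prop} {tr : Trace α} {tr' : Trace β} {D₁ D₂ : ℕ}
    (h : Expand T tr tr')
    (hT : ∀ x t, some x ∈ tr → T x t → Gap D₂ 0 t ∧ ∃ y, some y ∈ t) :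
    ∀ {a b : ℕ}, Gap D₁ a tr → b ≤ a + D₂ → Gap (D₁ + 2 * D₂) b tr' := by
  induction h with
  | nil => intro a b h hb; simp only [Gap] at h ⊢; omega
  | tick _ ih =>
    intro a b h hb
    exact ih (fun x t hx => hT x t (List.mem_cons_of_mem _ hx)) h (by omega)
  | @event x t tr tr' hxt _ ih =>
    intro a b h hb
    obtain ⟨h1, h2⟩ := hT x t List.mem_cons_self hxt
    have h3 := ih (fun x t hx => hT x t (List.mem_cons_of_mem _ hx)) h.2 (b := D₂) (by omega)
    have ha := h.1
    exact Gap.append (by omega) h3 h1 (Nat.zero_le _) h2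

end Trace

/-! ### Generators -/

section Generators

variable {σ : Schema} {X : Type}

/-- The variable `x` occurs in one of the atoms of `A`. -/
def Occurs (A : Set (Atom σ X)) (x : X) : Prop := ∃ a ∈ A, ∃ i, a.2 i = x

/-- A conjunction of tests: a fact matching `a` that passes the tests `own` and has the current
values of `ys` exists, and so on for `next`. -/
inductive Filters (σ : Schema) (X : Type) : Type
  | nil
  | cons (a : Atom σ X) (ys : List X) (own next : Filters σ X)

/-- A table of the values of `keys` on the facts matching `atom` that pass `filters`. -/
structure Table (σ : Schema) (X : Type) where
  atom : Atom σ X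
  keys : List X
  filters : Filters σ X

/-- The assignment `h` passes all tests. -/
def Filters.Holds (L : List (Atom σ ℕ)) : Filters σ X → (X → ℕ) → Prop
  | .nil, _ => True
  | .cons a ys own next, h =>
    (∃ h', Atom.map h' a ∈ L ∧ own.Holds L h' ∧ ys.map h' = ys.map h) ∧ next.Holds L h

/-- The contents the table should have. -/
def Table.den (L : List (Atom σ ℕ)) (t : Table σ X) : Set (List ℕ) :=
  {k | ∃ h', Atom.map h' t.atom ∈ L ∧ t.filters.Holds L h' ∧ t.keys.map h' = k}

/-- The tables that are looked up. -/
def Filters.tables : Filters σ X → List (Table σ X)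
  | .nil => []
  | .cons a ys own next => ⟨a, ys, own⟩ :: next.tables

theorem Filters.holds_iff {L : List (Atom σ ℕ)} {h : X → ℕ} : ∀ {F : Filters σ X},
    F.Holds L h ↔ ∀ t ∈ F.tables, t.keys.map h ∈ t.den L
  | .nil => by simp [Holds, tables]
  | .cons a ys own next => by
    simp only [Holds, tables, List.mem_cons, forall_eq_or_imp, Filters.holds_iff (F := next)]
    rfl

/-- The entries present in the tables. -/
abbrev Marks (σ : Schema) (X : Type) : Type := Set (Table σ X × List ℕ)

/-- Only entries which should be in a table are in it. -/
def Marks.Sound (L : List (Atom σ ℕ)) (M : Marks σ X) : Prop := ∀ e ∈ M, e.2 ∈ e.1.den L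

/-- Programs over a list of facts that extend an assignment of variables in all possible ways. -/
inductive Gen (σ : Schema) (X : Type) : Type
  | skip
  | seq (g₁ g₂ : Gen σ X)
  /-- the current assignment is an event -/
  | yield
  /-- replace the current assignment `h` by `h ∘ f` -/
  | rebind (f : X → X) (g : Gen σ X)
  /-- for each fact matching `a` under the current values of the variables in `S` -/
  | scan (a : Atom σ X) (S : Finset X) (g : Gen σ X)
  /-- enter the current values into a table -/
  | mark (t : Table σ X)
  /-- go on if the current values are in the table -/
  | test (t : Table σ X) (g : Gen σ X)

/-- The assignment `h'` changes `h` on variables of `a` outside `S` and takes `a` to `f`. -/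
def Matches (h : X → ℕ) (S : Finset X) (a : Atom σ X) (f : Atom σ ℕ) (h' : X → ℕ) : Prop :=
  Atom.map h' a = f ∧ ∀ x, (x ∈ S ∨ ¬ ∃ i, a.2 i = x) → h' x = h x

/-- The traces of a loop with body `B` over a list. -/
def Loop {α μ ω : Type} (B : α → μ → Trace ω → μ → Prop) :
    List α → μ → Trace ω → μ → Prop
  | [], M, tr, M' => tr = [none] ∧ M' = M
  | f :: fs, M, tr, M' => ∃ M₁ t₁ t₂, B f M t₁ M₁ ∧ Loop B fs M₁ t₂ M' ∧ tr = none :: (t₁ ++ t₂)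

/-- At an event, correct entries may be added to the tables. -/
def Grow (L : List (Atom σ ℕ)) (M M' : Marks σ X) : Prop := M ⊆ M' ∧ (M.Sound L → M'.Sound L)

/-- The traces of generators; the tables may grow at events. -/
def Gen.Run (L : List (Atom σ ℕ)) :
    Gen σ X → (X → ℕ) → Marks σ X → Trace (X → ℕ) → Marks σ X → Prop
  | .skip, _, M, tr, M' => tr = [] ∧ M' = M
  | .seq g₁ g₂, h, M, tr, M' => ∃ M₁ t₁ t₂, g₁.Run L h M t₁ M₁ ∧ g₂.Run L h M₁ t₂ M' ∧
      tr = t₁ ++ t₂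
  | .yield, h, M, tr, M' => tr = [some h] ∧ Grow L M M'
  | .rebind f g, h, M, tr, M' => g.Run L (h ∘ f) M tr M'
  | .scan a S g, h, M, tr, M' => ∃ t, tr = none :: t ∧ Loop (fun f M t M' =>
      (∃ h', Matches h S a f h' ∧ g.Run L h' M t M') ∨
      ((¬ ∃ h', Matches h S a f h') ∧ t = [] ∧ M' = M)) L M t M'
  | .mark t, h, M, tr, M' => tr = [none] ∧ M' = insert (t, t.keys.map h) M
  | .test t g, h, M, tr, M' =>
    ((t, t.keys.map h) ∈ M ∧ ∃ t₁, g.Run L h M t₁ M' ∧ tr = none :: t₁) ∨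
    ((t, t.keys.map h) ∉ M ∧ tr = [none] ∧ M' = M)

/-- Replace each event with the generator `k`. -/
def Gen.bind : Gen σ X → Gen σ X → Gen σ X
  | .skip, _ => .skip
  | .seq g₁ g₂, k => .seq (g₁.bind k) (g₂.bind k)
  | .yield, k => k
  | .rebind f g, k => .rebind f (g.bind k)
  | .scan a S g, k => .scan a S (g.bind k)
  | .mark t, _ => .mark t
  | .test t g, k => .test t (g.bind k)

/-- Only correct entries are made in tables when started from `h`. -/
def Gen.SoundAt (L : List (Atom σ ℕ)) : Gen σ X → (X → ℕ) → Prop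
  | .skip, _ => True
  | .seq g₁ g₂, h => g₁.SoundAt L h ∧ g₂.SoundAt L h
  | .yield, _ => True
  | .rebind f g, h => g.SoundAt L (h ∘ f)
  | .scan a S g, h => ∀ f ∈ L, ∀ h', Matches h S a f h' → g.SoundAt L h'
  | .mark t, h => t.keys.map h ∈ t.den L
  | .test t g, h => t.keys.map h ∈ t.den L → g.SoundAt L h

theorem Gen.SoundAt.bind {L : List (Atom σ ℕ)} {k : Gen σ X} (hk : ∀ h, k.SoundAt L h) :
    ∀ {g : Gen σ X} {h : X → ℕ}, g.SoundAt L h → (g.bind k).SoundAt L h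
  | .skip, _, _ => trivial
  | .seq _ _, _, h => ⟨SoundAt.bind hk h.1, SoundAt.bind hk h.2⟩
  | .yield, h, _ => hk h
  | .rebind f g, h', h => SoundAt.bind (g := g) (h := h' ∘ f) hk h
  | .scan _ _ _, _, h => fun f hf h' hm => SoundAt.bind hk (h f hf h' hm)
  | .mark _, _, h => h
  | .test _ _, _, h => fun ht => SoundAt.bind hk (h ht)

theorem Loop.rel {α μ ω : Type} {B : α → μ → Trace ω → μ → Prop} {R : μ → μ → Prop}
    (hr : ∀ M, R M M) (ht : ∀ M₁ M₂ M₃, R M₁ M₂ → R M₂ M₃ → R M₁ M₃) :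
    ∀ {L : List α}, (∀ f ∈ L, ∀ M t M', B f M t M' → R M M') →
    ∀ {M : μ} {tr : Trace ω} {M' : μ}, Loop B L M tr M' → R M M'
  | [], _, _, _, _, h => by obtain ⟨-, rfl⟩ := h; exact hr _
  | f :: fs, hB, _, _, _, h => by
    obtain ⟨M₁, t₁, t₂, h1, h2, -⟩ := h
    exact ht _ _ _ (hB f (List.mem_cons_self) _ _ _ h1)
      (Loop.rel hr ht (fun f hf => hB f (List.mem_cons_of_mem _ hf)) h2)

theorem Grow.refl {L : List (Atom σ ℕ)} (M : Marks σ X) : Grow L M M := ⟨subset_rfl, id⟩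

theorem Grow.trans {L : List (Atom σ ℕ)} {M₁ M₂ M₃ : Marks σ X} (h : Grow L M₁ M₂)
    (h' : Grow L M₂ M₃) : Grow L M₁ M₃ := ⟨h.1.trans h'.1, h'.2 ∘ h.2⟩

/-- Soundness of `M` enters at `test`: the marks behind a passed test are known to be correct only
if the entry that was found is correct. -/
theorem Gen.Run.grow {L : List (Atom σ ℕ)} : ∀ {g : Gen σ X} {h : X → ℕ} {M : Marks σ X}
    {tr : Trace (X → ℕ)} {M' : Marks σ X}, g.Run L h M tr M' → g.SoundAt L h →
    M.Sound L → Grow L M M'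
  | .skip, _, _, _, _, hr, _, _ => by obtain ⟨-, rfl⟩ := hr; exact Grow.refl _
  | .seq _ _, _, _, _, _, hr, hs, hM => by
    obtain ⟨M₁, t₁, t₂, h1, h2, -⟩ := hr
    have h3 := Run.grow h1 hs.1 hM
    exact h3.trans (Run.grow h2 hs.2 (h3.2 hM))
  | .yield, _, _, _, _, hr, _, _ => hr.2
  | .rebind f _, h, _, _, _, hr, hs, hM => Run.grow (h := h ∘ f) hr hs hM
  | .scan a S g, h, _, _, _, hr, hs, hM => by
    obtain ⟨t, -, hl⟩ := hr
    have := Loop.rel (R := fun M M' => M.Sound L → Grow L M M') (fun M _ => Grow.refl M)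
      (fun M₁ M₂ M₃ h12 h23 hM => (h12 hM).trans (h23 ((h12 hM).2 hM))) (L := L)
      (fun f hf M t M' hB hM => by
        rcases hB with ⟨h', hm, hB⟩ | ⟨-, -, rfl⟩
        · exact Run.grow hB (hs f hf h' hm) hM
        · exact Grow.refl _) hl
    exact this hM
  | .mark t, h, M, _, _, hr, hs, hM => by
    obtain ⟨-, rfl⟩ := hr
    refine ⟨Set.subset_insert _ _, fun _ e he => ?_⟩
    rcases he with rfl | he
    · exact hs
    · exact hM e he
  | .test t g, h, M, _, _, hr, hs, hM => by
    rcases hr with ⟨h1, t₁, h2, -⟩ | ⟨-, -, rfl⟩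
    · exact Run.grow h2 (hs (hM _ h1)) hM
    · exact Grow.refl _

/-- `yield` lets the tables grow in any sound way exactly so that the marks made by `k` can be
absorbed into a run of `g` alone. The set `M₀` records that entries present at the start are
available each time `k` is entered. -/
theorem Gen.run_bind {L : List (Atom σ ℕ)} {k : Gen σ X} (hk : ∀ h, k.SoundAt L h)
    {M₀ : Marks σ X} : ∀ {g : Gen σ X} {h : X → ℕ} {M : Marks σ X} {tr' : Trace (X → ℕ)}
    {M' : Marks σ X}, (g.bind k).Run L h M tr' M' → g.SoundAt L h → M.Sound L → M₀ ⊆ M →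
    ∃ tr, g.Run L h M tr M' ∧ Trace.Expand (fun h t => ∃ M₁ M₂, M₀ ⊆ M₁ ∧ M₁.Sound L ∧
      k.Run L h M₁ t M₂) tr tr'
  | .skip, _, _, _, _, hr, _, _, _ => by
    obtain ⟨rfl, rfl⟩ := hr; exact ⟨[], ⟨rfl, rfl⟩, .nil⟩
  | .seq g₁ g₂, _, _, _, _, hr, hs, hM, h0 => by
    obtain ⟨M₁, t₁, t₂, h1, h2, rfl⟩ := hr
    have h3 := Run.grow h1 (hs.1.bind hk) hM
    obtain ⟨s₁, hs1, he1⟩ := run_bind hk h1 hs.1 hM h0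
    obtain ⟨s₂, hs2, he2⟩ := run_bind hk h2 hs.2 (h3.2 hM) (h0.trans h3.1)
    exact ⟨s₁ ++ s₂, ⟨M₁, s₁, s₂, hs1, hs2, rfl⟩, he1.append he2⟩
  | .yield, h, M, tr', M', hr, hs, hM, h0 =>
    ⟨[some h], ⟨rfl, Run.grow hr (hk h) hM⟩, by
      simpa using Trace.Expand.event (T := fun h t => ∃ M₁ M₂, M₀ ⊆ M₁ ∧ M₁.Sound L ∧
      k.Run L h M₁ t M₂) ⟨M, M', h0, hM, hr⟩ .nil⟩
  | .rebind f g, h, M, tr', M', hr, hs, hM, h0 =>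
    run_bind (g := g) (h := h ∘ f) hk hr hs hM h0
  | .scan a S g, h, M, tr', M', hr, hs, hM, h0 => by
    obtain ⟨t, rfl, hl⟩ := hr
    suffices ∀ L' ⊆ L, ∀ M t, M.Sound L → M₀ ⊆ M → Loop (fun f M t M' =>
        (∃ h', Matches h S a f h' ∧ (g.bind k).Run L h' M t M') ∨
        ((¬ ∃ h', Matches h S a f h') ∧ t = [] ∧ M' = M)) L' M t M' →
        ∃ tr, Loop (fun f M t M' =>
        (∃ h', Matches h S a f h' ∧ g.Run L h' M t M') ∨
        ((¬ ∃ h', Matches h S a f h') ∧ t = [] ∧ M' = M)) L' M tr M' ∧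
        Trace.Expand (fun h t => ∃ M₁ M₂, M₀ ⊆ M₁ ∧ M₁.Sound L ∧
          k.Run L h M₁ t M₂) tr t by
      obtain ⟨tr, h1, h2⟩ := this L (List.Subset.refl L) M t hM h0 hl
      exact ⟨none :: tr, ⟨tr, rfl, h1⟩, .tick h2⟩
    intro L'
    induction L' with
    | nil =>
      rintro - M t hM h0 ⟨rfl, rfl⟩
      exact ⟨[none], ⟨rfl, rfl⟩, .tick .nil⟩
    | cons f L' ih =>
      rintro hL M t hM h0 ⟨M₁, t₁, t₂, h1, h2, rfl⟩
      obtain ⟨s₁, hb, hs1, hg⟩ : ∃ s₁, ((∃ h', Matches h S a f h' ∧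
          g.Run L h' M s₁ M₁) ∨ ((¬ ∃ h', Matches h S a f h') ∧ s₁ = [] ∧ M₁ = M)) ∧
          Trace.Expand (fun h t => ∃ M₁ M₂, M₀ ⊆ M₁ ∧ M₁.Sound L ∧
            k.Run L h M₁ t M₂) s₁ t₁ ∧ Grow L M M₁ := by
        rcases h1 with ⟨h', hm, hB⟩ | ⟨hn, rfl, rfl⟩
        · have hs' := hs f (hL List.mem_cons_self) h' hm
          obtain ⟨s₁, h3, h4⟩ := run_bind hk hB hs' hM h0
          exact ⟨s₁, .inl ⟨h', hm, h3⟩, h4, Run.grow hB (hs'.bind hk) hM⟩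
        · exact ⟨[], .inr ⟨hn, rfl, rfl⟩, .nil, Grow.refl _⟩
      obtain ⟨s₂, h3, h4⟩ := ih (fun x hx => hL (List.mem_cons_of_mem _ hx)) M₁ t₂ (hg.2 hM)
        (h0.trans hg.1) h2
      exact ⟨none :: (s₁ ++ s₂), ⟨M₁, s₁, s₂, hb, h3, rfl⟩, .tick (hs1.append h4)⟩
  | .mark t, h, M, tr', M', hr, hs, hM, h0 => by
    obtain ⟨rfl, rfl⟩ := hr; exact ⟨[none], ⟨rfl, rfl⟩, .tick .nil⟩
  | .test t g, h, M, tr', M', hr, hs, hM, h0 => by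
    rcases hr with ⟨h1, t₁, h2, rfl⟩ | ⟨hn, rfl, rfl⟩
    · obtain ⟨s₁, h3, h4⟩ := run_bind hk h2 (hs (hM _ h1)) hM h0
      exact ⟨none :: s₁, .inl ⟨h1, s₁, h3, rfl⟩, .tick h4⟩
    · exact ⟨[none], .inr ⟨hn, rfl, rfl⟩, .tick .nil⟩

end Generators

/-! ### Guarded scans of a single atom -/

section Acyclic

variable {σ : Schema} {X : Type}

/-- Perform the tests before `g`. -/
def Filters.guard : Filters σ X → Gen σ X → Gen σ X
  | .nil, g => g
  | .cons a ys own next, g => .test ⟨a, ys, own⟩ (next.guard g)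

theorem Filters.soundAt_guard {L : List (Atom σ ℕ)} {g : Gen σ X} {h : X → ℕ} :
    ∀ {F : Filters σ X}, (F.Holds L h → g.SoundAt L h) → (F.guard g).SoundAt L h
  | .nil, H => H trivial
  | .cons _ _ _ next, H => fun ht => soundAt_guard (F := next) fun hn => H ⟨ht, hn⟩

/-- The tables contain all they should for assignments that agree with `h₀` on `Y`. -/
def Filters.Complete (L : List (Atom σ ℕ)) (Y : Finset X) (h₀ : X → ℕ) (M : Marks σ X)
    (F : Filters σ X) : Prop :=
  ∀ t ∈ F.tables, ∀ h : X → ℕ, (∀ y ∈ Y, h y = h₀ y) → t.keys.map h ∈ t.den L →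
    (t, t.keys.map h) ∈ M

theorem Filters.Complete.mono {L : List (Atom σ ℕ)} {Y : Finset X} {h₀ : X → ℕ}
    {M M' : Marks σ X} {F : Filters σ X} (h : F.Complete L Y h₀ M) (hM : M ⊆ M') :
    F.Complete L Y h₀ M' := fun t ht h' hh hd => hM (h t ht h' hh hd)

/-- Soundness makes a successful lookup truthful and completeness makes a failed one truthful, so
the lookups decide `F.Holds`. The number `n` counts the lookups performed. -/
theorem Filters.run_guard {L : List (Atom σ ℕ)} {Y : Finset X} {h₀ h : X → ℕ} {g : Gen σ X}
    (hh : ∀ y ∈ Y, h y = h₀ y) {M M' : Marks σ X} (hM : M.Sound L) :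
    ∀ {F : Filters σ X} {tr : Trace (X → ℕ)}, F.Complete L Y h₀ M →
    (F.guard g).Run L h M tr M' → ∃ n ≤ F.tables.length,
    (F.Holds L h ∧ ∃ t, g.Run L h M t M' ∧ tr = List.replicate n none ++ t) ∨
    (¬ F.Holds L h ∧ tr = List.replicate n none ∧ M' = M)
  | .nil, tr, _, hr => ⟨0, Nat.zero_le _, .inl ⟨trivial, tr, hr, rfl⟩⟩
  | .cons a ys own next, tr, hc, hr => by
    have hc' : ys.map h ∈ Table.den L ⟨a, ys, own⟩ → (⟨a, ys, own⟩, ys.map h) ∈ M :=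
      fun hd => hc ⟨a, ys, own⟩ List.mem_cons_self h hh hd
    rcases hr with ⟨h1, t₁, h2, rfl⟩ | ⟨h1, rfl, rfl⟩
    · obtain ⟨n, hn, H⟩ := run_guard (F := next) hh hM
        (fun t ht => hc t (List.mem_cons_of_mem _ ht)) h2
      refine ⟨n + 1, Nat.succ_le_succ hn, ?_⟩
      have hd := hM _ h1
      rcases H with ⟨H1, t, H2, rfl⟩ | ⟨H1, rfl, rfl⟩
      · exact .inl ⟨⟨hd, H1⟩, t, H2, by simp [List.replicate_succ]⟩
      · exact .inr ⟨fun H => H1 H.2, by simp [List.replicate_succ], rfl⟩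
    · exact ⟨1, Nat.succ_le_succ (Nat.zero_le _), .inr ⟨fun H => h1 (hc' H.1), rfl, rfl⟩⟩

theorem Matches.unique {h : X → ℕ} {S : Finset X} {a : Atom σ X} {f : Atom σ ℕ} {h₁ h₂ : X → ℕ}
    (h1 : Matches h S a f h₁) (h2 : Matches h S a f h₂) : h₁ = h₂ := by
  funext x
  by_cases hx : x ∈ S ∨ ¬ ∃ i, a.2 i = x
  · rw [h1.2 x hx, h2.2 x hx]
  · push Not at hx
    obtain ⟨-, i, rfl⟩ := hx
    have h3 := h1.1.trans h2.1.symm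
    exact congrFun (eq_of_heq (Sigma.mk.inj h3).2) i

/-- The assignment `h` changes `h₀` only on the variables of `A` not in `Y`. -/
def ChangesOnly (A : Set (Atom σ X)) (Y : Finset X) (h₀ h : X → ℕ) : Prop :=
  ∀ x, (x ∈ Y ∨ ¬ Occurs A x) → h x = h₀ x

theorem occurs_singleton {a : Atom σ X} {x : X} : Occurs {a} x ↔ ∃ i, a.2 i = x := by
  simp [Occurs]

-- A fact admits at most one matching assignment, and an assignment determines the fact, so no event
-- repeats when `L` has no duplicates. Each fact costs one unit for the loop, one per lookup and one
-- for the event.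
open Classical in
theorem Gen.run_scan_yield {L : List (Atom σ ℕ)} (hL : L.Nodup) {Y S : Finset X} {h₀ h : X → ℕ}
    (hYS : Y ⊆ S) (hh : ∀ y ∈ Y, h y = h₀ y) {a : Atom σ X} {F : Filters σ X} {M M' : Marks σ X}
    (hM : M.Sound L) (hF : F.Complete L Y h₀ M) {tr : Trace (X → ℕ)}
    (hr : (scan a S (F.guard yield)).Run L h M tr M') :
    (∀ h', some h' ∈ tr ↔ Atom.map h' a ∈ L ∧ ChangesOnly {a} S h h' ∧ F.Holds L h') ∧
    (∀ h', tr.count (some h') ≤ 1) ∧ tr.length ≤ (F.tables.length + 2) * (L.length + 1) := by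
  obtain ⟨t, rfl, hl⟩ := hr
  suffices ∀ L' : List (Atom σ ℕ), L'.Nodup → ∀ M t, M.Sound L → F.Complete L Y h₀ M →
      Loop (fun f M t M' =>
        (∃ h', Matches h S a f h' ∧ (F.guard yield).Run L h' M t M') ∨
        ((¬ ∃ h', Matches h S a f h') ∧ t = [] ∧ M' = M)) L' M t M' →
      (∀ h', some h' ∈ t ↔ Atom.map h' a ∈ L' ∧ ChangesOnly {a} S h h' ∧ F.Holds L h') ∧
      (∀ h', t.count (some h') ≤ 1) ∧ t.length ≤ (F.tables.length + 2) * L'.length + 1 by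
    obtain ⟨h1, h2, h3⟩ := this L hL M t hM hF hl
    refine ⟨fun h' => by simpa using h1 h', fun h' => by simpa using h2 h', ?_⟩
    rw [List.length_cons]
    nlinarith
  intro L'
  induction L' with
  | nil => rintro - M t hM - ⟨rfl, rfl⟩; simp
  | cons f L' ih =>
    rintro hn M t hM hF ⟨M₁, t₁, t₂, h1, h2, rfl⟩
    rw [List.nodup_cons] at hn
    obtain ⟨hg, hm, hc, hlen⟩ : Grow L M M₁ ∧
        (∀ h', some h' ∈ t₁ ↔ Matches h S a f h' ∧ F.Holds L h') ∧
        (∀ h', t₁.count (some h') ≤ 1) ∧ t₁.length ≤ F.tables.length + 1 := by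
      rcases h1 with ⟨h', hm, hB⟩ | ⟨hn, rfl, rfl⟩
      · have hg := Run.grow hB (Filters.soundAt_guard fun _ => trivial) hM
        refine ⟨hg, ?_⟩
        obtain ⟨n, hn, ⟨H1, t, ⟨rfl, -⟩, rfl⟩ | ⟨H1, rfl, -⟩⟩ := Filters.run_guard
          (fun y hy => (hm.2 y (.inl (hYS hy))).trans (hh y hy)) hM hF hB
        · refine ⟨fun h'' => ?_, fun h'' => ?_, by simpa using hn⟩
          · simp only [List.mem_append, List.mem_replicate, reduceCtorEq, and_false, false_or,
              List.mem_singleton, Option.some.injEq]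
            constructor
            · rintro rfl; exact ⟨hm, H1⟩
            · rintro ⟨H2, -⟩; exact H2.unique hm
          · simp only [List.count_append, List.count_replicate, List.count_singleton]
            simp only [beq_iff_eq, reduceCtorEq, if_false, zero_add]
            split_ifs <;> simp
        · refine ⟨fun h'' => ?_, fun h'' => ?_, by simpa using hn.trans (Nat.le_succ _)⟩
          · simp only [List.mem_replicate, reduceCtorEq, and_false, false_iff]
            rintro ⟨H2, H3⟩
            exact H1 (H2.unique hm ▸ H3)
          · simp [List.count_replicate]
      · refine ⟨Grow.refl _, fun h' => ?_, by simp, by simp⟩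
        simp only [List.not_mem_nil, false_iff, not_and]
        exact fun H => absurd ⟨h', H⟩ hn
    obtain ⟨h3, h4, h5⟩ := ih hn.2 M₁ t₂ (hg.2 hM) (hF.mono hg.1) h2
    have hm' : ∀ h', Matches h S a f h' ↔ Atom.map h' a = f ∧ ChangesOnly {a} S h h' := by
      intro h'; simp only [Matches, ChangesOnly, occurs_singleton]
    refine ⟨fun h' => ?_, fun h' => ?_, ?_⟩
    · simp only [List.mem_cons, reduceCtorEq, false_or, List.mem_append, hm, h3, hm']
      tauto
    · simp only [List.count_cons, List.count_append, beq_iff_eq, reduceCtorEq, if_false, add_zero]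
      by_cases h6 : some h' ∈ t₁
      · have h7 : some h' ∉ t₂ := by
          rw [h3]
          rintro ⟨h7, -⟩
          rw [((hm h').1 h6).1.1] at h7
          exact hn.1 h7
        rw [List.count_eq_zero_of_not_mem h7]
        exact hc h'
      · rw [List.count_eq_zero_of_not_mem h6, zero_add]
        exact h4 h'
    · simp only [List.length_cons, List.length_append]
      nlinarith

/-- The semijoin pass: each admissible fact leaves its key in `T`, and since entries are never
deleted, all these keys are present at the end. -/
theorem Gen.run_scan_mark {L : List (Atom σ ℕ)} {Y : Finset X} {h₀ : X → ℕ}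
    {a : Atom σ X} {F : Filters σ X} {T : Table σ X} {M M' : Marks σ X}
    (hT : ∀ h', Atom.map h' a ∈ L → F.Holds L h' → T.keys.map h' ∈ T.den L)
    (hM : M.Sound L) (hF : F.Complete L Y h₀ M) {tr : Trace (X → ℕ)}
    (hr : (scan a Y (F.guard (mark T))).Run L h₀ M tr M') :
    (∀ h', some h' ∉ tr) ∧ tr.length ≤ (F.tables.length + 2) * (L.length + 1) ∧
    ∀ h', Atom.map h' a ∈ L → ChangesOnly {a} Y h₀ h' → F.Holds L h' →
      (T, T.keys.map h') ∈ M' := by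
  obtain ⟨t, rfl, hl⟩ := hr
  suffices ∀ L' ⊆ L, ∀ M t, M.Sound L → F.Complete L Y h₀ M →
      Loop (fun f M t M' =>
        (∃ h', Matches h₀ Y a f h' ∧ (F.guard (mark T)).Run L h' M t M') ∨
        ((¬ ∃ h', Matches h₀ Y a f h') ∧ t = [] ∧ M' = M)) L' M t M' →
      (∀ h', some h' ∉ t) ∧ t.length ≤ (F.tables.length + 2) * L'.length + 1 ∧ M ⊆ M' ∧
      (∀ h', Atom.map h' a ∈ L' → ChangesOnly {a} Y h₀ h' → F.Holds L h' →
        (T, T.keys.map h') ∈ M') by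
    obtain ⟨h1, h2, -, h3⟩ := this L (List.Subset.refl L) M t hM hF hl
    refine ⟨fun h' => by simpa using h1 h', ?_, h3⟩
    rw [List.length_cons]
    nlinarith
  intro L'
  induction L' with
  | nil => rintro - M t hM - ⟨rfl, rfl⟩; simp
  | cons f L' ih =>
    rintro hL' M t hM hF ⟨M₁, t₁, t₂, h1, h2, rfl⟩
    obtain ⟨hg, hm, hlen, hmark⟩ : Grow L M M₁ ∧ (∀ h', some h' ∉ t₁) ∧
        t₁.length ≤ F.tables.length + 1 ∧
        ∀ h', Matches h₀ Y a f h' → F.Holds L h' → (T, T.keys.map h') ∈ M₁ := by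
      rcases h1 with ⟨h', hm, hB⟩ | ⟨hn, rfl, rfl⟩
      · have hg := Run.grow hB (Filters.soundAt_guard (hT h' (by
          rw [hm.1]; exact hL' List.mem_cons_self))) hM
        refine ⟨hg, ?_⟩
        obtain ⟨n, hn, ⟨H1, t, ⟨rfl, rfl⟩, rfl⟩ | ⟨H1, rfl, -⟩⟩ := Filters.run_guard
          (fun y hy => (hm.2 y (.inl hy))) hM hF hB
        · refine ⟨fun h'' => by simp, by simpa using hn, fun h'' H2 _ => ?_⟩
          rw [H2.unique hm]
          exact Set.mem_insert _ _
        · refine ⟨fun h'' => by simp, by simpa using hn.trans (Nat.le_succ _), fun h'' H2 H3 => ?_⟩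
          exact absurd (H2.unique hm ▸ H3) H1
      · exact ⟨Grow.refl _, by simp, by simp, fun h' H => absurd ⟨h', H⟩ hn⟩
    obtain ⟨h3, h4, h5, h6⟩ := ih (fun x hx => hL' (List.mem_cons_of_mem _ hx)) M₁ t₂ (hg.2 hM)
      (hF.mono hg.1) h2
    refine ⟨fun h' => ?_, ?_, hg.1.trans h5, fun h' h7 h8 h9 => ?_⟩
    · simp only [List.mem_cons, reduceCtorEq, false_or, List.mem_append, not_or]
      exact ⟨hm h', h3 h'⟩
    · simp only [List.length_cons, List.length_append]
      nlinarith
    · rcases List.mem_cons.1 h7 with h7 | h7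
      · exact h5 (hmark h' ⟨h7, by simpa only [ChangesOnly, occurs_singleton] using h8⟩ h9)
      · exact h6 h' h7 h8 h9

end Acyclic

/-! ### Enumeration of acyclic queries -/

section AcyclicGen

variable {σ : Schema} {X : Type} [DecidableEq X]

theorem FullCQ.mem_vars {q : FullCQ σ X} {x : X} : x ∈ q.vars ↔ Occurs (q : Set (Atom σ X)) x := by
  simp [FullCQ.vars, Occurs]

omit [DecidableEq X] in
theorem Filters.holds_congr {L : List (Atom σ ℕ)} {F : Filters σ X} {h h' : X → ℕ}
    (hF : ∀ t ∈ F.tables, ∀ y ∈ t.keys, h y = h' y) : F.Holds L h ↔ F.Holds L h' := by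
  rw [holds_iff, holds_iff]
  refine forall₂_congr fun t ht => ?_
  rw [List.map_congr_left (hF t ht)]

omit [DecidableEq X] in
theorem Atom.map_congr {a : Atom σ X} {h h' : X → ℕ} (H : ∀ i, h (a.2 i) = h' (a.2 i)) :
    Atom.map h a = Atom.map h' a := by
  simp only [Atom.map, H]

/-- Extension by the last atom of an ear order. -/
theorem changesOnly_cons {a : Atom σ X} {l : List (Atom σ X)} {Y : Finset X} {h₀ h : X → ℕ} :
    ChangesOnly {b | b ∈ a :: l} Y h₀ h ↔
    ChangesOnly {b | b ∈ l} Y h₀ (fun x => if x ∈ Y ∪ FullCQ.vars l.toFinset then h x else h₀ x) ∧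
    ChangesOnly {a} (Y ∪ FullCQ.vars l.toFinset)
      (fun x => if x ∈ Y ∪ FullCQ.vars l.toFinset then h x else h₀ x) h := by
  have hv : ∀ x, x ∈ FullCQ.vars l.toFinset ↔ Occurs {b | b ∈ l} x := by
    intro x; simp [FullCQ.mem_vars]
  have ho : ∀ x, Occurs {b | b ∈ a :: l} x ↔ Occurs {a} x ∨ Occurs {b | b ∈ l} x := by
    intro x; simp [Occurs]
  have hS : ∀ x, x ∈ Y ∪ FullCQ.vars l.toFinset ↔ x ∈ Y ∨ Occurs {b | b ∈ l} x := by
    intro x; rw [Finset.mem_union, hv]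
  simp only [ChangesOnly, ho]
  constructor
  · intro H
    refine ⟨fun x hx => ?_, fun x hx => ?_⟩
    · split_ifs with h1
      · rw [hS] at h1
        exact H x (by tauto)
      · rfl
    · split_ifs with h1
      · rfl
      · rw [hS] at h1 hx
        exact H x (by tauto)
  · rintro ⟨H1, H2⟩ x hx
    by_cases h1 : x ∈ Y ∪ FullCQ.vars l.toFinset
    · have := H1 x (by rw [hS] at h1; tauto)
      rwa [if_pos h1] at this
    · have := H2 x (by rw [hS] at h1 ⊢; tauto)
      rwa [if_neg h1] at this

/-- The ear `a` is traded for a test on its parent `p`: a table holds the values on `Y` and on the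
variables common to `a` and `p` of the facts for `a`. Solutions of the rest that pass this test
extend to `a`, so the closing scan of `a` always produces an event. The filters `F` are part of the
statement because the induction keeps adding to them. The keys contain `Y`, so entries made under
other values of `Y` do no harm. A list with one atom is treated separately, as its atom has no
parent. -/
theorem exists_gen_of_earOrder (Y : Finset X) : ∀ l : List (Atom σ X),
    EarOrder (fun a => {x | x ∉ Y ∧ ∃ i, a.2 i = x}) l → ∀ F : Atom σ X → Filters σ X,
    (∀ a ∈ l, ∀ t ∈ (F a).tables, ∀ y ∈ t.keys, y ∈ Y ∨ ∃ i, a.2 i = y) →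
    ∃ (g : Gen σ X) (c : ℕ), ∀ L : List (Atom σ ℕ), L.Nodup → (∀ h, g.SoundAt L h) ∧
      ∀ h₀ M tr M', M.Sound L → (∀ a ∈ l, (F a).Complete L Y h₀ M) → g.Run L h₀ M tr M' →
      (∀ h, some h ∈ tr ↔ (∀ a ∈ l, Atom.map h a ∈ L ∧ (F a).Holds L h) ∧
        ChangesOnly {a | a ∈ l} Y h₀ h) ∧
      (∀ h, (open Classical in tr.count (some h)) ≤ 1) ∧ tr.Gap (c * (L.length + 1)) 0
  | [], _, F, _ => by
    refine ⟨.yield, 1, fun L _ => ⟨fun _ => trivial, ?_⟩⟩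
    rintro h₀ M tr M' - - ⟨rfl, -⟩
    refine ⟨fun h => ?_, fun h => ?_, Trace.gap_of_length (by simp)⟩
    · simp only [List.mem_singleton, Option.some.injEq, ChangesOnly, Occurs, List.not_mem_nil,
        Set.ofPred_false, Set.mem_empty_iff_false, false_and, exists_false, not_false_eq_true,
        or_true, false_imp_iff, implies_true, true_and, forall_const]
      exact funext_iff
    · classical rw [List.count_singleton]; split_ifs <;> simp
  | [a], _, F, hF => by
    refine ⟨.scan a Y ((F a).guard .yield), (F a).tables.length + 2, fun L hL =>
      ⟨fun h f _ h' _ => Filters.soundAt_guard fun _ => trivial, ?_⟩⟩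
    intro h₀ M tr M' hM hc hr
    obtain ⟨h1, h2, h3⟩ := Gen.run_scan_yield hL subset_rfl (fun _ _ => rfl) hM
      (hc a List.mem_cons_self) hr
    refine ⟨fun h => ?_, h2, Trace.gap_of_length (by simpa using h3)⟩
    rw [h1]
    simp only [List.mem_singleton, forall_eq, Set.ofPred_eq_eq_singleton]
    tauto
  | a :: b :: l, hear, F, hF => by
    obtain ⟨hp, hear⟩ := hear
    obtain ⟨p, hpl, hp⟩ := hp.resolve_left (by simp)
    generalize hl : b :: l = l' at *
    set ys : List X := Y.toList ++ (Finset.univ.image a.2 ∩ Finset.univ.image p.2).toList with hys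
    have hmem : ∀ y, y ∈ ys ↔ y ∈ Y ∨ (∃ i, a.2 i = y) ∧ ∃ i, p.2 i = y := by
      intro y; simp [hys]
    set F' : Atom σ X → Filters σ X := fun b => if b = p then .cons a ys (F a) (F p) else F b
      with hF'
    set T : Table σ X := ⟨a, ys, F a⟩ with hT
    have hFp : F' p = .cons a ys (F a) (F p) := if_pos rfl
    have hFn : ∀ b, b ≠ p → F' b = F b := fun b hb => if_neg hb
    have haY : ∀ t ∈ (F a).tables, ∀ y ∈ t.keys, y ∈ Y ∨ ∃ i, a.2 i = y :=
      hF a List.mem_cons_self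
    obtain ⟨g, c, hg⟩ := exists_gen_of_earOrder Y l' hear F' (by
      intro b hb t ht y hy
      by_cases hbp : b = p
      · subst hbp
        rw [hFp] at ht
        rcases List.mem_cons.1 ht with rfl | ht
        · have := (hmem y).1 hy
          tauto
        · exact hF b (List.mem_cons_of_mem _ hb) t ht y hy
      · rw [hFn b hbp] at ht
        exact hF b (List.mem_cons_of_mem _ hb) t ht y hy)
    set S : Finset X := Y ∪ FullCQ.vars l'.toFinset with hS
    have hSmem : ∀ x, x ∈ S ↔ x ∈ Y ∨ Occurs {b | b ∈ l'} x := by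
      intro x; simp [hS, FullCQ.mem_vars]
    set m := (F a).tables.length + 2 with hm
    -- The marking scan contributes `m`; the rest is an expansion of delay `c` by traces of length
    -- governed by `m`, hence `c + 2 * m` by `Trace.Expand.gap`.
    refine ⟨.seq (.scan a Y ((F a).guard (.mark T))) (g.bind (.scan a S ((F a).guard .yield))),
      m + (c + 2 * m), fun L hL => ?_⟩
    obtain ⟨hgs, hg⟩ := hg L hL
    have hTden : ∀ h', Atom.map h' a ∈ L → (F a).Holds L h' → T.keys.map h' ∈ T.den L :=
      fun h' h1 h2 => ⟨h', h1, h2, rfl⟩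
    have hks : ∀ h, (Gen.scan a S ((F a).guard .yield)).SoundAt L h :=
      fun h f _ h' _ => Filters.soundAt_guard fun _ => trivial
    have hms : ∀ h, (Gen.scan a Y ((F a).guard (.mark T))).SoundAt L h :=
      fun h f hf h' hm => Filters.soundAt_guard fun hH => hTden h' (by rwa [hm.1]) hH
    refine ⟨fun h => ⟨hms h, (hgs h).bind hks⟩, ?_⟩
    rintro h₀ M tr M' hM hc ⟨M₁, t₁, t₂, h1, h2, rfl⟩
    have hca := hc a List.mem_cons_self
    have hgrow := Gen.Run.grow h1 (hms _) hM
    have hM₁ := hgrow.2 hM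
    obtain ⟨hsil, hlen, hmark⟩ := Gen.run_scan_mark hTden hM hca h1
    obtain ⟨t, ht, hex⟩ := Gen.run_bind hks (M₀ := M₁) h2 (hgs _) hM₁ subset_rfl
    have hTc : ∀ h : X → ℕ, (∀ y ∈ Y, h y = h₀ y) → T.keys.map h ∈ T.den L →
        (T, T.keys.map h) ∈ M₁ := by
      rintro h hh ⟨h', ha, hH, hk⟩
      have hk' : ∀ y ∈ ys, h' y = h y := by simpa using hk
      have hY : ∀ y ∈ Y, h' y = h₀ y := fun y hy =>
        (hk' y ((hmem y).2 (.inl hy))).trans (hh y hy)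
      -- The witness `h'` is arbitrary off `a`, whereas the marking scan starts from `h₀` and
      -- changes only variables of `a`; so `h'` is reset to `h₀` elsewhere.
      let h'' : X → ℕ := fun x => if ∃ i, a.2 i = x then h' x else h₀ x
      have hag : ∀ y, (y ∈ Y ∨ ∃ i, a.2 i = y) → h'' y = h' y := by
        intro y hy
        simp only [h'']
        split_ifs with hi
        · rfl
        · exact (hY y (hy.resolve_right hi)).symm
      have := hmark h'' (by rwa [Atom.map_congr (h' := h') fun i => hag _ (.inr ⟨i, rfl⟩)]) (by
          intro x hx
          rw [occurs_singleton] at hx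
          by_cases hi : ∃ i, a.2 i = x
          · rw [hag x (.inr hi), hY x (hx.resolve_right (not_not.2 hi))]
          · simp only [h'', if_neg hi])
        ((Filters.holds_congr fun t ht y hy => hag y (haY t ht y hy)).2 hH)
      rwa [List.map_congr_left (g := h) fun y hy => (hag y (by
        have := (hmem y).1 hy; tauto)).trans (hk' y hy)] at this
    obtain ⟨hsol, hcnt, hgap⟩ := hg h₀ M₁ t M' hM₁ (by
      intro b hb
      by_cases hbp : b = p
      · subst hbp
        rw [hFp]
        intro t ht
        rcases List.mem_cons.1 ht with rfl | ht
        · exact hTc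
        · exact (hc b (List.mem_cons_of_mem _ hb)).mono hgrow.1 t ht
      · rw [hFn b hbp]
        exact (hc b (List.mem_cons_of_mem _ hb)).mono hgrow.1) ht
    have hstep : ∀ h' t', some h' ∈ t → (∃ M₂ M₃, M₁ ⊆ M₂ ∧ M₂.Sound L ∧
        (Gen.scan a S ((F a).guard .yield)).Run L h' M₂ t' M₃) →
        (∀ h, some h ∈ t' ↔ Atom.map h a ∈ L ∧ ChangesOnly {a} S h' h ∧ (F a).Holds L h) ∧
        (∀ h, (open Classical in t'.count (some h)) ≤ 1) ∧ t'.length ≤ m * (L.length + 1) := by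
      rintro h' t' hh' ⟨M₂, M₃, hM₂, hs₂, hr⟩
      exact Gen.run_scan_yield hL Finset.subset_union_left
        (fun y hy => ((hsol h').1 hh').2 y (.inl hy)) hs₂ (hca.mono (hgrow.1.trans hM₂)) hr
    -- solutions without `a` are restrictions of solutions
    have hres : ∀ h' h, ChangesOnly {a} S h' h → ChangesOnly {b | b ∈ l'} Y h₀ h' →
        h' = fun x => if x ∈ S then h x else h₀ x := by
      intro h' h h1 h2
      funext x
      split_ifs with hx
      · exact (h1 x (.inl hx)).symm
      · rw [hSmem, not_or] at hx
        exact h2 x (.inr hx.2)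
    refine ⟨fun h => ?_, fun h => ?_, ?_⟩
    · rw [List.mem_append, or_iff_right (hsil h),
        hex.mem_iff fun h' t' hh' ht' => (hstep h' t' hh' ht').1 h, changesOnly_cons, ← hS]
      have hcong : ∀ h', h' = (fun x => if x ∈ S then h x else h₀ x) → ∀ b ∈ l',
          (Atom.map h' b = Atom.map h b) ∧ ((F b).Holds L h' ↔ (F b).Holds L h) ∧
          ((F' b).Holds L h' ↔ (F' b).Holds L h) := by
        rintro h' rfl b hb
        have hbS : ∀ i, b.2 i ∈ S := fun i => (hSmem _).2 (.inr ⟨b, hb, i, rfl⟩)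
        have hkS : ∀ t ∈ (F b).tables, ∀ y ∈ t.keys, y ∈ S := by
          intro t ht y hy
          rcases hF b (List.mem_cons_of_mem _ hb) t ht y hy with h1 | ⟨i, rfl⟩
          · exact (hSmem _).2 (.inl h1)
          · exact hbS i
        refine ⟨Atom.map_congr fun i => if_pos (hbS i),
          Filters.holds_congr fun t ht y hy => if_pos (hkS t ht y hy),
          Filters.holds_congr fun t ht y hy => if_pos ?_⟩
        by_cases hbp : b = p
        · subst hbp
          rw [hFp] at ht
          rcases List.mem_cons.1 ht with rfl | ht
          · rcases (hmem y).1 hy with h1 | ⟨-, i, rfl⟩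
            · exact (hSmem _).2 (.inl h1)
            · exact hbS i
          · exact hkS t ht y hy
        · rw [hFn b hbp] at ht
          exact hkS t ht y hy
      constructor
      · rintro ⟨h', hh', ha, hch, hH⟩
        obtain ⟨hs, hch'⟩ := (hsol h').1 hh'
        have he := hres h' h hch hch'
        refine ⟨fun b hb => ?_, by rwa [← he], by rwa [← he]⟩
        rcases List.mem_cons.1 hb with rfl | hb
        · exact ⟨ha, hH⟩
        · obtain ⟨hc1, hc2, -⟩ := hcong h' he b hb
          rw [← hc1, ← hc2]
          refine ⟨(hs b hb).1, ?_⟩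
          have h3 := (hs b hb).2
          by_cases hbp : b = p
          · subst hbp
            rw [hFp] at h3
            exact h3.2
          · rwa [hFn b hbp] at h3
      · rintro ⟨hs, hch', hch⟩
        refine ⟨_, (hsol _).2 ⟨fun b hb => ?_, hch'⟩, (hs a List.mem_cons_self).1, hch,
          (hs a List.mem_cons_self).2⟩
        obtain ⟨hc1, -, hc3⟩ := hcong _ rfl b hb
        rw [hc1, hc3]
        refine ⟨(hs b (List.mem_cons_of_mem _ hb)).1, ?_⟩
        have h3 := (hs b (List.mem_cons_of_mem _ hb)).2
        by_cases hbp : b = p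
        · subst hbp
          rw [hFp]
          exact ⟨⟨h, (hs a List.mem_cons_self).1, (hs a List.mem_cons_self).2, rfl⟩, h3⟩
        · rwa [hFn b hbp]
    · classical
      rw [List.count_append, List.count_eq_zero_of_not_mem (hsil h), zero_add]
      -- Only the restriction of `h` to `S` can produce `h`, so the second source gets multiplicity
      -- zero.
      have := hex.count_le (y := h) (r₁ := fun x => if x ∈ S then h x else h₀ x) (r₂ := h₀)
        (k₁ := 1) (k₂ := 0) (by
          intro h' t' hh' ht'
          obtain ⟨h3, h4, -⟩ := hstep h' t' hh' ht'
          by_cases h5 : some h ∈ t'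
          · rw [if_pos (hres h' h ((h3 h).1 h5).2.1 ((hsol h').1 hh').2)]
            exact (h4 h).trans (Nat.le_add_right _ _)
          · rw [List.count_eq_zero_of_not_mem h5]
            exact Nat.zero_le _)
      rw [mul_one, mul_zero, add_zero] at this
      exact this.trans (hcnt _)
    · have hne : ∀ h' t', some h' ∈ t → (∃ M₂ M₃, M₁ ⊆ M₂ ∧ M₂.Sound L ∧
          (Gen.scan a S ((F a).guard .yield)).Run L h' M₂ t' M₃) →
          t'.Gap (m * (L.length + 1)) 0 ∧ ∃ h, some h ∈ t' := by
        intro h' t' hh' ht'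
        obtain ⟨h3, -, h5⟩ := hstep h' t' hh' ht'
        refine ⟨Trace.gap_of_length (by simpa using h5), ?_⟩
        obtain ⟨hs, hch⟩ := (hsol h').1 hh'
        have h6 := (hs p hpl).2
        rw [hFp] at h6
        obtain ⟨⟨h'', ha, hH, hk⟩, -⟩ := h6
        have hk' : ∀ y ∈ ys, h'' y = h' y := by simpa using hk
        -- The solution `h'` of the rest is glued to the fact for `a` that the table promises. They
        -- are compatible: by the ear property a variable of `a` in `S` but not in `Y` occurs in
        -- `p`, hence is a key.
        let h : X → ℕ := fun x => if x ∈ S then h' x else if ∃ i, a.2 i = x then h'' x else h' x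
        have hag : ∀ y, (y ∈ Y ∨ ∃ i, a.2 i = y) → h y = h'' y := by
          intro y hy
          simp only [h]
          split_ifs with h7 h8
          · refine (hk' y ((hmem y).2 ?_)).symm
            rw [or_iff_not_imp_left]
            intro hyY
            have h9 := hy.resolve_left hyY
            obtain ⟨u, hu, hxu⟩ := ((hSmem y).1 h7).resolve_left hyY
            exact ⟨h9, (hp y ⟨hyY, h9⟩ u hu ⟨hyY, hxu⟩).2⟩
          · rfl
          · exact absurd ((hSmem y).2 (.inl (hy.resolve_right h8))) h7
        refine ⟨h, (h3 h).2 ⟨?_, ?_, ?_⟩⟩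
        · rwa [Atom.map_congr (h' := h'') fun i => hag _ (.inr ⟨i, rfl⟩)]
        · intro x hx
          rw [occurs_singleton] at hx
          simp only [h]
          split_ifs with h7 h8
          · rfl
          · exact absurd (hx.resolve_left h7) (not_not.2 h8)
          · rfl
        · exact (Filters.holds_congr fun t ht y hy => hag y (haY t ht y hy)).2 hH
      have h3 := hex.gap hne hgap (b := m * (L.length + 1)) (by omega)
      refine Trace.gap_silent_append hsil ?_
      rw [← hm] at hlen
      exact h3.mono (by nlinarith) (by omega)
  termination_by l => l.length
  decreasing_by simp_wf

end AcyclicGen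

/-! ### Images and untangling -/

section Untangle

variable {σ : Schema} {X : Type}

/-- On every list of facts, `g` extends the assignment of `Y` to exactly the solutions of `A`, each
of which occurs at most `K` times, and with linear delay. -/
def Gen.Enumerates (g : Gen σ X) (A : Set (Atom σ X)) (Y : Finset X) (K c : ℕ) : Prop :=
  ∀ L : List (Atom σ ℕ), L.Nodup → (∀ h, g.SoundAt L h) ∧
    ∀ h₀ M tr M', M.Sound L → g.Run L h₀ M tr M' →
      (∀ h, some h ∈ tr ↔ (∀ a ∈ A, Atom.map h a ∈ L) ∧ ChangesOnly A Y h₀ h) ∧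
      (∀ h, (open Classical in tr.count (some h)) ≤ K) ∧ tr.Gap (c * (L.length + 1)) 0

-- Each solution `h₁` of `I` yields the event `h₁ ∘ μ` before the possibly fruitless search for its
-- extensions; this keeps the delay linear. A solution `h` of `A` comes from at most two assignments
-- `h₁`: its own restriction, giving at most `K₁ * K₂` occurrences, and the one with `h = h₁ ∘ μ`,
-- giving at most `K₁`. The latter is unique because `ν` maps onto the variables of `I` outside `Y`.
open Classical in
theorem Gen.Enumerates.of_image {A I : Set (Atom σ X)} {Y Y' : Finset X} {ν : X → X}
    {g₁ g₂ : Gen σ X} {K₁ K₂ c₁ c₂ : ℕ} (hIA : I ⊆ A)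
    (hY' : ∀ x, x ∈ Y' ↔ x ∈ Y ∨ Occurs I x) (hνY : ∀ y ∈ Y, ν y = y)
    (hνI : ∀ a ∈ A, Atom.map ν a ∈ I)
    (hνs : ∀ x, Occurs I x → x ∉ Y → ∃ z, Occurs A z ∧ z ∉ Y ∧ ν z = x)
    (h₁ : g₁.Enumerates I Y K₁ c₁) (h₂ : g₂.Enumerates (A \ I) Y' K₂ c₂) :
    ∃ g : Gen σ X, g.Enumerates A Y (K₁ + K₁ * K₂) (c₁ + 2 * c₂) := by
  choose! ρ hρ using hνs
  -- Variables that do not occur in `A` must keep their values from `h₀`, so `ν` is cut off to the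
  -- identity there.
  set μ : X → X := fun x => if Occurs A x ∧ x ∉ Y then ν x else x with hμ
  have hμa : ∀ a ∈ A, ∀ i, μ (a.2 i) = ν (a.2 i) := by
    intro a ha i
    simp only [hμ]
    split_ifs with h
    · rfl
    · have : a.2 i ∈ Y := by
        by_contra hY
        exact h ⟨⟨a, ha, i, rfl⟩, hY⟩
      exact (hνY _ this).symm
  have hμn : ∀ x, (x ∈ Y ∨ ¬ Occurs A x) → μ x = x := fun x hx => if_neg (by tauto)
  have hOI : ∀ x, Occurs I x → Occurs A x := fun x ⟨a, ha, i⟩ => ⟨a, hIA ha, i⟩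
  have hOd : ∀ x, Occurs A x → Occurs I x ∨ Occurs (A \ I) x := by
    rintro x ⟨a, ha, i⟩
    by_cases h : a ∈ I
    · exact .inl ⟨a, h, i⟩
    · exact .inr ⟨a, ⟨ha, h⟩, i⟩
  have hOD : ∀ x, Occurs (A \ I) x → Occurs A x := fun x ⟨a, ha, i⟩ => ⟨a, ha.1, i⟩
  refine ⟨g₁.bind (.seq (.rebind μ .yield) g₂), fun L hL => ?_⟩
  obtain ⟨hs₁, h₁⟩ := h₁ L hL
  obtain ⟨hs₂, h₂⟩ := h₂ L hL
  have hks : ∀ h, (Gen.seq (.rebind μ .yield) g₂).SoundAt L h := fun h => ⟨trivial, hs₂ h⟩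
  refine ⟨fun h => (hs₁ h).bind hks, fun h₀ M tr M' hM hr => ?_⟩
  obtain ⟨t, ht, hex⟩ := Gen.run_bind hks (M₀ := M) hr (hs₁ _) hM subset_rfl
  obtain ⟨hsol, hcnt, hgap⟩ := h₁ h₀ M t M' hM ht
  have hstep : ∀ h₁ t', some h₁ ∈ t → (∃ M₂ M₃, M ⊆ M₂ ∧ M₂.Sound L ∧
      (Gen.seq (.rebind μ .yield) g₂).Run L h₁ M₂ t' M₃) → ∃ t₂, t' = some (h₁ ∘ μ) :: t₂ ∧
      (∀ h, some h ∈ t₂ ↔ (∀ a ∈ A \ I, Atom.map h a ∈ L) ∧ ChangesOnly (A \ I) Y' h₁ h) ∧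
      (∀ h, t₂.count (some h) ≤ K₂) ∧ Trace.Gap (c₂ * (L.length + 1)) 0 t₂ := by
    rintro h₁ t' - ⟨M₂, M₃, -, hM₂, M₄, t₁, t₂, ⟨rfl, hg⟩, hr₂, rfl⟩
    exact ⟨t₂, rfl, h₂ h₁ M₄ t₂ M₃ (hg.2 hM₂) hr₂⟩
  have hres : ∀ h₁ h, ChangesOnly (A \ I) Y' h₁ h → ChangesOnly I Y h₀ h₁ →
      h₁ = fun x => if x ∈ Y' then h x else h₀ x := by
    intro h₁ h hch hch₁
    funext x
    split_ifs with hx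
    · exact (hch x (.inl hx)).symm
    · rw [hY'] at hx
      exact hch₁ x (by tauto)
  refine ⟨fun h => ?_, fun h => ?_, ?_⟩
  · rw [hex.mem_iff (Q := fun h₁ => h = h₁ ∘ μ ∨ ((∀ a ∈ A \ I, Atom.map h a ∈ L) ∧
      ChangesOnly (A \ I) Y' h₁ h)) (by
        intro h₁ t' hh₁ ht'
        obtain ⟨t₂, rfl, h3, -⟩ := hstep h₁ t' hh₁ ht'
        rw [List.mem_cons, h3, Option.some.injEq])]
    constructor
    · rintro ⟨h₁, hh₁, rfl | ⟨hA, hch⟩⟩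
      · obtain ⟨hI, hch₁⟩ := (hsol h₁).1 hh₁
        refine ⟨fun a ha => ?_, fun x hx => ?_⟩
        · have : Atom.map (h₁ ∘ μ) a = Atom.map h₁ (Atom.map ν a) := by
            simp only [Atom.map, Function.comp, hμa a ha]
          rw [this]
          exact hI _ (hνI a ha)
        · rw [Function.comp, hμn x hx]
          exact hch₁ x (by have := hOI x; tauto)
      · obtain ⟨hI, hch₁⟩ := (hsol h₁).1 hh₁
        refine ⟨fun a ha => ?_, fun x hx => ?_⟩
        · by_cases haI : a ∈ I
          · rw [Atom.map_congr (h' := h₁) fun i => hch _ (.inl ((hY' _).2 (.inr ⟨a, haI, i, rfl⟩)))]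
            exact hI a haI
          · exact hA a ⟨ha, haI⟩
        · rw [hch x (by have := hOD x; have := hY' x; tauto)]
          exact hch₁ x (by have := hOI x; tauto)
    -- Every solution is reached as an extension of its restriction; completeness does not depend on
    -- the events `h₁ ∘ μ`.
    · rintro ⟨hA, hch⟩
      refine ⟨fun x => if x ∈ Y' then h x else h₀ x, (hsol _).2 ⟨fun a ha => ?_, fun x hx => ?_⟩,
        .inr ⟨fun a ha => hA a ha.1, fun x hx => ?_⟩⟩
      · rw [Atom.map_congr (h' := h) fun i => if_pos ((hY' _).2 (.inr ⟨a, ha, i, rfl⟩))]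
        exact hA a (hIA ha)
      · dsimp only
        split_ifs with h1
        · rw [hY'] at h1
          exact hch x (by tauto)
        · rfl
      · dsimp only
        split_ifs with h1
        · rfl
        · rw [hY'] at h1
          exact hch x (by have := hOd x; have := hY' x; tauto)
  -- If `h = h₁ ∘ μ`, then `h₁ x = h (ρ x)` for the chosen preimage `ρ x` of `x` under `ν`; this
  -- recovers `h₁` from `h`.
  · have := hex.count_le (y := h) (r₁ := fun x => if Occurs I x ∧ x ∉ Y then h (ρ x) else h₀ x)
      (r₂ := fun x => if x ∈ Y' then h x else h₀ x) (k₁ := 1) (k₂ := K₂) (by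
        intro h₁ t' hh₁ ht'
        obtain ⟨t₂, rfl, h3, h4, -⟩ := hstep h₁ t' hh₁ ht'
        have hch₁ := ((hsol h₁).1 hh₁).2
        rw [List.count_cons, add_comm]
        refine add_le_add ?_ ?_
        · simp only [beq_iff_eq, Option.some.injEq]
          split_ifs with h5 h6
          · exact le_rfl
          · refine absurd ?_ h6
            funext x
            split_ifs with h7
            · obtain ⟨h8, h9, h10⟩ := hρ x h7.1 h7.2
              rw [← h5, Function.comp]
              simp only [hμ]
              rw [if_pos ⟨h8, h9⟩, h10]
            · exact hch₁ x (by tauto)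
          · exact Nat.zero_le _
          · exact le_rfl
        · by_cases h5 : some h ∈ t₂
          · rw [if_pos (hres h₁ h ((h3 h).1 h5).2 hch₁)]
            exact h4 h
          · rw [List.count_eq_zero_of_not_mem h5]
            exact Nat.zero_le _)
    rw [mul_one] at this
    exact this.trans (add_le_add (hcnt _) (Nat.mul_le_mul_right _ (hcnt _)))
  · refine (hex.gap (D₂ := c₂ * (L.length + 1)) ?_ hgap (Nat.zero_le _)).mono
      (by nlinarith) le_rfl
    intro h₁ t' hh₁ ht'
    obtain ⟨t₂, rfl, -, -, h5⟩ := hstep h₁ t' hh₁ ht'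
    exact ⟨⟨Nat.zero_le _, h5⟩, _, List.mem_cons_self⟩

variable [DecidableEq X]

theorem Atom.exists_strip {Y : Finset X} {a : Atom σ X} {x : X} :
    (∃ j, (Atom.strip Y a).2 j = x) ↔ x ∉ Y ∧ ∃ i, a.2 i = x := by
  constructor
  · rintro ⟨j, rfl⟩
    refine ⟨?_, _, rfl⟩
    have := (Finset.mem_filter.1 (Finset.orderEmbOfFin_mem (Finset.univ.filter fun i =>
      (if a.2 i ∈ Y then some (a.2 i) else none) = none) rfl j)).2
    exact fun h => Option.some_ne_none _ ((if_pos h).symm.trans this)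
  · rintro ⟨hx, i, rfl⟩
    have hi : i ∈ Set.range ((Finset.univ.filter fun i =>
        (if a.2 i ∈ Y then some (a.2 i) else none) = none).orderEmbOfFin rfl) := by
      rw [Finset.range_orderEmbOfFin]
      simpa using hx
    obtain ⟨j, hj⟩ := hi
    exact ⟨j, congrArg a.2 hj⟩

/-- The symbol of a stripped atom records which variable stood at each removed position, so `a` and
`b` agree there; the kept positions are related by `ν`. -/
theorem Atom.eq_map_of_strip {Y : Finset X} {ν : X → X} {a b : Atom σ X}
    (h : Atom.strip Y b = Atom.map ν (Atom.strip Y a)) :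
    b = Atom.map (fun x => if x ∈ Y then x else ν x) a := by
  obtain ⟨R, z⟩ := a
  obtain ⟨R', w⟩ := b
  -- The type of the argument tuple depends on `p`. With `p` and `p'` as variables, `p' = p` can be
  -- substituted before the tuples are compared.
  have key : ∀ (p p' : Fin (σ.arity R) → Option X) (w z : Fin (σ.arity R) → X), p' = p →
      (⟨⟨R, p'⟩, fun j => w ((Finset.univ.filter fun i => p' i = none).orderEmbOfFin rfl j)⟩ :
        Atom (σ.untangle X) X) =
      ⟨⟨R, p⟩, fun j => z ((Finset.univ.filter fun i => p i = none).orderEmbOfFin rfl j)⟩ →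
      ∀ i, p i = none → w i = z i := by
    rintro _ p w z rfl h i hi
    have h1 := eq_of_heq (Sigma.mk.inj h).2
    have hi : i ∈ Set.range ((Finset.univ.filter fun i => p i = none).orderEmbOfFin rfl) := by
      rw [Finset.range_orderEmbOfFin]
      simpa using hi
    obtain ⟨j, rfl⟩ := hi
    exact congrFun h1 j
  have h1 := congrArg (fun c => c.1) h
  obtain rfl : R' = R := congrArg (fun c => c.1) h1
  have h2 := eq_of_heq (Sigma.mk.inj h1).2
  have h3 := key _ _ w (fun i => ν (z i)) h2 h
  refine Sigma.ext rfl (heq_of_eq (funext fun i => ?_))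
  have h4 := congrFun h2 i
  have h5 := h3 i
  simp only [Atom.map] at h4 h5 ⊢
  by_cases h6 : z i ∈ Y
  · rw [if_pos h6] at h4 ⊢
    split_ifs at h4 with h7
    exact Option.some.inj h4
  · rw [if_neg h6] at h5 ⊢
    exact h5 rfl

theorem Atom.strip_injective (Y : Finset X) : Function.Injective (Atom.strip (σ := σ) Y) := by
  intro a b h
  have := Atom.eq_map_of_strip (ν := id) (a := b) (b := a) h
  rw [this]
  simp [Atom.map]

/-- The atoms of `q` are those of a query over another schema with the variables in `Y` removed. -/
structure Flattens {τ : Schema} (φ : Atom τ X → Atom σ X) (q : FullCQ τ X) (Y : Finset X) :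
    Prop where
  disj : ∀ a ∈ q, ∀ i, a.2 i ∉ Y
  vars : ∀ a ∈ q, ∀ x, x ∉ Y → ((∃ i, (φ a).2 i = x) ↔ ∃ i, a.2 i = x)
  map : ∀ a ∈ q, ∀ b ∈ q, ∀ ν : X → X, b = Atom.map ν a →
    φ b = Atom.map (fun x => if x ∈ Y then x else ν x) (φ a)
  inj : Set.InjOn φ q

theorem Flattens.mono {τ : Schema} {φ : Atom τ X → Atom σ X} {q I : FullCQ τ X} {Y : Finset X}
    (h : Flattens φ q Y) (hI : I ⊆ q) : Flattens φ I Y :=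
  ⟨fun a ha => h.disj a (hI ha), fun a ha => h.vars a (hI ha),
    fun a ha b hb => h.map a (hI ha) b (hI hb), h.inj.mono hI⟩

/-- Outside `Y` an atom and its original have the same variables, so a join tree of `q` gives an ear
order of the original atoms relative to `Y`. -/
theorem Flattens.exists_gen_of_isAcyclic {τ : Schema} {φ : Atom τ X → Atom σ X}
    {q : FullCQ τ X} {Y : Finset X} (h : Flattens φ q Y) (hq : q.IsAcyclic) :
    ∃ (g : Gen σ X) (K c : ℕ), g.Enumerates (φ '' q) Y K c := by
  obtain ⟨l, hl, hear⟩ : ∃ l : List (Atom σ X), {a | a ∈ l} = φ '' q ∧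
      EarOrder (fun a => {x | x ∉ Y ∧ ∃ i, a.2 i = x}) l := by
    rcases hq with rfl | ⟨T, hT, hc⟩
    · exact ⟨[], by simp, trivial⟩
    · obtain ⟨l, -, hl, hear⟩ := exists_earOrder_of_isTree _ _ rfl T hT
        (fun a => {x | ∃ i, a.1.2 i = x}) hc
      refine ⟨l.map fun a => φ a.1, ?_, EarOrder.map _ _ l ?_⟩
      · ext a
        simp [hl]
      · convert hear using 2 with a
        ext x
        constructor
        · rintro ⟨h1, h2⟩
          exact (h.vars a.1 a.2 x h1).1 h2
        · rintro ⟨i, rfl⟩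
          exact ⟨h.disj a.1 a.2 i, (h.vars a.1 a.2 _ (h.disj a.1 a.2 i)).2 ⟨i, rfl⟩⟩
  obtain ⟨g, c, hg⟩ := exists_gen_of_earOrder Y l hear (fun _ => .nil)
    (by simp [Filters.tables])
  refine ⟨g, 1, c, fun L hL => ⟨(hg L hL).1, fun h₀ M tr M' hM hr => ?_⟩⟩
  have := (hg L hL).2 h₀ M tr M' hM (fun a _ t ht => by simp [Filters.tables] at ht) hr
  rw [hl] at this
  refine ⟨fun h => ?_, this.2⟩
  rw [this.1, ← hl]
  simp [Filters.Holds]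

/-- Stripping is injective, so composing `φ` with its inverse leads from the untangled atoms back to
the original ones, while the variables of `I` join `Y`. -/
theorem Flattens.untangle {τ : Schema} [Nonempty (Atom τ X)] {φ : Atom τ X → Atom σ X}
    {q I : FullCQ τ X} {Y : Finset X} (h : Flattens φ q Y) (hI : I ⊆ q) :
    ∃ φ' : Atom (τ.untangle X) X → Atom σ X, Flattens φ' (q.untangle I) (Y ∪ I.vars) ∧
      φ' '' (q.untangle I) = φ '' q \ φ '' I := by
  set ψ := Function.invFun (Atom.strip (σ := τ) I.vars)
  have hψ : ∀ a, ψ (Atom.strip I.vars a) = a :=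
    Function.leftInverse_invFun (Atom.strip_injective I.vars)
  have hmem : ∀ b, b ∈ q.untangle I ↔ ∃ a, (a ∈ q ∧ a ∉ I) ∧ Atom.strip I.vars a = b := by
    intro b; simp [FullCQ.untangle]
  refine ⟨φ ∘ ψ, ⟨?_, ?_, ?_, ?_⟩, ?_⟩
  · intro b hb i
    obtain ⟨a, ⟨ha, -⟩, rfl⟩ := (hmem b).1 hb
    obtain ⟨h1, j, h2⟩ := Atom.exists_strip.1 ⟨i, rfl⟩
    rw [Finset.mem_union, not_or]
    exact ⟨by rw [← h2]; exact h.disj a ha j, h1⟩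
  · intro b hb x hx
    obtain ⟨a, ⟨ha, -⟩, rfl⟩ := (hmem b).1 hb
    rw [Finset.mem_union, not_or] at hx
    rw [Function.comp, hψ, h.vars a ha x hx.1, Atom.exists_strip]
    tauto
  · rintro a' ha' b' hb' ν hν
    obtain ⟨a, ⟨ha, -⟩, rfl⟩ := (hmem a').1 ha'
    obtain ⟨b, ⟨hb, -⟩, rfl⟩ := (hmem b').1 hb'
    rw [Function.comp, Function.comp, hψ, hψ, h.map a ha b hb _ (Atom.eq_map_of_strip hν)]
    congr 1
    funext x
    simp only [Finset.mem_union]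
    split_ifs <;> first | rfl | tauto
  · rintro a' ha' b' hb' heq
    obtain ⟨a, ⟨ha, -⟩, rfl⟩ := (hmem a').1 ha'
    obtain ⟨b, ⟨hb, -⟩, rfl⟩ := (hmem b').1 hb'
    simp only [Function.comp, hψ] at heq
    rw [h.inj ha hb heq]
  · ext c
    constructor
    · rintro ⟨a', ha', rfl⟩
      obtain ⟨a, ⟨ha, haI⟩, rfl⟩ := (hmem a').1 ha'
      rw [Function.comp, hψ]
      refine ⟨⟨a, ha, rfl⟩, ?_⟩
      rintro ⟨b, hb, hbc⟩
      rw [h.inj (hI hb) ha hbc] at hb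
      exact haI hb
    · rintro ⟨⟨a, ha, rfl⟩, haI⟩
      refine ⟨Atom.strip I.vars a, (hmem _).2 ⟨a, ⟨ha, fun h => haI ⟨a, h, rfl⟩⟩, rfl⟩, ?_⟩
      rw [Function.comp, hψ]

/-- The endomorphism of `q`, continued by the identity on `Y`, acts on the original atoms. That all
variables of `I` are values of `ν` is what bounds the multiplicities. -/
theorem Flattens.exists_gen_of_isImage {τ : Schema} {φ : Atom τ X → Atom σ X}
    {q I : FullCQ τ X} {Y : Finset X} (h : Flattens φ q Y) (hI : I.IsImage q)
    (h₁ : ∃ (g : Gen σ X) (K c : ℕ), g.Enumerates (φ '' I) Y K c)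
    (h₂ : ∃ (g : Gen σ X) (K c : ℕ), g.Enumerates (φ '' q \ φ '' I) (Y ∪ I.vars) K c) :
    ∃ (g : Gen σ X) (K c : ℕ), g.Enumerates (φ '' q) Y K c := by
  obtain ⟨g₁, K₁, c₁, h₁⟩ := h₁
  obtain ⟨g₂, K₂, c₂, h₂⟩ := h₂
  obtain ⟨ν, -, hIq, hν, hv⟩ := hI
  have hocc : ∀ {p : FullCQ τ X}, p ⊆ q → ∀ x, x ∉ Y → (Occurs (φ '' p) x ↔ x ∈ p.vars) := by
    intro p hp x hx
    rw [FullCQ.mem_vars]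
    constructor
    · rintro ⟨_, ⟨a, ha, rfl⟩, hi⟩
      exact ⟨a, ha, (h.vars a (hp ha) x hx).1 hi⟩
    · rintro ⟨a, ha, hi⟩
      exact ⟨φ a, ⟨a, ha, rfl⟩, (h.vars a (hp ha) x hx).2 hi⟩
  obtain ⟨g, hg⟩ := Gen.Enumerates.of_image (ν := fun x => if x ∈ Y then x else ν x)
    (Set.image_mono hIq) (Y' := Y ∪ I.vars) (by
      intro x
      rw [Finset.mem_union]
      by_cases hx : x ∈ Y
      · simp [hx]
      · simp [hx, hocc hIq x hx]) (fun y hy => if_pos hy) (by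
      rintro _ ⟨a, ha, rfl⟩
      exact ⟨_, hν a ha, h.map a ha _ (hIq (hν a ha)) ν rfl⟩) (by
      intro x hx hxY
      rw [hocc hIq x hxY] at hx
      obtain ⟨z, hz, rfl⟩ := Finset.mem_image.1 (hv hx)
      have hzY : z ∉ Y := by
        obtain ⟨a, ha, i, rfl⟩ := FullCQ.mem_vars.1 hz
        exact h.disj a ha i
      exact ⟨z, (hocc subset_rfl z hzY).2 hz, hzY, if_neg hzY⟩) h₁ h₂
  exact ⟨g, _, _, hg⟩

/-- All queries of the sequence are realised by atoms of the one schema `σ`. With `φ` and `Y` free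
in the induction, both kinds of step are instances of the same combination; they differ only in
which part is acyclic. -/
theorem FullCQ.CanBeUntangled.exists_gen {τ : Schema} {q : FullCQ τ X} (hq : q.CanBeUntangled) :
    ∀ (φ : Atom τ X → Atom σ X) (Y : Finset X), Flattens φ q Y →
      ∃ (g : Gen σ X) (K c : ℕ), g.Enumerates (φ '' q) Y K c := by
  induction hq with
  | acyclic q hq => exact fun φ Y h => h.exists_gen_of_isAcyclic hq
  | image q I hI hac _ ih =>
    intro φ Y h
    rcases q.eq_empty_or_nonempty with rfl | ⟨a, ha⟩
    · exact h.exists_gen_of_isAcyclic (.inl rfl)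
    have hIq : I ⊆ q := hI.choose_spec.2.1
    have : Nonempty (Atom _ X) := ⟨a⟩
    obtain ⟨φ', hφ', him⟩ := h.untangle hIq
    exact h.exists_gen_of_isImage hI (ih φ Y (h.mono hIq))
      (him ▸ hφ'.exists_gen_of_isAcyclic hac)
  | residual q I hI hac _ ih =>
    intro φ Y h
    rcases q.eq_empty_or_nonempty with rfl | ⟨a, ha⟩
    · exact h.exists_gen_of_isAcyclic (.inl rfl)
    have hIq : I ⊆ q := hI.choose_spec.2.1
    have : Nonempty (Atom _ X) := ⟨a⟩
    obtain ⟨φ', hφ', him⟩ := h.untangle hIq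
    exact h.exists_gen_of_isImage hI ((h.mono hIq).exists_gen_of_isAcyclic hac)
      (him ▸ ih φ' _ hφ')

end Untangle

/-! ### Structured code for random access machines -/

/-- The instructions that always continue with the next one. -/
inductive Op (ρ : Type) : Type
  | const (r : ρ) (k : ℕ)
  | add (r a b : ρ)
  | mul (r a b : ρ)
  | input (r a : ρ)
  | load (r a : ρ)
  | store (a r : ρ)
  | emit (rs : List ρ)

/-- Structured code. The last argument is the code that comes next. -/
inductive Code (ρ : Type) : Type
  | nil
  | op (o : Op ρ) (k : Code ρ)
  /-- if `a < b` then `yes` else `no` -/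
  | ite (a b : ρ) (yes no k : Code ρ)
  /-- while `a < b` do `body` -/
  | loop (a b : ρ) (body k : Code ρ)

/-- The registers and the memory of a machine. -/
structure RamState (ρ : Type) where
  reg : ρ → ℕ
  mem : ℕ → ℕ

section Machine

variable {ρ : Type}

def Code.append : Code ρ → Code ρ → Code ρ
  | .nil, c => c
  | .op o k, c => .op o (k.append c)
  | .ite a b y n k, c => .ite a b y n (k.append c)
  | .loop a b body k, c => .loop a b body (k.append c)

instance : Append (Code ρ) := ⟨Code.append⟩

namespace Code

@[simp] theorem nil_append (c : Code ρ) : nil ++ c = c := rfl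
@[simp] theorem op_append (o : Op ρ) (k c : Code ρ) : op o k ++ c = op o (k ++ c) := rfl
@[simp] theorem ite_append (a b : ρ) (y n k c : Code ρ) :
    ite a b y n k ++ c = ite a b y n (k ++ c) := rfl
@[simp] theorem loop_append (a b : ρ) (body k c : Code ρ) :
    loop a b body k ++ c = loop a b body (k ++ c) := rfl

@[simp] theorem append_nil : ∀ c : Code ρ, c ++ nil = c
  | nil => rfl
  | op o k => congrArg (op o) (append_nil k)
  | ite a b y n k => congrArg (ite a b y n) (append_nil k)
  | loop a b body k => congrArg (loop a b body) (append_nil k)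

theorem append_assoc : ∀ c₁ c₂ c₃ : Code ρ, c₁ ++ c₂ ++ c₃ = c₁ ++ (c₂ ++ c₃)
  | nil, _, _ => rfl
  | op o k, _, _ => congrArg (op o) (append_assoc k _ _)
  | ite a b y n k, _, _ => congrArg (ite a b y n) (append_assoc k _ _)
  | loop a b body k, _, _ => congrArg (loop a b body) (append_assoc k _ _)

end Code

def Op.instr {Λ : Type} : Op ρ → Λ → Instr Λ ρ
  | .const r k, l => .const r k l
  | .add r a b, l => .add r a b l
  | .mul r a b, l => .mul r a b l
  | .input r a, l => .input r a l
  | .load r a, l => .load r a l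
  | .store a r, l => .store a r l
  | .emit rs, l => .emit rs l

/-- The code labels the instructions: the first instruction. -/
def Code.instr : Code ρ → Instr (Code ρ) ρ
  | .nil => .halt
  | .op o k => o.instr k
  | .ite a b y n k => .ifLt a b (y ++ k) (n ++ k)
  | .loop a b body k => .ifLt a b (body ++ .loop a b body k) k

/-- The labels at which the execution may continue. -/
def Instr.next {Λ : Type} : Instr Λ ρ → Set Λ
  | .const _ _ l | .add _ _ _ l | .sub _ _ _ l | .mul _ _ _ l | .input _ _ l | .load _ _ l
  | .store _ _ l | .emit _ l => {l}
  | .ifLt _ _ y n => {y, n}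
  | .halt => ∅

/-- The registers that occur. -/
def Instr.regs {Λ : Type} : Instr Λ ρ → Set ρ
  | .const r _ _ => {r}
  | .add r a b _ | .sub r a b _ | .mul r a b _ => {r, a, b}
  | .input r a _ | .load r a _ | .store r a _ => {r, a}
  | .emit rs _ => {r | r ∈ rs}
  | .ifLt a b _ _ => {a, b}
  | .halt => ∅

theorem Instr.finite_regs {Λ : Type} (i : Instr Λ ρ) : i.regs.Finite := by
  cases i <;> simp [Instr.regs, List.finite_toSet]

def Instr.map {Λ Λ' ρ' : Type} (f : Λ → Λ') (g : ρ → ρ') : Instr Λ ρ → Instr Λ' ρ'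
  | .const r k l => .const (g r) k (f l)
  | .add r a b l => .add (g r) (g a) (g b) (f l)
  | .sub r a b l => .sub (g r) (g a) (g b) (f l)
  | .mul r a b l => .mul (g r) (g a) (g b) (f l)
  | .input r a l => .input (g r) (g a) (f l)
  | .load r a l => .load (g r) (g a) (f l)
  | .store a r l => .store (g a) (g r) (f l)
  | .ifLt a b y n => .ifLt (g a) (g b) (f y) (f n)
  | .emit rs l => .emit (rs.map g) (f l)
  | .halt => .halt

namespace Code

/-- The code that may remain to be executed at some time. -/
def labels : Code ρ → Set (Code ρ)
  | nil => {nil}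
  | op o k => insert (op o k) k.labels
  | ite a b y n k => insert (ite a b y n k)
      (((· ++ k) '' y.labels ∪ (· ++ k) '' n.labels) ∪ k.labels)
  | loop a b body k => insert (loop a b body k)
      (((· ++ loop a b body k) '' body.labels) ∪ k.labels)

theorem mem_labels : ∀ c : Code ρ, c ∈ c.labels
  | nil => rfl
  | op _ _ => Set.mem_insert _ _
  | ite _ _ _ _ _ => Set.mem_insert _ _
  | loop _ _ _ _ => Set.mem_insert _ _

/-- A branch or loop body is always followed by the same continuation, so finitely many remainders
suffice however often a loop is repeated. -/
theorem finite_labels : ∀ c : Code ρ, c.labels.Finite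
  | nil => Set.finite_singleton _
  | op _ k => (finite_labels k).insert _
  | ite _ _ y n k => ((((finite_labels y).image _).union ((finite_labels n).image _)).union
      (finite_labels k)).insert _
  | loop _ _ body k => (((finite_labels body).image _).union (finite_labels k)).insert _

theorem next_instr_append {l k : Code ρ} (hl : l ≠ nil) :
    (l ++ k).instr.next = (· ++ k) '' l.instr.next := by
  cases l with
  | nil => exact absurd rfl hl
  | op o k' => cases o <;> simp [instr, Op.instr, Instr.next]
  | ite a b y n k' => simp [instr, Instr.next, append_assoc, Set.image_pair]
  | loop a b body k' => simp [instr, Instr.next, append_assoc, Set.image_pair]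

/-- Inside a branch or body the successors are those of the body with the continuation appended;
only when the body is used up does control pass to the continuation itself. -/
theorem next_subset_labels : ∀ (c : Code ρ), ∀ l ∈ c.labels, l.instr.next ⊆ c.labels
  | nil, l, hl => by rw [hl]; exact Set.empty_subset _
  | op o k, l, hl => by
    rcases hl with rfl | hl
    · have : (op o k).instr.next = {k} := by cases o <;> rfl
      rw [this, Set.singleton_subset_iff]
      exact Set.mem_insert_of_mem _ (mem_labels k)
    · exact (next_subset_labels k l hl).trans (Set.subset_insert _ _)
  | ite a b y n k, l, hl => by
    have hy : (· ++ k) '' y.labels ⊆ (ite a b y n k).labels := fun x hx =>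
      Set.mem_insert_of_mem _ (.inl (.inl hx))
    have hn : (· ++ k) '' n.labels ⊆ (ite a b y n k).labels := fun x hx =>
      Set.mem_insert_of_mem _ (.inl (.inr hx))
    have hk : k.labels ⊆ (ite a b y n k).labels := fun x hx =>
      Set.mem_insert_of_mem _ (.inr hx)
    have hyn : ∀ c : Code ρ, (∀ l ∈ c.labels, l.instr.next ⊆ c.labels) →
        ∀ l' ∈ c.labels, (l' ++ k).instr.next ⊆ (· ++ k) '' c.labels ∪ k.labels := by
      intro c hc l' hl'
      by_cases h : l' = nil
      · subst h
        exact (next_subset_labels k k (mem_labels k)).trans Set.subset_union_right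
      · rw [next_instr_append h]
        exact (Set.image_mono (hc l' hl')).trans Set.subset_union_left
    rcases hl with rfl | (⟨l', hl', rfl⟩ | ⟨l', hl', rfl⟩) | hl
    · rintro x (rfl | rfl)
      · exact hy ⟨y, mem_labels y, rfl⟩
      · exact hn ⟨n, mem_labels n, rfl⟩
    · exact (hyn y (next_subset_labels y) l' hl').trans (Set.union_subset hy hk)
    · exact (hyn n (next_subset_labels n) l' hl').trans (Set.union_subset hn hk)
    · exact (next_subset_labels k l hl).trans hk
  | loop a b body k, l, hl => by
    have hk : k.labels ⊆ (loop a b body k).labels := fun x hx =>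
      Set.mem_insert_of_mem _ (.inr hx)
    have hb : (· ++ loop a b body k) '' body.labels ⊆ (loop a b body k).labels := fun x hx =>
      Set.mem_insert_of_mem _ (.inl hx)
    have h0 : (loop a b body k).instr.next ⊆ (loop a b body k).labels := by
      rintro x (rfl | rfl)
      · exact hb ⟨body, mem_labels body, rfl⟩
      · exact hk (mem_labels _)
    rcases hl with rfl | ⟨l', hl', rfl⟩ | hl
    · exact h0
    · by_cases h : l' = nil
      · subst h
        exact h0
      · dsimp only
        rw [next_instr_append h]
        exact (Set.image_mono (next_subset_labels body l' hl')).trans hb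
    · exact (next_subset_labels k l hl).trans hk

variable [DecidableEq ρ]

/-- The effect of an operation. -/
def _root_.Op.apply (inp : List ℕ) (s : RamState ρ) : Op ρ → RamState ρ
  | .const r k => ⟨Function.update s.reg r k, s.mem⟩
  | .add r a b => ⟨Function.update s.reg r (s.reg a + s.reg b), s.mem⟩
  | .mul r a b => ⟨Function.update s.reg r (s.reg a * s.reg b), s.mem⟩
  | .input r a => ⟨Function.update s.reg r (inp.getD (s.reg a) 0), s.mem⟩
  | .load r a => ⟨Function.update s.reg r (s.mem (s.reg a)), s.mem⟩
  | .store a r => ⟨s.reg, Function.update s.mem (s.reg a) (s.reg r)⟩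
  | .emit _ => s

/-- The output of an operation. -/
def _root_.Op.out (s : RamState ρ) : Op ρ → Option (List ℕ)
  | .emit rs => some (rs.map s.reg)
  | _ => none

/-- All words are at most `w`. -/
def _root_.RamState.Bounded (w : ℕ) (s : RamState ρ) : Prop :=
  (∀ r, s.reg r ≤ w) ∧ ∀ i, s.mem i ≤ w

/-- The execution of code from a state, with its trace, until some code and a state, with all words
at most `w` before the last state. -/
inductive Path (w : ℕ) (inp : List ℕ) :
    Code ρ → RamState ρ → Trace (List ℕ) → Code ρ → RamState ρ → Prop
  | refl (c s) : Path w inp c s [] c s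
  | op {o k s tr c' s'} : s.Bounded w → Path w inp k (o.apply inp s) tr c' s' →
      Path w inp (op o k) s (o.out s :: tr) c' s'
  | yes {a b y n k s tr c' s'} : s.Bounded w → s.reg a < s.reg b →
      Path w inp (y ++ k) s tr c' s' → Path w inp (ite a b y n k) s (none :: tr) c' s'
  | no {a b y n k s tr c' s'} : s.Bounded w → s.reg b ≤ s.reg a →
      Path w inp (n ++ k) s tr c' s' → Path w inp (ite a b y n k) s (none :: tr) c' s'
  | iter {a b body k s tr c' s'} : s.Bounded w → s.reg a < s.reg b →
      Path w inp (body ++ loop a b body k) s tr c' s' →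
      Path w inp (loop a b body k) s (none :: tr) c' s'
  | exit {a b body k s tr c' s'} : s.Bounded w → s.reg b ≤ s.reg a →
      Path w inp k s tr c' s' → Path w inp (loop a b body k) s (none :: tr) c' s'

theorem Path.trans {w : ℕ} {inp : List ℕ} {c₁ c₂ c₃ : Code ρ} {s₁ s₂ s₃ : RamState ρ}
    {t₁ t₂ : Trace (List ℕ)} (h : Path w inp c₁ s₁ t₁ c₂ s₂) (h' : Path w inp c₂ s₂ t₂ c₃ s₃) :
    Path w inp c₁ s₁ (t₁ ++ t₂) c₃ s₃ := by
  induction h with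
  | refl => exact h'
  | op h1 _ ih => exact .op h1 (ih h')
  | yes h1 h2 _ ih => exact .yes h1 h2 (ih h')
  | no h1 h2 _ ih => exact .no h1 h2 (ih h')
  | iter h1 h2 _ ih => exact .iter h1 h2 (ih h')
  | exit h1 h2 _ ih => exact .exit h1 h2 (ih h')

/-- The registers used by the code. -/
def regs (c : Code ρ) : Set ρ := ⋃ l ∈ c.labels, l.instr.regs

omit [DecidableEq ρ] in
theorem finite_regs (c : Code ρ) : c.regs.Finite :=
  c.finite_labels.biUnion fun l _ => l.instr.finite_regs

open Classical in
/-- The machine executing the code. -/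
noncomputable def toProgram [Inhabited ρ] (c : Code ρ) : Program where
  Λ := {l // l ∈ c.labels}
  -- The type `ρ` may be infinite, so the machine keeps only the registers in use; `default`
  -- guarantees that there is one.
  ρ := {r // r ∈ insert default c.regs}
  finLabels := c.finite_labels
  finRegisters := c.finite_regs.insert _
  start := ⟨c, c.mem_labels⟩
  code l := l.1.instr.map
    (fun l' => if h : l' ∈ c.labels then ⟨l', h⟩ else ⟨c, c.mem_labels⟩)
    (fun r => if h : r ∈ insert default c.regs then ⟨r, h⟩ else ⟨default, Set.mem_insert _ _⟩)

/-- A configuration of the machine represents code and a state. -/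
structure Represents [Inhabited ρ] {c : Code ρ} (p : c.toProgram.Config) (l : Code ρ)
    (s : RamState ρ) : Prop where
  lab : p.lab.1 = l
  reg : ∀ r : c.toProgram.ρ, p.reg r = s.reg r.1
  mem : p.mem = s.mem

end Code

end Machine

/-! ### Correctness of the machine built from code -/

section MachineCorrect

variable {ρ : Type} [DecidableEq ρ] [Inhabited ρ]

namespace Code

/-- The output at a configuration. -/
def _root_.Program.Config.out {P : Program} (p : P.Config) : Option (List ℕ) :=
  match P.code p.lab with
  | .emit rs _ => some (rs.map p.reg)
  | _ => none

theorem Represents.step {c : Code ρ} {p : c.toProgram.Config} {l : Code ρ} {s : RamState ρ}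
    (h : Represents p l s) {w : ℕ} {inp : List ℕ} {tr : Trace (List ℕ)} {s' : RamState ρ}
    (hp : Path w inp l s tr nil s') :
    (tr = [] ∧ l = nil ∧ s = s' ∧ p.out = none ∧ c.toProgram.code p.lab = .halt) ∨
    ∃ tr' l₁ s₁, tr = p.out :: tr' ∧ Represents (c.toProgram.step inp p) l₁ s₁ ∧
      Path w inp l₁ s₁ tr' nil s' ∧ s.Bounded w := by
  classical
  have hl : l ∈ c.labels := h.lab ▸ p.lab.2
  obtain ⟨f, g, hcode, hf, hg⟩ : ∃ (f : Code ρ → c.toProgram.Λ) (g : ρ → c.toProgram.ρ),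
      c.toProgram.code p.lab = l.instr.map f g ∧ (∀ l' ∈ c.labels, (f l').1 = l') ∧
      ∀ r ∈ insert default c.regs, (g r).1 = r :=
    ⟨fun l' => if h : l' ∈ c.labels then ⟨l', h⟩ else ⟨c, c.mem_labels⟩,
      fun r => if h : r ∈ insert default c.regs then ⟨r, h⟩ else ⟨default, Set.mem_insert _ _⟩,
      by rw [← h.lab]; rfl, fun l' hl' => congrArg Subtype.val (dif_pos hl'),
      fun r hr => congrArg Subtype.val (dif_pos hr)⟩
  have hfn : ∀ l' ∈ l.instr.next, (f l').1 = l' :=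
    fun l' hl' => hf l' (c.next_subset_labels l hl hl')
  have hgr : ∀ r ∈ l.instr.regs, (g r).1 = r :=
    fun r hr => hg r (Set.mem_insert_of_mem _ (Set.mem_biUnion hl hr))
  have hreg : ∀ r ∈ l.instr.regs, p.reg (g r) = s.reg r := by
    intro r hr
    rw [h.reg, hgr r hr]
  have hupd : ∀ r ∈ l.instr.regs, ∀ v r', Function.update p.reg (g r) v r' =
      Function.update s.reg r v r'.1 := by
    intro r hr v r'
    rw [Function.update_apply, Function.update_apply, h.reg]
    congr 1
    exact propext (Subtype.ext_iff.trans
      ⟨fun e => e.trans (hgr r hr), fun e => e.trans (hgr r hr).symm⟩)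
  cases hp with
  | refl => exact .inl ⟨rfl, rfl, rfl, by simp [Program.Config.out, hcode, instr, Instr.map],
      by rw [hcode]; rfl⟩
  | @op o k _ tr _ _ hb hp =>
    refine .inr ⟨tr, k, _, ?_, ?_, hp, hb⟩
    · congr 1
      rw [Program.Config.out, hcode]
      cases o <;> simp only [Op.out, instr, Op.instr, Instr.map]
      rw [List.map_map]
      exact congrArg some (List.map_congr_left fun r hr => (hreg r hr).symm)
    · have hk : (f k).1 = k := hfn k (by cases o <;> rfl)
      rw [Program.step, hcode]
      cases o with
      | const r v =>
        exact ⟨hk, hupd r (by simp [instr, Op.instr, Instr.regs]) _, h.mem⟩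
      | add r a b =>
        refine ⟨hk, ?_, h.mem⟩
        simp only [Op.apply]
        rw [← hreg a (by simp [instr, Op.instr, Instr.regs]),
          ← hreg b (by simp [instr, Op.instr, Instr.regs])]
        exact hupd r (by simp [instr, Op.instr, Instr.regs]) _
      | mul r a b =>
        refine ⟨hk, ?_, h.mem⟩
        simp only [Op.apply]
        rw [← hreg a (by simp [instr, Op.instr, Instr.regs]),
          ← hreg b (by simp [instr, Op.instr, Instr.regs])]
        exact hupd r (by simp [instr, Op.instr, Instr.regs]) _
      | input r a =>
        refine ⟨hk, ?_, h.mem⟩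
        simp only [Op.apply]
        rw [← hreg a (by simp [instr, Op.instr, Instr.regs])]
        exact hupd r (by simp [instr, Op.instr, Instr.regs]) _
      | load r a =>
        refine ⟨hk, ?_, h.mem⟩
        simp only [Op.apply]
        rw [← hreg a (by simp [instr, Op.instr, Instr.regs]), ← h.mem]
        exact hupd r (by simp [instr, Op.instr, Instr.regs]) _
      | store a r =>
        refine ⟨hk, h.reg, ?_⟩
        simp only [Op.apply]
        rw [← hreg a (by simp [instr, Op.instr, Instr.regs]),
          ← hreg r (by simp [instr, Op.instr, Instr.regs]), ← h.mem]
        rfl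
      | emit rs => exact ⟨hk, h.reg, h.mem⟩
  | @yes a b y n k _ tr _ _ hb hlt hp =>
    refine .inr ⟨tr, y ++ k, _, ?_, ?_, hp, hb⟩
    · congr 1
      rw [Program.Config.out, hcode]
      rfl
    · rw [Program.step, hcode]
      refine ⟨?_, h.reg, h.mem⟩
      simp only [instr, Instr.map]
      rw [hreg a (by simp [instr, Instr.regs]), hreg b (by simp [instr, Instr.regs]), if_pos hlt]
      exact hfn _ (by simp [instr, Instr.next])
  | @no a b y n k _ tr _ _ hb hlt hp =>
    refine .inr ⟨tr, n ++ k, _, ?_, ?_, hp, hb⟩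
    · congr 1
      rw [Program.Config.out, hcode]
      rfl
    · rw [Program.step, hcode]
      refine ⟨?_, h.reg, h.mem⟩
      simp only [instr, Instr.map]
      rw [hreg a (by simp [instr, Instr.regs]), hreg b (by simp [instr, Instr.regs]),
        if_neg hlt.not_gt]
      exact hfn _ (by simp [instr, Instr.next])
  | @iter a b body k _ tr _ _ hb hlt hp =>
    refine .inr ⟨tr, _, _, ?_, ?_, hp, hb⟩
    · congr 1
      rw [Program.Config.out, hcode]
      rfl
    · rw [Program.step, hcode]
      refine ⟨?_, h.reg, h.mem⟩
      simp only [instr, Instr.map]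
      rw [hreg a (by simp [instr, Instr.regs]), hreg b (by simp [instr, Instr.regs]), if_pos hlt]
      exact hfn _ (by simp [instr, Instr.next])
  | @exit a b body k _ tr _ _ hb hlt hp =>
    refine .inr ⟨tr, _, _, ?_, ?_, hp, hb⟩
    · congr 1
      rw [Program.Config.out, hcode]
      rfl
    · rw [Program.step, hcode]
      refine ⟨?_, h.reg, h.mem⟩
      simp only [instr, Instr.map]
      rw [hreg a (by simp [instr, Instr.regs]), hreg b (by simp [instr, Instr.regs]),
        if_neg hlt.not_gt]
      exact hfn _ (by simp [instr, Instr.next])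

/-- Each machine step consumes one entry of the trace; once the trace is used up the configuration
no longer changes. -/
theorem toProgram_run {c : Code ρ} {w : ℕ} {inp : List ℕ} {tr : Trace (List ℕ)}
    {s' : RamState ρ} (hp : Path w inp c ⟨fun _ => 0, fun _ => 0⟩ tr nil s')
    (t : ℕ) : ∃ l s, Represents (c.toProgram.run inp t) l s ∧
      Path w inp l s (tr.drop t) nil s' := by
  induction t with
  | zero => exact ⟨c, _, ⟨rfl, fun _ => rfl, rfl⟩, hp⟩
  | succ t ih =>
    obtain ⟨l, s, hr, hp⟩ := ih
    rw [Program.run, Function.iterate_succ_apply', ← Program.run]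
    rcases hr.step hp with ⟨h1, rfl, rfl, -, h2⟩ | ⟨tr', l₁, s₁, h1, h2, h3, -⟩
    · refine ⟨nil, s, ?_, ?_⟩
      · rw [Program.step, h2]
        exact hr
      · rw [← List.drop_drop, h1]
        exact .refl _ _
    · refine ⟨l₁, s₁, h2, ?_⟩
      rw [← List.drop_drop, h1]
      exact h3

theorem toProgram_spec {c : Code ρ} {w : ℕ} {inp : List ℕ} {tr : Trace (List ℕ)}
    {s' : RamState ρ} (hp : Path w inp c ⟨fun _ => 0, fun _ => 0⟩ tr nil s') (hb : s'.Bounded w) :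
    (∀ t, c.toProgram.output inp t = tr[t]?.join) ∧ c.toProgram.HaltedAt inp tr.length ∧
    ∀ t, (∀ r, (c.toProgram.run inp t).reg r ≤ w) ∧ ∀ i, (c.toProgram.run inp t).mem i ≤ w := by
  refine ⟨fun t => ?_, ?_, fun t => ?_⟩
  · obtain ⟨l, s, hr, hp⟩ := toProgram_run hp t
    change (c.toProgram.run inp t).out = _
    rw [← List.head?_drop]
    rcases hr.step hp with ⟨h1, -, -, h2, -⟩ | ⟨tr', l₁, s₁, h1, -⟩
    · rw [h1, h2]; rfl
    · rw [h1]; rfl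
  · obtain ⟨l, s, hr, hp⟩ := toProgram_run hp tr.length
    rcases hr.step hp with ⟨-, -, -, -, h2⟩ | ⟨tr', l₁, s₁, h1, -⟩
    · exact h2
    · simp at h1
  · obtain ⟨l, s, hr, hp⟩ := toProgram_run hp t
    have hs : s.Bounded w := by
      rcases hr.step hp with ⟨-, -, rfl, -⟩ | ⟨tr', l₁, s₁, -, -, -, h⟩
      · exact hb
      · exact h
    exact ⟨fun r => by rw [hr.reg]; exact hs.1 _, fun i => by rw [hr.mem]; exact hs.2 _⟩

-- Turns the recursive notion of gap into a statement about positions. The second conjunct keeps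
-- track of the time already elapsed, which the induction needs.
omit [DecidableEq ρ] [Inhabited ρ] in
theorem _root_.Trace.Gap.exists_event {α : Type} {D : ℕ} : ∀ {tr : Trace α} {a : ℕ},
    tr.Gap D a →
    (∀ t ≤ tr.length, ∃ t', t ≤ t' ∧ t' ≤ t + D ∧ (t' = tr.length ∨ tr[t']?.join.isSome)) ∧
    ∃ t', t' + a ≤ D ∧ (t' = tr.length ∨ tr[t']?.join.isSome)
  | [], a, h => ⟨fun t ht => ⟨t, le_rfl, Nat.le_add_right _ _, .inl (by simpa using ht)⟩,
      0, (zero_add a).le.trans h, .inl rfl⟩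
  | none :: tr, a, h => by
    obtain ⟨h1, t₀, h2, h3⟩ := Trace.Gap.exists_event (tr := tr) h
    have h4 : ∃ t', t' + a ≤ D ∧
        (t' = (none :: tr).length ∨ (none :: tr)[t']?.join.isSome) :=
      ⟨t₀ + 1, by omega, by simpa using h3⟩
    refine ⟨fun t ht => ?_, h4⟩
    cases t with
    | zero =>
      obtain ⟨t', h5, h6⟩ := h4
      exact ⟨t', Nat.zero_le _, by omega, h6⟩
    | succ t =>
      obtain ⟨t', h5, h6, h7⟩ := h1 t (by simpa using ht)
      exact ⟨t' + 1, by omega, by omega, by simpa using h7⟩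
  | some x :: tr, a, h => by
    obtain ⟨h1, -⟩ := Trace.Gap.exists_event (tr := tr) h.2
    refine ⟨fun t ht => ?_, 0, by simpa using h.1, .inr rfl⟩
    cases t with
    | zero => exact ⟨0, le_rfl, Nat.zero_le _, .inr rfl⟩
    | succ t =>
      obtain ⟨t', h5, h6, h7⟩ := h1 t (by simpa using ht)
      exact ⟨t' + 1, by omega, by omega, by simpa using h7⟩

omit [DecidableEq ρ] [Inhabited ρ] in
theorem _root_.Trace.existsUnique_event {α : Type} {x : α} : ∀ {tr : Trace α},
    tr.reduceOption.Nodup → some x ∈ tr → ∃! t : ℕ, tr[t]? = some (some x)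
  | [], _, h => by simp at h
  | none :: tr, hn, h => by
    obtain ⟨t, ht, hu⟩ := existsUnique_event (tr := tr) (by simpa using hn) (by simpa using h)
    refine ⟨t + 1, by simpa using ht, fun t' ht' => ?_⟩
    cases t' with
    | zero => simp at ht'
    | succ t' => rw [hu t' (by simpa using ht')]
  | some y :: tr, hn, h => by
    rw [List.reduceOption_cons_of_some, List.nodup_cons, List.reduceOption_mem_iff] at hn
    by_cases hxy : y = x
    · subst hxy
      refine ⟨0, rfl, fun t' ht' => ?_⟩
      cases t' with
      | zero => rfl
      | succ t' => exact absurd (List.mem_of_getElem? (by simpa using ht')) hn.1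
    · obtain ⟨t, ht, hu⟩ := existsUnique_event (tr := tr) hn.2
        (by simpa [Ne.symm hxy] using h)
      refine ⟨t + 1, by simpa using ht, fun t' ht' => ?_⟩
      cases t' with
      | zero => exact absurd (by simpa using ht') hxy
      | succ t' => rw [hu t' (by simpa using ht')]

/-- The enumeration phase is declared to start at time zero, so the bound `pre` can be anything. -/
theorem enumerates_of_path {c : Code ρ} {w : ℕ} {inp : List ℕ} {tr : Trace (List ℕ)}
    {s' : RamState ρ} (hp : Path w inp c ⟨fun _ => 0, fun _ => 0⟩ tr nil s') (hb : s'.Bounded w)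
    {S : Set (List ℕ)} {D D' pre : ℕ} (hD : tr.Gap D 0) (hDD' : D < D')
    (hS : ∀ a, some a ∈ tr ↔ a ∈ S) (hn : tr.reduceOption.Nodup) :
    c.toProgram.Enumerates inp S pre D' w := by
  obtain ⟨h1, h2, h3⟩ := toProgram_spec hp hb
  have hj : ∀ (t : ℕ) (a : List ℕ), tr[t]?.join = some a ↔ tr[t]? = some (some a) :=
    fun t a => Option.join_eq_some_iff
  refine ⟨fun t a ha => ?_, fun a ha => ?_, ⟨0, tr.length, Nat.zero_le _, Nat.zero_le _, h2,
    by simp, fun t _ ht => ?_⟩, h3⟩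
  · rw [h1, hj] at ha
    exact (hS a).1 (List.mem_of_getElem? ha)
  · simp only [h1, hj]
    exact Trace.existsUnique_event hn ((hS a).2 ha)
  · obtain ⟨t', h4, h5, h6⟩ := (hD.exists_event).1 t ht
    exact ⟨t', h4, by omega, by rwa [h1]⟩

end Code

end MachineCorrect

/-! ### Execution of fragments of code -/

section Execution

variable {ρ : Type} [DecidableEq ρ] {w : ℕ} {inp : List ℕ}

open Code

/-- The execution of a piece of code from one state to another, with its trace. -/
def Exec (w : ℕ) (inp : List ℕ) (c : Code ρ) (s : RamState ρ) (tr : Trace (List ℕ))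
    (s' : RamState ρ) : Prop :=
  ∀ k, Path w inp (c ++ k) s tr k s'

namespace Exec

theorem nil (s : RamState ρ) : Exec w inp .nil s [] s := fun k => .refl k s

theorem op {o : Op ρ} {k : Code ρ} {s s' : RamState ρ} {tr : Trace (List ℕ)}
    (hb : s.Bounded w) (h : Exec w inp k (o.apply inp s) tr s') :
    Exec w inp (.op o k) s (o.out s :: tr) s' := fun k' => .op hb (h k')

theorem append {c₁ c₂ : Code ρ} {s₁ s₂ s₃ : RamState ρ} {t₁ t₂ : Trace (List ℕ)}
    (h₁ : Exec w inp c₁ s₁ t₁ s₂) (h₂ : Exec w inp c₂ s₂ t₂ s₃) :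
    Exec w inp (c₁ ++ c₂) s₁ (t₁ ++ t₂) s₃ := fun k => by
  rw [Code.append_assoc]
  exact (h₁ _).trans (h₂ k)

theorem yes {a b : ρ} {y n k : Code ρ} {s₁ s₂ s₃ : RamState ρ} {t₁ t₂ : Trace (List ℕ)}
    (hb : s₁.Bounded w) (hab : s₁.reg a < s₁.reg b) (h₁ : Exec w inp y s₁ t₁ s₂)
    (h₂ : Exec w inp k s₂ t₂ s₃) : Exec w inp (.ite a b y n k) s₁ (none :: (t₁ ++ t₂)) s₃ :=
  fun k' => .yes hb hab ((h₁ _).trans (h₂ k'))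

theorem no {a b : ρ} {y n k : Code ρ} {s₁ s₂ s₃ : RamState ρ} {t₁ t₂ : Trace (List ℕ)}
    (hb : s₁.Bounded w) (hab : s₁.reg b ≤ s₁.reg a) (h₁ : Exec w inp n s₁ t₁ s₂)
    (h₂ : Exec w inp k s₂ t₂ s₃) : Exec w inp (.ite a b y n k) s₁ (none :: (t₁ ++ t₂)) s₃ :=
  fun k' => .no hb hab ((h₁ _).trans (h₂ k'))

theorem iter {a b : ρ} {body k : Code ρ} {s₁ s₂ s₃ : RamState ρ} {t₁ t₂ : Trace (List ℕ)}
    (hb : s₁.Bounded w) (hab : s₁.reg a < s₁.reg b) (h₁ : Exec w inp body s₁ t₁ s₂)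
    (h₂ : Exec w inp (.loop a b body k) s₂ t₂ s₃) :
    Exec w inp (.loop a b body k) s₁ (none :: (t₁ ++ t₂)) s₃ :=
  fun k' => .iter hb hab ((h₁ _).trans (h₂ k'))

theorem exit {a b : ρ} {body k : Code ρ} {s₁ s₂ : RamState ρ} {t : Trace (List ℕ)}
    (hb : s₁.Bounded w) (hab : s₁.reg b ≤ s₁.reg a) (h : Exec w inp k s₁ t s₂) :
    Exec w inp (.loop a b body k) s₁ (none :: t) s₂ :=
  fun k' => .exit hb hab (h k')

end Exec

/-- The execution of code without output and in time at most `C`. -/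
def Silent (w : ℕ) (inp : List ℕ) (c : Code ρ) (C : ℕ) (s s' : RamState ρ) : Prop :=
  s.Bounded w ∧ s'.Bounded w ∧ ∃ n ≤ C, Exec w inp c s (List.replicate n none) s'

theorem RamState.Bounded.update {s : RamState ρ} (hb : s.Bounded w) {r : ρ} {v : ℕ} (hv : v ≤ w) :
    RamState.Bounded w ⟨Function.update s.reg r v, s.mem⟩ := by
  refine ⟨fun r' => ?_, hb.2⟩
  dsimp only
  rw [Function.update_apply]
  split_ifs
  · exact hv
  · exact hb.1 r'

namespace Silent

variable {c c₁ c₂ y n k : Code ρ} {C C₁ C₂ : ℕ} {s s' s₁ s₂ s₃ : RamState ρ} {a b r : ρ}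

theorem nil (hb : s.Bounded w) : Silent w inp .nil 0 s s := ⟨hb, hb, 0, le_rfl, Exec.nil s⟩

theorem of_eq (hb : s'.Bounded w) (h : s = s') : Silent w inp .nil 0 s s' := h ▸ nil (h ▸ hb)

theorem mono (h : Silent w inp c C₁ s s') (hC : C₁ ≤ C₂) : Silent w inp c C₂ s s' :=
  ⟨h.1, h.2.1, h.2.2.imp fun _ hn => ⟨hn.1.trans hC, hn.2⟩⟩

theorem append (h₁ : Silent w inp c₁ C₁ s₁ s₂) (h₂ : Silent w inp c₂ C₂ s₂ s₃) :
    Silent w inp (c₁ ++ c₂) (C₁ + C₂) s₁ s₃ := by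
  obtain ⟨hb₁, -, n₁, hn₁, h₁⟩ := h₁
  obtain ⟨-, hb₃, n₂, hn₂, h₂⟩ := h₂
  refine ⟨hb₁, hb₃, n₁ + n₂, add_le_add hn₁ hn₂, ?_⟩
  rw [List.replicate_add]
  exact h₁.append h₂

theorem op {o : Op ρ} (hb : s.Bounded w) (ho : o.out s = none)
    (h : Silent w inp k C (o.apply inp s) s') : Silent w inp (.op o k) (C + 1) s s' := by
  obtain ⟨-, hb', n, hn, h⟩ := h
  refine ⟨hb, hb', n + 1, Nat.succ_le_succ hn, ?_⟩
  have := h.op hb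
  rwa [ho] at this

theorem yes (hab : s₁.reg a < s₁.reg b) (h₁ : Silent w inp y C₁ s₁ s₂)
    (h₂ : Silent w inp k C₂ s₂ s₃) : Silent w inp (.ite a b y n k) (C₁ + C₂ + 1) s₁ s₃ := by
  obtain ⟨hb₁, -, n₁, hn₁, h₁⟩ := h₁
  obtain ⟨-, hb₃, n₂, hn₂, h₂⟩ := h₂
  refine ⟨hb₁, hb₃, n₁ + n₂ + 1, by omega, ?_⟩
  rw [List.replicate_succ, List.replicate_add]
  exact h₁.yes hb₁ hab h₂

theorem no (hab : s₁.reg b ≤ s₁.reg a) (h₁ : Silent w inp n C₁ s₁ s₂)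
    (h₂ : Silent w inp k C₂ s₂ s₃) : Silent w inp (.ite a b y n k) (C₁ + C₂ + 1) s₁ s₃ := by
  obtain ⟨hb₁, -, n₁, hn₁, h₁⟩ := h₁
  obtain ⟨-, hb₃, n₂, hn₂, h₂⟩ := h₂
  refine ⟨hb₁, hb₃, n₁ + n₂ + 1, by omega, ?_⟩
  rw [List.replicate_succ, List.replicate_add]
  exact h₁.no hb₁ hab h₂

end Silent

end Execution

/-! ### Registers and the numbering of keys -/

/-- The registers used for the execution of generators. -/
inductive Reg : Type
  | zero | one | size | base | stride | addr | tmp | sym | skip | qlen | qpos | qrem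
  | val (d i : ℕ)
  | ptr (d : ℕ)
  | cnt (d : ℕ)
  | out (i : ℕ)
  deriving DecidableEq, Inhabited

/-- The registers whose contents are not changed at depth `d`. -/
def Reg.Fixed (d : ℕ) : Reg → Prop
  | .zero | .one | .size | .base | .stride => True
  | .val d' _ | .ptr d' | .cnt d' => d' < d
  | _ => False

/-- The registers of the queue. -/
def Reg.IsQueue : Reg → Prop
  | .qlen | .qpos | .qrem => True
  | _ => False

/-- Of the registers fixed at depth `d`, none has changed. -/
def Keep (d : ℕ) (s s' : RamState Reg) : Prop := ∀ r, r.Fixed d → s'.reg r = s.reg r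

theorem Keep.refl (d : ℕ) (s : RamState Reg) : Keep d s s := fun _ _ => rfl

theorem Keep.trans {d : ℕ} {s₁ s₂ s₃ : RamState Reg} (h : Keep d s₁ s₂) (h' : Keep d s₂ s₃) :
    Keep d s₁ s₃ := fun r hr => (h' r hr).trans (h r hr)

theorem Keep.mono {d d' : ℕ} (hd : d ≤ d') {s s' : RamState Reg} (h : Keep d' s s') :
    Keep d s s' := fun r hr => h r (by cases r <;> simp_all [Reg.Fixed] <;> omega)

theorem Keep.update {d : ℕ} {s s' : RamState Reg} {r : Reg} (h : Keep d s s') (hr : ¬ r.Fixed d)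
    (v : ℕ) (mem : ℕ → ℕ) : Keep d s ⟨Function.update s'.reg r v, mem⟩ := by
  intro r' hr'
  have : r' ≠ r := by rintro rfl; exact hr hr'
  simp only [Function.update_of_ne this]
  exact h r' hr'

/-- The number that represents a list of numbers at most `B - 2`. -/
def keyval (B : ℕ) : List ℕ → ℕ
  | [] => 0
  | v :: vs => keyval B vs * B + v + 1

theorem keyval_lt {B : ℕ} : ∀ {vs : List ℕ}, (∀ v ∈ vs, v + 2 ≤ B) → keyval B vs < B ^ vs.length
  | [], _ => by simp [keyval]
  | v :: vs, h => by
    have h1 := keyval_lt fun v hv => h v (List.mem_cons_of_mem _ hv)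
    have h2 := h v List.mem_cons_self
    rw [keyval, List.length_cons, pow_succ]
    nlinarith

/-- The digits `v + 1` in base `B` are nonzero, so lists of different lengths get different numbers
too. -/
theorem keyval_injOn {B : ℕ} : ∀ {vs vs' : List ℕ}, (∀ v ∈ vs, v + 2 ≤ B) →
    (∀ v ∈ vs', v + 2 ≤ B) → keyval B vs = keyval B vs' → vs = vs'
  | [], [], _, _, _ => rfl
  | [], v :: vs, _, _, h => by simp [keyval] at h
  | v :: vs, [], _, _, h => by simp [keyval] at h
  | v :: vs, v' :: vs', h, h', he => by
    have h1 := h v List.mem_cons_self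
    have h2 := h' v' List.mem_cons_self
    simp only [keyval, add_assoc] at he
    have h3 : v + 1 = v' + 1 := by
      have := congrArg (· % B) he
      simp only [Nat.mul_add_mod_self_right] at this
      rwa [Nat.mod_eq_of_lt (by omega), Nat.mod_eq_of_lt (by omega)] at this
    have h4 : keyval B vs = keyval B vs' := by
      rw [h3] at he
      exact Nat.eq_of_mul_eq_mul_right (by omega : 0 < B) (by omega)
    rw [Nat.succ.inj h3, keyval_injOn (fun v hv => h v (List.mem_cons_of_mem _ hv))
      (fun v hv => h' v (List.mem_cons_of_mem _ hv)) h4]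

/-- Puts the number of the list of the contents of `rs` into the address register. -/
def keyBody : List Reg → Code Reg
  | [] => .op (.const .addr 0) .nil
  | r :: rs => keyBody rs ++
    .op (.mul .addr .addr .base) (.op (.add .addr .addr r) (.op (.add .addr .addr .one) .nil))

/-- Adds `t` to the multiple of the stride by the contents of the address register. -/
def offsetCode (r : Reg) (t : ℕ) : Code Reg :=
  .op (.mul .addr r .stride) (.op (.const .tmp t) (.op (.add .addr .addr .tmp) .nil))

section Addresses

variable {w : ℕ} {inp : List ℕ}

theorem silent_offsetCode {s : RamState Reg} (hb : s.Bounded w) {r : Reg} {t : ℕ}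
    (hw : s.reg r * s.reg .stride + t ≤ w) :
    Silent w inp (offsetCode r t) 3 s ⟨Function.update (Function.update s.reg .addr
      (s.reg r * s.reg .stride + t)) .tmp t, s.mem⟩ := by
  have h1 := hb.update (r := .addr) (v := s.reg r * s.reg .stride) (by omega)
  have h2 := h1.update (r := .tmp) (v := t) (by omega)
  have h3 := (hb.update (r := .addr) hw).update (r := .tmp) (v := t) (by omega)
  refine .op hb rfl (.op h1 rfl (.op h2 rfl (.of_eq h3 ?_)))
  simp only [Op.apply, Function.update_self, RamState.mk.injEq, and_true]
  funext r'
  simp only [Function.update_apply]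
  split_ifs <;> simp_all

theorem silent_keyBody {s : RamState Reg} (hb : s.Bounded w) (h1 : s.reg .one = 1)
    (h0 : 0 < s.reg .base) :
    ∀ {rs : List Reg}, (∀ r ∈ rs, r ≠ .addr) → keyval (s.reg .base) (rs.map s.reg) ≤ w →
    Silent w inp (keyBody rs) (3 * rs.length + 1) s
      ⟨Function.update s.reg .addr (keyval (s.reg .base) (rs.map s.reg)), s.mem⟩
  | [], _, _ => .op hb rfl (.nil (hb.update (Nat.zero_le _)))
  | r :: rs, hr, hw => by
    rw [List.map_cons, keyval] at hw
    have hm : keyval (s.reg .base) (rs.map s.reg) * s.reg .base ≤ w := by omega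
    have hk : keyval (s.reg .base) (rs.map s.reg) ≤ w := (Nat.le_mul_of_pos_right _ h0).trans hm
    have ih := silent_keyBody hb h1 h0 (fun r hr' => hr r (List.mem_cons_of_mem _ hr')) hk
    refine (ih.append (C₂ := 3) ?_).mono (by simp; omega)
    have hra : r ≠ .addr := hr r List.mem_cons_self
    have hb1 := ih.2.1
    have hb2 := hb.update (r := .addr) hm
    have hb3 := hb.update (r := .addr)
      (v := keyval (s.reg .base) (rs.map s.reg) * s.reg .base + s.reg r) (by omega)
    have hb4 := hb.update (r := .addr) hw
    refine .op hb1 rfl (.op ?_ rfl (.op ?_ rfl ?_))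
    · simpa [Op.apply] using hb2
    · simpa [Op.apply, hra] using hb3
    · simpa [Op.apply, hra, h1, keyval] using Silent.nil hb4

end Addresses

/-! ### The output queue -/

/-- A queue of distinct tuples: all those that were put into it, the number of those that have
been taken out, and a counter. -/
structure Queue where
  items : List (List ℕ)
  pos : ℕ
  rem : ℕ

/-- Put a tuple into the queue unless it has been there before. -/
def Queue.insert (q : Queue) (x : List ℕ) : Queue :=
  { q with items := if x ∈ q.items then q.items else q.items ++ [x] }

/-- Count; every `K` times a tuple is taken out. -/
def Queue.tick (K : ℕ) (q : Queue) : Queue :=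
  if q.rem + 1 < K then { q with rem := q.rem + 1 }
  else if q.pos < q.items.length then { q with pos := q.pos + 1, rem := 0 }
  else { q with rem := 0 }

/-! ### Layout of the memory -/

section Layout

variable {σ : Schema} {X : Type}

/-- The data on which the code for a generator depends. -/
structure Layout (σ : Schema) (X : Type) where
  /-- the numbering of the symbols -/
  code : σ.Sym → ℕ
  /-- all symbols -/
  syms : List σ.Sym
  /-- the tables in use -/
  tabs : Set (Table σ X)
  /-- the numbering of the tables -/
  num : Table σ X → ℕ
  /-- the number of tables -/
  m : ℕ
  /-- the variables, as ordered in the output -/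
  xs : List X
  /-- the number of events after which a tuple is output -/
  K : ℕ

namespace Layout

/-- The memory is divided into this number of arrays. -/
def stride (lay : Layout σ X) : ℕ := lay.m + 1 + lay.xs.length

structure Valid (lay : Layout σ X) : Prop where
  code_injective : Function.Injective lay.code
  mem_syms : ∀ R, R ∈ lay.syms
  num_injOn : Set.InjOn lay.num lay.tabs
  num_lt : ∀ t ∈ lay.tabs, lay.num t < lay.m

/-- The input for a list of facts. -/
def encode (lay : Layout σ X) (dom : ℕ) (L : List (Atom σ ℕ)) : List ℕ :=
  dom :: L.length :: L.flatMap fun f => lay.code f.1 :: List.ofFn f.2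

/-- Words of size `w` suffice. -/
structure Fits (lay : Layout σ X) (dom : ℕ) (L : List (Atom σ ℕ)) (P w : ℕ) : Prop where
  args : ∀ f ∈ L, ∀ i, f.2 i ≤ dom
  input_le : ∀ v ∈ lay.encode dom L, v ≤ w
  length_le : (lay.encode dom L).length ≤ w
  code_le : ∀ R, lay.code R ≤ w
  K_le : lay.K ≤ w
  keys_le : ∀ t ∈ lay.tabs, (dom + 2) ^ t.keys.length ≤ P
  vars_le : (dom + 2) ^ lay.xs.length ≤ P
  words : (P + 1) * lay.stride ≤ w

open Classical in
/-- The state of the machine represents the contents of the tables and of the queue. -/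
structure Inv (lay : Layout σ X) (dom N w : ℕ) (M : Marks σ X) (q : Queue) (s : RamState Reg) :
    Prop where
  bounded : s.Bounded w
  zero : s.reg .zero = 0
  one : s.reg .one = 1
  size : s.reg .size = N
  base : s.reg .base = dom + 2
  stride : s.reg .stride = lay.stride
  qlen : s.reg .qlen = q.items.length
  qpos : s.reg .qpos = q.pos
  qrem : s.reg .qrem = q.rem
  pos_le : q.pos ≤ q.items.length
  rem_lt : q.rem < lay.K
  nodup : q.items.Nodup
  items : ∀ x ∈ q.items, x.length = lay.xs.length ∧ ∀ v ∈ x, v ≤ dom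
  table : ∀ t ∈ lay.tabs, ∀ ks : List ℕ, (∀ v ∈ ks, v ≤ dom) →
    s.mem (keyval (dom + 2) ks * lay.stride + lay.num t) = if (t, ks) ∈ M then 1 else 0
  dedup : ∀ ks : List ℕ, (∀ v ∈ ks, v ≤ dom) →
    s.mem (keyval (dom + 2) ks * lay.stride + lay.m) = if ks ∈ q.items then 1 else 0
  queue : ∀ j x, q.items[j]? = some x → ∀ i < lay.xs.length,
    s.mem (j * lay.stride + (lay.m + 1 + i)) = x.getD i 0

variable {lay : Layout σ X} {dom N w P : ℕ} {M : Marks σ X} {q : Queue} {s s' : RamState Reg}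
  {L : List (Atom σ ℕ)} {inp : List ℕ}

theorem Inv.congr (h : lay.Inv dom N w M q s) (hk : Keep 0 s s')
    (hq : ∀ r : Reg, r.IsQueue → s'.reg r = s.reg r) (hm : s'.mem = s.mem) (hb : s'.Bounded w) :
    lay.Inv dom N w M q s' where
  bounded := hb
  zero := (hk .zero trivial).trans h.zero
  one := (hk .one trivial).trans h.one
  size := (hk .size trivial).trans h.size
  base := (hk .base trivial).trans h.base
  stride := (hk .stride trivial).trans h.stride
  qlen := (hq .qlen trivial).trans h.qlen
  qpos := (hq .qpos trivial).trans h.qpos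
  qrem := (hq .qrem trivial).trans h.qrem
  pos_le := h.pos_le
  rem_lt := h.rem_lt
  nodup := h.nodup
  items := h.items
  table := hm ▸ h.table
  dedup := hm ▸ h.dedup
  queue := hm ▸ h.queue

/-- Tuples taken out of the queue stay in memory, so its size is controlled only by the number of
different tuples, which is polynomial. -/
theorem Inv.length_le (h : lay.Inv dom N w M q s) :
    q.items.length ≤ (dom + 2) ^ lay.xs.length := by
  have h1 : (q.items.map (keyval (dom + 2))).Nodup := by
    refine h.nodup.map_on fun x hx y hy hxy => ?_
    exact keyval_injOn (fun v hv => by have := (h.items x hx).2 v hv; omega)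
      (fun v hv => by have := (h.items y hy).2 v hv; omega) hxy
  have h2 : q.items.map (keyval (dom + 2)) ⊆ List.range ((dom + 2) ^ lay.xs.length) := by
    intro v hv
    obtain ⟨x, hx, rfl⟩ := List.mem_map.1 hv
    obtain ⟨hl, hx⟩ := h.items x hx
    rw [List.mem_range, ← hl]
    exact keyval_lt fun v hv => by have := hx v hv; omega
  simpa using (h1.subperm h2).length_le

/-- The arrays are interleaved: entry `v` of array `t` is cell `v * S + t`, and division with
remainder by `S` recovers both numbers. -/
theorem cell_inj {S v t v' t' : ℕ} (ht : t < S) (ht' : t' < S) (h : v * S + t = v' * S + t') :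
    v = v' ∧ t = t' := by
  have h1 : t = t' := by
    have := congrArg (· % S) h
    simp only [Nat.mul_add_mod_self_right] at this
    rwa [Nat.mod_eq_of_lt ht, Nat.mod_eq_of_lt ht'] at this
  subst h1
  exact ⟨Nat.eq_of_mul_eq_mul_right (by omega : 0 < S) (by omega), rfl⟩

end Layout

end Layout

/-! ### Code for the queue -/

/-- Stores the contents of `rs` in the arrays from number `t` on. -/
def storeRow : List Reg → ℕ → Code Reg
  | [], _ => .nil
  | r :: rs, t => offsetCode .qlen t ++ .op (.store .addr r) (storeRow rs (t + 1))

/-- Loads `n` output registers from number `i` on from the arrays from number `t` on. -/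
def loadRow : ℕ → ℕ → ℕ → Code Reg
  | _, _, 0 => .nil
  | i, t, n + 1 => offsetCode .qpos t ++ .op (.load (.out i) .addr) (loadRow (i + 1) (t + 1) n)

/-- Only scratch registers have changed. -/
def Quiet (s s' : RamState Reg) : Prop :=
  ∀ r : Reg, (∀ i, r ≠ .out i) → r ≠ .addr → r ≠ .tmp → s'.reg r = s.reg r

theorem Quiet.keep {s s' : RamState Reg} (h : Quiet s s') (d : ℕ) : Keep d s s' := by
  intro r hr
  exact h r (by rintro i rfl; exact hr) (by rintro rfl; exact hr) (by rintro rfl; exact hr)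

theorem Quiet.trans {s₁ s₂ s₃ : RamState Reg} (h : Quiet s₁ s₂) (h' : Quiet s₂ s₃) :
    Quiet s₁ s₃ := fun r h1 h2 h3 => (h' r h1 h2 h3).trans (h r h1 h2 h3)

section QueueCode

variable {w : ℕ} {inp : List ℕ}

theorem silent_storeRow : ∀ {rs : List Reg} {t : ℕ} {s : RamState Reg}, s.Bounded w →
    s.reg .qlen * s.reg .stride + t + rs.length ≤ w →
    (∀ r ∈ rs, (∀ i, r ≠ .out i) ∧ r ≠ .addr ∧ r ≠ .tmp) →
    ∃ s', Silent w inp (storeRow rs t) (4 * rs.length) s s' ∧ Quiet s s' ∧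
      (∀ i r, rs[i]? = some r → s'.mem (s.reg .qlen * s.reg .stride + (t + i)) = s.reg r) ∧
      ∀ a, (∀ i < rs.length, a ≠ s.reg .qlen * s.reg .stride + (t + i)) → s'.mem a = s.mem a
  | [], _, s, hb, _, _ => ⟨s, .nil hb, fun _ _ _ _ => rfl, by simp, fun _ _ => rfl⟩
  | r :: rs, t, s, hb, hw, hr => by
    rw [List.length_cons] at hw
    have h1 := silent_offsetCode (inp := inp) hb (r := .qlen) (t := t) (by omega)
    obtain ⟨hr1, hr2, hr3⟩ := hr r List.mem_cons_self
    set s₁ : RamState Reg := ⟨Function.update (Function.update s.reg .addr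
      (s.reg .qlen * s.reg .stride + t)) .tmp t, s.mem⟩ with hs₁
    have hq₁ : Quiet s s₁ := by
      intro r' _ h2 h3
      simp [hs₁, h2, h3]
    have ha₁ : s₁.reg .addr = s.reg .qlen * s.reg .stride + t := by simp [hs₁]
    have hrr : s₁.reg r = s.reg r := hq₁ r hr1 hr2 hr3
    set s₂ : RamState Reg := ⟨s₁.reg, Function.update s.mem
      (s.reg .qlen * s.reg .stride + t) (s.reg r)⟩ with hs₂
    have hb₂ : s₂.Bounded w := by
      refine ⟨h1.2.1.1, fun i => ?_⟩
      simp only [hs₂, Function.update_apply]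
      split_ifs
      · exact hb.1 r
      · exact hb.2 i
    have hql : s₂.reg .qlen = s.reg .qlen := hq₁ .qlen (by simp) (by simp) (by simp)
    have hst : s₂.reg .stride = s.reg .stride := hq₁ .stride (by simp) (by simp) (by simp)
    obtain ⟨s', h2, hq₂, h3, h4⟩ := silent_storeRow (rs := rs) (t := t + 1) hb₂
      (by rw [hql, hst]; omega) (fun r' hr' => hr r' (List.mem_cons_of_mem _ hr'))
    rw [hql, hst] at h3 h4
    have hq : Quiet s s₂ := hq₁
    refine ⟨s', (h1.append (C₂ := 4 * rs.length + 1) (.op h1.2.1 rfl ?_)).mono (by simp; omega),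
      hq.trans hq₂, ?_, ?_⟩
    · have : Op.apply inp s₁ (.store .addr r) = s₂ := by
        simp only [Op.apply, ha₁, hrr]
        rfl
      rwa [this]
    · intro i r' hi
      cases i with
      | zero =>
        obtain rfl : r = r' := by simpa using hi
        rw [h4 _ (by intro i _; omega)]
        simp [hs₂]
      | succ i =>
        rw [show t + (i + 1) = t + 1 + i by omega, h3 i r' (by simpa using hi)]
        obtain ⟨h5, h6, h7⟩ := hr r' (List.mem_cons_of_mem _
          (List.mem_of_getElem? (by simpa using hi)))
        exact hq r' h5 h6 h7
    · intro a ha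
      rw [h4 a (fun i hi => by
        have := ha (i + 1) (by simp; omega)
        rwa [show t + (i + 1) = t + 1 + i by omega] at this)]
      have := ha 0 (by simp)
      simp only [hs₂]
      rw [Function.update_of_ne]
      simpa using this

theorem silent_loadRow : ∀ {n i t : ℕ} {s : RamState Reg}, s.Bounded w →
    s.reg .qpos * s.reg .stride + t + n ≤ w →
    ∃ s', Silent w inp (loadRow i t n) (4 * n) s s' ∧ Quiet s s' ∧ s'.mem = s.mem ∧
      (∀ j < n, s'.reg (.out (i + j)) = s.mem (s.reg .qpos * s.reg .stride + (t + j))) ∧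
      ∀ j < i, s'.reg (.out j) = s.reg (.out j)
  | 0, _, _, s, hb, _ => ⟨s, .nil hb, fun _ _ _ _ => rfl, rfl, by simp, fun _ _ => rfl⟩
  | n + 1, i, t, s, hb, hw => by
    have h1 := silent_offsetCode (inp := inp) hb (r := .qpos) (t := t) (by omega)
    set s₁ : RamState Reg := ⟨Function.update (Function.update s.reg .addr
      (s.reg .qpos * s.reg .stride + t)) .tmp t, s.mem⟩ with hs₁
    have ha₁ : s₁.reg .addr = s.reg .qpos * s.reg .stride + t := by simp [hs₁]
    set s₂ : RamState Reg := ⟨Function.update s₁.reg (.out i)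
      (s.mem (s.reg .qpos * s.reg .stride + t)), s.mem⟩ with hs₂
    have hb₂ : s₂.Bounded w := h1.2.1.update (hb.2 _)
    have hq : Quiet s s₂ := by
      intro r' h1 h2 h3
      simp [hs₂, hs₁, h1, h2, h3]
    have hql : s₂.reg .qpos = s.reg .qpos := hq .qpos (by simp) (by simp) (by simp)
    have hst : s₂.reg .stride = s.reg .stride := hq .stride (by simp) (by simp) (by simp)
    obtain ⟨s', h2, hq₂, hm, h3, h4⟩ := silent_loadRow (n := n) (i := i + 1) (t := t + 1) hb₂
      (by rw [hql, hst]; omega)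
    rw [hql, hst] at h3
    refine ⟨s', (h1.append (C₂ := 4 * n + 1) (.op h1.2.1 rfl ?_)).mono (by omega),
      hq.trans hq₂, hm, ?_, ?_⟩
    · have : Op.apply inp s₁ (.load (.out i) .addr) = s₂ := by
        simp only [Op.apply, ha₁]
        rfl
      rwa [this]
    · intro j hj
      cases j with
      | zero =>
        rw [add_zero, h4 i (Nat.lt_succ_self i)]
        simp [hs₂]
      | succ j =>
        rw [show i + (j + 1) = i + 1 + j by omega, h3 j (by omega)]
        rw [show t + 1 + j = t + (j + 1) by omega]
    · intro j hj
      rw [h4 j (by omega)]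
      have : (Reg.out j) ≠ .out i := by simp; omega
      simp [hs₂, hs₁, this]

end QueueCode

/-- The registers that may hold the value of a variable at depth `d`. -/
def Reg.IsVal (d : ℕ) : Reg → Prop
  | .zero => True
  | .val d' _ => d' < d
  | _ => False

theorem Reg.IsVal.fixed {d : ℕ} {r : Reg} (h : r.IsVal d) : r.Fixed d := by
  cases r <;> simp_all [Reg.IsVal, Reg.Fixed]

theorem Reg.IsVal.mono {d d' : ℕ} (hd : d ≤ d') {r : Reg} (h : r.IsVal d) : r.IsVal d' := by
  cases r <;> simp_all [Reg.IsVal]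
  omega

theorem RamState.Bounded.store {w : ℕ} {s : RamState Reg} (hb : s.Bounded w) {a v : ℕ}
    (hv : v ≤ w) : RamState.Bounded w ⟨s.reg, Function.update s.mem a v⟩ := by
  refine ⟨hb.1, fun i => ?_⟩
  dsimp only
  rw [Function.update_apply]
  split_ifs
  · exact hv
  · exact hb.2 i

theorem Exec.op_eq {w : ℕ} {inp : List ℕ} {o : Op Reg} {k : Code Reg} {s s₁ s' : RamState Reg}
    {tr : Trace (List ℕ)} {x : Option (List ℕ)} (hb : s.Bounded w) (ho : o.out s = x)
    (hs : o.apply inp s = s₁) (h : Exec w inp k s₁ tr s') :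
    Exec w inp (.op o k) s (x :: tr) s' := by
  subst hs ho
  exact .op hb h

theorem Silent.op_eq {w : ℕ} {inp : List ℕ} {o : Op Reg} {k : Code Reg} {s s₁ s' : RamState Reg}
    {C : ℕ} (hb : s.Bounded w) (ho : o.out s = none)
    (hs : o.apply inp s = s₁) (h : Silent w inp k C s₁ s') :
    Silent w inp (.op o k) (C + 1) s s' := by
  subst hs
  exact .op hb ho h

/-- Loads the entry of array number `t` for the contents of `rs` into a scratch register. -/
def lookupCode (rs : List Reg) (t : ℕ) : Code Reg :=
  keyBody rs ++ (offsetCode .addr t ++ .op (.load .tmp .addr) .nil)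

theorem silent_lookupCode {w : ℕ} {inp : List ℕ} {s : RamState Reg} (hb : s.Bounded w)
    (h1 : s.reg .one = 1) (h0 : 0 < s.reg .base) (hS : 0 < s.reg .stride) {rs : List Reg} {t : ℕ}
    (hr : ∀ r ∈ rs, r ≠ .addr)
    (hw : keyval (s.reg .base) (rs.map s.reg) * s.reg .stride + t ≤ w) :
    ∃ s', Silent w inp (lookupCode rs t) (3 * rs.length + 5) s s' ∧ s'.mem = s.mem ∧
      s'.reg .addr = keyval (s.reg .base) (rs.map s.reg) * s.reg .stride + t ∧
      s'.reg .tmp = s.mem (keyval (s.reg .base) (rs.map s.reg) * s.reg .stride + t) ∧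
      ∀ r, r ≠ .addr → r ≠ .tmp → s'.reg r = s.reg r := by
  have hk : keyval (s.reg .base) (rs.map s.reg) ≤ w :=
    (Nat.le_mul_of_pos_right _ hS).trans (by omega)
  have h2 := silent_keyBody (inp := inp) hb h1 h0 hr hk
  have h3 := silent_offsetCode (inp := inp) h2.2.1 (r := .addr) (t := t) (by simpa using hw)
  have h4 := h3.2.1.update (r := .tmp) (hb.2 (keyval (s.reg .base) (rs.map s.reg) *
    s.reg .stride + t))
  refine ⟨_, (h2.append (h3.append (.op_eq h3.2.1 rfl (by simp [Op.apply]) (.nil h4)))).mono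
    (by omega), rfl, ?_, ?_, ?_⟩
  · simp
  · simp
  · intro r h4 h5
    simp [h4, h5]

namespace Layout

section Queue

variable {σ : Schema} {X : Type} {lay : Layout σ X} {dom N w P : ℕ} {M : Marks σ X} {q : Queue}
  {s s' : RamState Reg} {L : List (Atom σ ℕ)} {inp : List ℕ}

theorem Inv.update (h : lay.Inv dom N w M q s) {r : Reg} (hr : ¬ r.Fixed 0) (hq : ¬ r.IsQueue)
    {v : ℕ} (hv : v ≤ w) : lay.Inv dom N w M q ⟨Function.update s.reg r v, s.mem⟩ := by
  refine h.congr ((Keep.refl 0 s).update hr v _) (fun r' hr' => ?_) rfl (h.bounded.update hv)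
  have : r' ≠ r := by rintro rfl; exact hq hr'
  simp [Function.update_of_ne this]

theorem stride_pos (lay : Layout σ X) : 0 < lay.stride := by
  simp only [Layout.stride]
  omega

theorem Fits.cell_le (hf : lay.Fits dom L P w) {a t : ℕ} (ha : a ≤ P) (ht : t ≤ lay.stride) :
    a * lay.stride + t ≤ w := by
  refine le_trans ?_ hf.words
  rw [add_mul, one_mul]
  exact add_le_add (Nat.mul_le_mul_right _ ha) ht

/-- Outputs a tuple of the queue. -/
def popCode (lay : Layout σ X) : Code Reg :=
  loadRow 0 (lay.m + 1) lay.xs.length ++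
    .op (.add .qpos .qpos .one) (.op (.emit ((List.range lay.xs.length).map .out)) .nil)

theorem Inv.pop (h : lay.Inv dom N w M q s) (hf : lay.Fits dom L P w) (hp : q.pos < q.items.length)
    (d : ℕ) :
    ∃ n ≤ 4 * lay.xs.length + 1, ∃ s', Exec w inp lay.popCode s
      (List.replicate n none ++ [some q.items[q.pos]]) s' ∧
      lay.Inv dom N w M { q with pos := q.pos + 1 } s' ∧ Keep d s s' := by
  have hP : q.items.length ≤ P := h.length_le.trans hf.vars_le
  have hPw : P ≤ w := by
    have := hf.cell_le (a := P) (t := 0) le_rfl (Nat.zero_le _)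
    exact (Nat.le_mul_of_pos_right P lay.stride_pos).trans (by omega)
  obtain ⟨s₁, h1, hq, hm, h2, -⟩ := silent_loadRow (inp := inp) (n := lay.xs.length) (i := 0)
    (t := lay.m + 1) h.bounded (by
      rw [h.qpos, h.stride, add_assoc]
      exact hf.cell_le (by omega) le_rfl)
  have hI := h.congr (hq.keep 0) (fun r hr => hq r (by rintro i rfl; exact hr)
    (by rintro rfl; exact hr) (by rintro rfl; exact hr)) hm h1.2.1
  have hb₂ := h1.2.1.update (r := .qpos) (v := q.pos + 1) (by omega)
  obtain ⟨-, -, n, hn, h1⟩ := h1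
  have hx := h.items _ (List.getElem_mem hp)
  refine ⟨n + 1, by omega, ⟨Function.update s₁.reg .qpos (q.pos + 1), s₁.mem⟩, ?_, ?_, ?_⟩
  · have h3 : ((List.range lay.xs.length).map Reg.out).map
        (Function.update s₁.reg .qpos (q.pos + 1)) = q.items[q.pos] := by
      refine List.ext_getElem (by simp [hx.1]) fun i hi hi' => ?_
      have hi2 : i < lay.xs.length := by simpa using hi
      have h4 := h2 i hi2
      rw [zero_add, h.qpos, h.stride, h.queue _ _ (List.getElem?_eq_getElem hp) i hi2] at h4
      simp [h4, List.getD_eq_getElem?_getD, List.getElem?_eq_getElem hi']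
    have h5 : Op.apply inp s₁ (.add .qpos .qpos .one) =
        ⟨Function.update s₁.reg .qpos (q.pos + 1), s₁.mem⟩ := by
      simp [Op.apply, hI.qpos, hI.one]
    have := h1.append (.op_eq hI.bounded rfl h5
      (.op_eq (o := .emit ((List.range lay.xs.length).map .out)) hb₂ (congrArg some h3) rfl
        (.nil _)))
    rw [List.replicate_succ', List.append_assoc]
    exact this
  · exact
    { bounded := hb₂
      zero := by simp [hI.zero]
      one := by simp [hI.one]
      size := by simp [hI.size]
      base := by simp [hI.base]
      stride := by simp [hI.stride]
      qlen := by simp [hI.qlen]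
      qpos := by simp
      qrem := by simp [hI.qrem]
      pos_le := hp
      rem_lt := h.rem_lt
      nodup := h.nodup
      items := h.items
      table := hI.table
      dedup := hI.dedup
      queue := hI.queue }
  · exact (hq.keep d).update (by simp [Reg.Fixed]) _ _

/-- Enters a tuple into the queue. -/
def insertCode (lay : Layout σ X) (rs : List Reg) : Code Reg :=
  lookupCode rs lay.m ++ .ite .zero .tmp .nil
    (.op (.store .addr .one) (storeRow rs (lay.m + 1) ++ .op (.add .qlen .qlen .one) .nil)) .nil

theorem Inv.queue_insert (h : lay.Inv dom N w M q s) (hf : lay.Fits dom L P w)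
    (hv : lay.Valid) {d : ℕ} {rs : List Reg} (hrs : rs.length = lay.xs.length)
    (hr : ∀ r ∈ rs, r.IsVal d ∧ s.reg r ≤ dom) :
    ∃ s', Silent w inp (lay.insertCode rs) (7 * lay.xs.length + 9) s s' ∧
      lay.Inv dom N w M (q.insert (rs.map s.reg)) s' ∧ Keep d s s' := by
  set x := rs.map s.reg with hx
  have hxl : x.length = lay.xs.length := by simp [hx, hrs]
  have hxd : ∀ v ∈ x, v ≤ dom := by
    intro v hv
    obtain ⟨r, hr', rfl⟩ := List.mem_map.1 hv
    exact (hr r hr').2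
  have hS : 0 < lay.stride := lay.stride_pos
  have hmS : lay.m < lay.stride := by simp only [Layout.stride]; omega
  have hkP : keyval (dom + 2) x ≤ P := by
    refine le_trans (keyval_lt fun v hv => ?_).le (hxl ▸ hf.vars_le)
    have := hxd v hv
    omega
  have hrn : ∀ r ∈ rs, (∀ i, r ≠ .out i) ∧ r ≠ .addr ∧ r ≠ .tmp := by
    intro r hr'
    have := (hr r hr').1
    refine ⟨?_, ?_, ?_⟩ <;> [rintro i rfl; rintro rfl; rintro rfl] <;> exact this
  obtain ⟨s₁, h1, hm, ha, ht, hreg⟩ := silent_lookupCode (inp := inp) h.bounded h.one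
    (by rw [h.base]; omega) (by rw [h.stride]; exact hS) (rs := rs) (t := lay.m)
    (fun r hr' => (hrn r hr').2.1) (by
      rw [h.base, h.stride]
      exact hf.cell_le hkP hmS.le)
  rw [h.base, h.stride, ← hx] at ha ht
  rw [h.dedup x hxd] at ht
  have hk₁ : ∀ d, Keep d s s₁ := fun d r hr => hreg r (by rintro rfl; exact hr)
    (by rintro rfl; exact hr)
  have hI₁ := h.congr (hk₁ 0) (fun r hr => hreg r (by rintro rfl; exact hr)
    (by rintro rfl; exact hr)) hm h1.2.1
  by_cases hxq : x ∈ q.items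
  · rw [if_pos hxq] at ht
    refine ⟨s₁, (h1.append (.yes (C₁ := 0) (C₂ := 0) ?_ (.nil h1.2.1) (.nil h1.2.1))).mono
      (by omega), ?_, hk₁ d⟩
    · rw [hI₁.zero, ht]; exact one_pos
    · rw [Queue.insert, if_pos hxq]
      exact hI₁
  · rw [if_neg hxq] at ht
    set A := keyval (dom + 2) x * lay.stride + lay.m with hA
    have hw1 : 1 ≤ w := hI₁.one ▸ hI₁.bounded.1 .one
    set s₂ : RamState Reg := ⟨s₁.reg, Function.update s₁.mem A 1⟩ with hs₂
    have hb₂ : s₂.Bounded w := h1.2.1.store hw1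
    -- Together with the new tuple `x` there are still at most this many different tuples, so a free
    -- row remains.
    have hlt : q.items.length < (dom + 2) ^ lay.xs.length := by
      have h3 : (q.items ++ [x]).Nodup := by
        rw [List.nodup_append]
        exact ⟨h.nodup, by simp, by rintro a ha b hb rfl; simp_all⟩
      have h1 : ((q.items ++ [x]).map (keyval (dom + 2))).Nodup := by
        have h4 : ∀ y ∈ q.items ++ [x], ∀ v ∈ y, v + 2 ≤ dom + 2 := by
          intro y hy v hv
          rcases List.mem_append.1 hy with hy | hy
          · have := (h.items y hy).2 v hv; omega
          · obtain rfl := List.mem_singleton.1 hy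
            have := hxd v hv; omega
        exact h3.map_on fun y hy z hz hyz => keyval_injOn (h4 y hy) (h4 z hz) hyz
      have h2 : (q.items ++ [x]).map (keyval (dom + 2)) ⊆
          List.range ((dom + 2) ^ lay.xs.length) := by
        intro v hv
        obtain ⟨y, hy, rfl⟩ := List.mem_map.1 hv
        obtain ⟨hl, hy⟩ : y.length = lay.xs.length ∧ ∀ v ∈ y, v ≤ dom := by
          rcases List.mem_append.1 hy with hy | hy
          · exact h.items y hy
          · obtain rfl := List.mem_singleton.1 hy
            exact ⟨hxl, hxd⟩
        rw [List.mem_range, ← hl]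
        exact keyval_lt fun v hv => by have := hy v hv; omega
      have := (h1.subperm h2).length_le
      simp at this
      omega
    have hlP : q.items.length < P := hlt.trans_le hf.vars_le
    have hlw : q.items.length + 1 ≤ w := by
      have := hf.cell_le (a := P) (t := 0) le_rfl (Nat.zero_le _)
      exact hlP.trans_le ((Nat.le_mul_of_pos_right P hS).trans (by omega))
    have hql : s₂.reg .qlen = q.items.length := hI₁.qlen
    have hst : s₂.reg .stride = lay.stride := hI₁.stride
    obtain ⟨s₃, h2, hq₃, h3, h4⟩ := silent_storeRow (inp := inp) (rs := rs) (t := lay.m + 1) hb₂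
      (by rw [hql, hst, add_assoc, hrs]; exact hf.cell_le hlP.le le_rfl) hrn
    rw [hql, hst] at h3 h4
    -- The new row touches only index `items.length` of the arrays numbered above `m`; tables,
    -- lookup array and older rows are unaffected.
    have hne : ∀ a t, t < lay.stride → (a ≠ q.items.length ∨ t ≤ lay.m) →
        s₃.mem (a * lay.stride + t) = s₂.mem (a * lay.stride + t) := by
      intro a t ht hat
      refine h4 _ fun i hi he => ?_
      have := cell_inj ht (by simp only [Layout.stride]; omega) he
      omega
    have hk₃ : ∀ d, Keep d s s₃ := fun d => (hk₁ d).trans (hq₃.keep d)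
    have hb₄ := h2.2.1.update (r := .qlen) hlw
    have hA' : Op.apply inp s₁ (.store .addr .one) = s₂ := by
      simp [Op.apply, ha, hI₁.one, hs₂]
    have hq₃l : s₃.reg .qlen = q.items.length :=
      (hq₃ .qlen (by simp) (by simp) (by simp)).trans hql
    have hF : ∀ r : Reg, r.Fixed 0 → s₃.reg r = s.reg r := hk₃ 0
    refine ⟨⟨Function.update s₃.reg .qlen (q.items.length + 1), s₃.mem⟩,
      (h1.append (.no (C₁ := 4 * rs.length + 1 + 1) (C₂ := 0) ?_ (.op_eq h1.2.1 rfl hA'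
        (h2.append (.op h2.2.1 rfl (.of_eq hb₄ ?_)))) (.nil hb₄))).mono
      (by omega), ?_, (hk₃ d).update (by simp [Reg.Fixed]) _ _⟩
    · rw [ht]; exact Nat.zero_le _
    · simp [Op.apply, hq₃l, (hF .one trivial).trans h.one]
    · rw [Queue.insert, if_neg hxq]
      refine
      { bounded := hb₄
        zero := by simpa using (hF .zero trivial).trans h.zero
        one := by simpa using (hF .one trivial).trans h.one
        size := by simpa using (hF .size trivial).trans h.size
        base := by simpa using (hF .base trivial).trans h.base
        stride := by simpa using (hF .stride trivial).trans h.stride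
        qlen := by simp
        qpos := by simpa using (hq₃ .qpos (by simp) (by simp) (by simp)).trans hI₁.qpos
        qrem := by simpa using (hq₃ .qrem (by simp) (by simp) (by simp)).trans hI₁.qrem
        pos_le := by simpa using h.pos_le.trans (Nat.le_succ _)
        rem_lt := h.rem_lt
        nodup := ?_
        items := ?_
        table := ?_
        dedup := ?_
        queue := ?_ }
      · simp only [List.nodup_append]
        exact ⟨h.nodup, by simp, by rintro a ha b hb rfl; simp_all⟩
      · intro y hy
        rcases List.mem_append.1 hy with hy | hy
        · exact h.items y hy
        · obtain rfl := List.mem_singleton.1 hy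
          exact ⟨hxl, hxd⟩
      · intro t ht' ks hks
        have hn := hv.num_lt t ht'
        rw [hne _ _ (by omega) (.inr hn.le), hs₂]
        simp only
        rw [Function.update_of_ne, hm, h.table t ht' ks hks]
        intro he
        have := cell_inj (by omega) hmS he
        omega
      · intro ks hks
        rw [hne _ _ hmS (.inr le_rfl), hs₂]
        simp only [Function.update_apply]
        by_cases he : ks = x
        · subst he
          simp [hA]
        · rw [if_neg, hm, h.dedup ks hks]
          · simp [he]
          · intro he'
            exact he (keyval_injOn (fun v hv => by have := hks v hv; omega)
              (fun v hv => by have := hxd v hv; omega) (cell_inj hmS hmS he').1)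
      · intro j y hj i hi
        by_cases hjl : j < q.items.length
        · rw [hne _ _ (by simp only [Layout.stride]; omega) (.inl hjl.ne), hs₂]
          simp only
          rw [Function.update_of_ne, hm]
          · refine h.queue j y ?_ i hi
            rwa [List.getElem?_append_left hjl] at hj
          · intro he
            have := cell_inj (by simp only [Layout.stride]; omega) hmS he
            omega
        · have hjl' : j = q.items.length := by
            have := (List.getElem?_eq_some_iff.1 hj).1
            simp at this
            omega
          subst hjl'
          obtain rfl : x = y := by simpa using hj
          have hi' : i < rs.length := by omega
          rw [h3 i _ (List.getElem?_eq_getElem hi')]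
          have h5 : s₂.reg rs[i] = s.reg rs[i] :=
            hreg _ (hrn _ (List.getElem_mem hi')).2.1 (hrn _ (List.getElem_mem hi')).2.2
          simp [h5, hx, List.getD_eq_getElem?_getD, List.getElem?_eq_getElem hi']

/-- Counts, and from time to time outputs a tuple. -/
def tickCode (lay : Layout σ X) : Code Reg :=
  .op (.add .qrem .qrem .one) (.op (.const .tmp lay.K) (.ite .qrem .tmp .nil
    (.op (.const .qrem 0) (.ite .qpos .qlen lay.popCode .nil .nil)) .nil))

theorem Inv.setRem (h : lay.Inv dom N w M q s) {v : ℕ} (hv : v ≤ w) {v' : ℕ} (hv' : v' < lay.K)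
    (hvv : v = v') :
    lay.Inv dom N w M { q with rem := v' } ⟨Function.update s.reg .qrem v, s.mem⟩ where
  bounded := h.bounded.update hv
  zero := by simp [h.zero]
  one := by simp [h.one]
  size := by simp [h.size]
  base := by simp [h.base]
  stride := by simp [h.stride]
  qlen := by simp [h.qlen]
  qpos := by simp [h.qpos]
  qrem := by simp [hvv]
  pos_le := h.pos_le
  rem_lt := hv'
  nodup := h.nodup
  items := h.items
  table := h.table
  dedup := h.dedup
  queue := h.queue

/-- The output is described as the segment of `items` between the old and the new position, empty or
a single tuple. Such segments concatenate along a run. -/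
theorem Inv.queue_tick (h : lay.Inv dom N w M q s) (hf : lay.Fits dom L P w) (d : ℕ) :
    ∃ tr s', Exec w inp lay.tickCode s tr s' ∧ tr.length ≤ 4 * lay.xs.length + 7 ∧
      tr.reduceOption = (q.items.take (q.tick lay.K).pos).drop q.pos ∧
      lay.Inv dom N w M (q.tick lay.K) s' ∧ Keep d s s' := by
  have hK := hf.K_le
  have hr := h.rem_lt
  set s₁ : RamState Reg := ⟨Function.update s.reg .qrem (q.rem + 1), s.mem⟩ with hs₁
  have hs₁' : Op.apply inp s (.add .qrem .qrem .one) = s₁ := by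
    simp [Op.apply, h.qrem, h.one, hs₁]
  have hb₁ : s₁.Bounded w := h.bounded.update (by omega)
  set s₂ : RamState Reg := ⟨Function.update s₁.reg .tmp lay.K, s.mem⟩ with hs₂
  have hb₂ : s₂.Bounded w := hb₁.update hK
  have hk₂ : ∀ d, Keep d s s₂ := fun d =>
    ((Keep.refl d s).update (r := .qrem) (by simp [Reg.Fixed]) (q.rem + 1) s.mem).update
      (r := .tmp) (by simp [Reg.Fixed]) lay.K s.mem
  have hdrop : (q.items.take q.pos).drop q.pos = [] := by simp
  by_cases hlt : q.rem + 1 < lay.K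
  · have hI₂ : lay.Inv dom N w M { q with rem := q.rem + 1 } s₂ :=
      (h.setRem (by omega) hlt rfl).update (r := .tmp) (by simp [Reg.Fixed])
        (by simp [Reg.IsQueue]) hK
    refine ⟨_, s₂, .op_eq h.bounded rfl hs₁' (.op_eq hb₁ rfl rfl (.yes hb₂ ?_ (.nil _) (.nil _))),
      ?_, ?_, ?_, hk₂ d⟩
    · simpa [Op.apply, hs₁] using hlt
    · simp
    · simp [Queue.tick, hlt, Op.out]
    · simpa [Queue.tick, hlt] using hI₂
  · have hI₀ : lay.Inv dom N w M q ⟨Function.update s.reg .tmp lay.K, s.mem⟩ :=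
      h.update (r := .tmp) (by simp [Reg.Fixed]) (by simp [Reg.IsQueue]) hK
    have hI₃ := hI₀.setRem (v := 0) (Nat.zero_le _) (by omega : 0 < lay.K) rfl
    set s₃ : RamState Reg := ⟨Function.update s₂.reg .qrem 0, s.mem⟩ with hs₃
    have hs₃' : s₃ = ⟨Function.update (Function.update s.reg .tmp lay.K) .qrem 0, s.mem⟩ := by
      simp only [hs₃, hs₂, hs₁, RamState.mk.injEq, and_true]
      funext r
      simp only [Function.update_apply]
      split_ifs <;> simp_all
    rw [← hs₃'] at hI₃
    have hk₃ : Keep d s s₃ := (hk₂ d).update (r := .qrem) (by simp [Reg.Fixed]) 0 s.mem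
    by_cases hp : q.pos < q.items.length
    · obtain ⟨n, hn, s', he, hI', hk'⟩ := hI₃.pop (inp := inp) hf hp d
      refine ⟨_, s', .op_eq h.bounded rfl hs₁' (.op_eq hb₁ rfl rfl (.no hb₂ ?_
        (.op_eq hb₂ rfl rfl (.yes (s₁ := s₃) hI₃.bounded ?_ he (.nil _))) (.nil _))), ?_, ?_, ?_,
        hk₃.trans hk'⟩
      · simpa [Op.apply, hs₁] using hlt
      · rw [hI₃.qpos, hI₃.qlen]
        exact hp
      · simp
        omega
      · simp only [Queue.tick, hlt, hp, if_true, if_false, Op.out, List.append_nil,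
          List.reduceOption_cons_of_none, List.reduceOption_append]
        rw [List.take_add_one, List.drop_append]
        simp [hp, h.pos_le, List.reduceOption_replicate_none]
      · simpa [Queue.tick, hlt, hp] using hI'
    · refine ⟨_, s₃, .op_eq h.bounded rfl hs₁' (.op_eq hb₁ rfl rfl (.no hb₂ ?_
        (.op_eq hb₂ rfl rfl (.no (s₁ := s₃) hI₃.bounded ?_ (.nil _) (.nil _))) (.nil _))),
        ?_, ?_, ?_, hk₃⟩
      · simpa [Op.apply, hs₁] using hlt
      · rw [hI₃.qpos, hI₃.qlen]
        exact not_lt.1 hp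
      · simp
      · simp [Queue.tick, hlt, hp, Op.out]
      · simpa [Queue.tick, hlt, hp] using hI₃

end Queue

end Layout

/-! ### Implementation of traces -/

/-- A trace of a machine that implements a trace of events: between events it is silent, and at
each event the result is entered into the queue, and possibly a tuple of the queue is output. -/
inductive Impl {β : Type} (C K : ℕ) (f : β → List ℕ) :
    Queue → Trace β → Trace (List ℕ) → Queue → Prop
  | nil (q) : Impl C K f q [] [] q
  | tick {q as tr q' n} : n ≤ C → Impl C K f q as tr q' →
      Impl C K f q (none :: as) (List.replicate n none ++ tr) q'
  | event {q h t as tr q'} : t.length ≤ C →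
      t.reduceOption =
        (((q.insert (f h)).tick K).items.take ((q.insert (f h)).tick K).pos).drop q.pos →
      Impl C K f ((q.insert (f h)).tick K) as tr q' →
      Impl C K f q (some h :: as) (t ++ tr) q'

namespace Impl

variable {β : Type} {C C' K : ℕ} {f : β → List ℕ} {q q₁ q₂ : Queue} {as as' : Trace β}
  {tr tr' : Trace (List ℕ)}

theorem append (h : Impl C K f q as tr q₁) (h' : Impl C K f q₁ as' tr' q₂) :
    Impl C K f q (as ++ as') (tr ++ tr') q₂ := by
  induction h with
  | nil => exact h'
  | tick hn _ ih =>
    rw [List.append_assoc]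
    exact .tick hn (ih h')
  | event h1 h2 _ ih =>
    rw [List.append_assoc]
    exact .event h1 h2 (ih h')

theorem mono (hC : C ≤ C') (h : Impl C K f q as tr q₁) : Impl C' K f q as tr q₁ := by
  induction h with
  | nil => exact .nil _
  | tick hn _ ih => exact .tick (hn.trans hC) ih
  | event h1 h2 _ ih => exact .event (h1.trans hC) h2 ih

theorem silent {n : ℕ} (hn : n ≤ C) : Impl C K f q [none] (List.replicate n none) q := by
  simpa using Impl.tick hn (.nil q)

end Impl

/-! ### Code for generators -/

/-- `if a = b then yes else no` -/
def ifEq (a b : Reg) (yes no : Code Reg) : Code Reg :=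
  .ite a b no (.ite b a no yes .nil) .nil

/-- Executes `c` if both registers of each pair have the same contents. -/
def checkCode : List (Reg × Reg) → Code Reg → Code Reg
  | [], c => c
  | p :: ps, c => ifEq p.1 p.2 (checkCode ps c) .nil

/-- Reads `n` words of the input. -/
def readCode (d : ℕ) : ℕ → ℕ → Code Reg
  | _, 0 => .nil
  | i, n + 1 => .op (.input (.val d i) (.ptr d)) (.op (.add (.ptr d) (.ptr d) .one)
      (readCode d (i + 1) n))

section Pieces

variable {w : ℕ} {inp : List ℕ} {s s' : RamState Reg}

theorem Exec.ifEq_pos {a b : Reg} {yes no : Code Reg} {tr : Trace (List ℕ)} (hb : s.Bounded w)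
    (hab : s.reg a = s.reg b) (h : Exec w inp yes s tr s') :
    Exec w inp (ifEq a b yes no) s (List.replicate 2 none ++ tr) s' := by
  simpa [ifEq] using Exec.no hb hab.ge (.no hb hab.le h (.nil _)) (.nil _)

theorem Exec.ifEq_neg {a b : Reg} {yes no : Code Reg} {tr : Trace (List ℕ)} (hb : s.Bounded w)
    (hab : s.reg a ≠ s.reg b) (h : Exec w inp no s tr s') :
    ∃ n ≤ 2, Exec w inp (ifEq a b yes no) s (List.replicate n none ++ tr) s' := by
  rcases lt_or_gt_of_ne hab with hab | hab
  · exact ⟨1, by omega, by simpa [ifEq] using Exec.yes hb hab h (.nil _)⟩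
  · exact ⟨2, le_rfl, by simpa [ifEq] using Exec.no hb hab.le (.yes hb hab h (.nil _)) (.nil _)⟩

theorem Exec.check_pos {c : Code Reg} {tr : Trace (List ℕ)} (hb : s.Bounded w)
    (h : Exec w inp c s tr s') : ∀ {ps : List (Reg × Reg)}, (∀ p ∈ ps, s.reg p.1 = s.reg p.2) →
    Exec w inp (checkCode ps c) s (List.replicate (2 * ps.length) none ++ tr) s'
  | [], _ => by simpa [checkCode] using h
  | p :: ps, hp => by
    have := (Exec.check_pos hb h fun p hp' => hp p (List.mem_cons_of_mem _ hp')).ifEq_pos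
      (no := .nil) hb (hp p List.mem_cons_self)
    rwa [← List.append_assoc, ← List.replicate_add,
      show 2 + 2 * ps.length = 2 * (p :: ps).length by simp; omega] at this

theorem Exec.check_neg {c : Code Reg} (hb : s.Bounded w) : ∀ {ps : List (Reg × Reg)},
    (¬ ∀ p ∈ ps, s.reg p.1 = s.reg p.2) →
    ∃ n ≤ 2 * ps.length, Exec w inp (checkCode ps c) s (List.replicate n none) s
  | [], hp => by simp at hp
  | p :: ps, hp => by
    by_cases h : s.reg p.1 = s.reg p.2
    · obtain ⟨n, hn, h1⟩ := Exec.check_neg (c := c) hb (ps := ps)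
        (fun h' => hp (by simp [h]; simpa using h'))
      refine ⟨2 + n, by simp; omega, ?_⟩
      rw [List.replicate_add]
      exact h1.ifEq_pos hb h
    · obtain ⟨n, hn, h1⟩ := Exec.ifEq_neg (yes := checkCode ps c) hb h (.nil s)
      exact ⟨n, by simp; omega, by simpa [checkCode] using h1⟩

theorem silent_readCode {d : ℕ} (hin : ∀ a, inp.getD a 0 ≤ w) : ∀ {n i : ℕ} {s : RamState Reg},
    s.Bounded w → s.reg .one = 1 → s.reg (.ptr d) + n ≤ w →
    ∃ s', Silent w inp (readCode d i n) (2 * n) s s' ∧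
      (∀ j < n, s'.reg (.val d (i + j)) = inp.getD (s.reg (.ptr d) + j) 0) ∧
      s'.reg (.ptr d) = s.reg (.ptr d) + n ∧ s'.mem = s.mem ∧
      ∀ r, r ≠ .ptr d → (∀ j, i ≤ j → r ≠ .val d j) → s'.reg r = s.reg r
  | 0, i, s, hb, _, _ => ⟨s, .nil hb, by simp, rfl, rfl, fun _ _ _ => rfl⟩
  | n + 1, i, s, hb, h1, hw => by
    have hb₁ := hb.update (r := .val d i) (hin (s.reg (.ptr d)))
    have hb₂ := hb₁.update (r := .ptr d) (v := s.reg (.ptr d) + 1) (by omega)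
    obtain ⟨s', h2, h3, h4, h5, h6⟩ := silent_readCode (d := d) hin (n := n) (i := i + 1) hb₂
      (by simpa using h1) (by simpa using by omega)
    refine ⟨s', (Silent.op_eq hb rfl (by rfl) (.op_eq hb₁ rfl ?_ h2)).mono (by omega),
      ?_, ?_, h5, ?_⟩
    · simp [Op.apply, h1]
    · intro j hj
      cases j with
      | zero =>
        rw [h6 _ (by simp) (by intro j hj; simp; omega)]
        simp
      | succ j =>
        rw [show i + (j + 1) = i + 1 + j by omega, h3 j (by omega)]
        simp [add_assoc, add_comm 1 j]
    · rw [h4]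
      simp [add_assoc, add_comm 1 n]
    · intro r hr hr'
      rw [h6 r hr fun j hj => hr' j (by omega)]
      simp [hr, hr' i le_rfl]

end Pieces

namespace Layout

section Comp

variable {σ : Schema} {X : Type}

/-- Moves on the input pointer over the arguments of a fact with the current symbol. -/
def skipCode (lay : Layout σ X) (d : ℕ) : List σ.Sym → Code Reg
  | [] => .nil
  | R :: Rs => .op (.const .tmp (lay.code R)) (ifEq .sym .tmp
      (.op (.const .skip (σ.arity R)) (.op (.add (.ptr d) (.ptr d) .skip) .nil))
      (lay.skipCode d Rs))

open Classical in
/-- The registers of the variables after the arguments of a fact matching `a` have been read. -/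
noncomputable def bindEnv (d : ℕ) (e : X → Reg) (a : Atom σ X) (S : Finset X) (x : X) : Reg :=
  if h : x ∉ S ∧ ∃ i, a.2 i = x then .val d h.2.choose else e x

/-- Processes one fact. -/
noncomputable def scanBody (lay : Layout σ X) (d : ℕ) (e : X → Reg) (a : Atom σ X) (S : Finset X)
    (c : Code Reg) : Code Reg :=
  .op (.input .sym (.ptr d)) (.op (.add (.ptr d) (.ptr d) .one) (.op (.add (.cnt d) (.cnt d) .one)
    (.op (.const .tmp (lay.code a.1)) (ifEq .sym .tmp
      (readCode d 0 (σ.arity a.1) ++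
        checkCode ((List.finRange (σ.arity a.1)).map fun i =>
          (bindEnv d e a S (a.2 i), .val d i)) c)
      (lay.skipCode d lay.syms)))))

/-- The code for a generator at depth `d`, where `e` gives the registers of the variables. -/
noncomputable def comp (lay : Layout σ X) : Gen σ X → ℕ → (X → Reg) → Code Reg
  | .skip, _, _ => .nil
  | .seq g₁ g₂, d, e => lay.comp g₁ d e ++ lay.comp g₂ d e
  | .yield, _, e => lay.insertCode (lay.xs.map e) ++ lay.tickCode
  | .rebind f g, d, e => lay.comp g d (e ∘ f)
  | .scan a S g, d, e => .op (.const (.ptr d) 2) (.op (.const (.cnt d) 0)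
      (.loop (.cnt d) .size (lay.scanBody d e a S (lay.comp g (d + 1) (bindEnv d e a S))) .nil))
  | .mark t, _, e => lookupCode (t.keys.map e) (lay.num t) ++ .op (.store .addr .one) .nil
  | .test t g, d, e => lookupCode (t.keys.map e) (lay.num t) ++
      .ite .zero .tmp (lay.comp g d e) .nil .nil

/-- The registers hold the values of the variables. -/
def Env (dom d : ℕ) (e : X → Reg) (h : X → ℕ) (s : RamState Reg) : Prop :=
  ∀ x, (e x).IsVal d ∧ s.reg (e x) = h x ∧ h x ≤ dom

variable {lay : Layout σ X} {dom w P d : ℕ} {M : Marks σ X} {q : Queue}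
  {s s' : RamState Reg} {L : List (Atom σ ℕ)} {inp : List ℕ} {e : X → Reg} {h : X → ℕ}

theorem Env.keep (he : Env dom d e h s) (hk : Keep d s s') : Env dom d e h s' := fun x =>
  ⟨(he x).1, (hk _ (he x).1.fixed).trans (he x).2.1, (he x).2.2⟩

theorem Env.map_eq (he : Env dom d e h s) (ks : List X) : (ks.map e).map s.reg = ks.map h := by
  rw [List.map_map]
  exact List.map_congr_left fun x _ => (he x).2.1

/-- A fact has to be skipped by as many words as its symbol has arguments, so the symbol is searched
among all symbols. Each comparison overwrites `tmp`, whence the arbitrary contents `v`. -/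
theorem silent_skipCode (hlay : Function.Injective lay.code) {R : σ.Sym} (hb : s.Bounded w)
    (hs : s.reg .sym = lay.code R) (hw : s.reg (.ptr d) + σ.arity R ≤ w)
    (hc : ∀ R, lay.code R ≤ w) : ∀ {Rs : List σ.Sym}, R ∈ Rs → ∀ {v : ℕ}, v ≤ w →
    ∃ s', (∃ n ≤ 3 * Rs.length + 2, Exec w inp (lay.skipCode d Rs)
        ⟨Function.update s.reg .tmp v, s.mem⟩ (List.replicate n none) s') ∧
      s'.Bounded w ∧ s'.mem = s.mem ∧ s'.reg (.ptr d) = s.reg (.ptr d) + σ.arity R ∧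
      ∀ r, r ≠ .tmp → r ≠ .skip → r ≠ .ptr d → s'.reg r = s.reg r
  | R' :: Rs, hR, v, hv => by
    have hb₀ := hb.update (r := .tmp) hv
    have hb₁ := hb.update (r := .tmp) (hc R')
    have heq : Op.apply inp ⟨Function.update s.reg .tmp v, s.mem⟩ (.const .tmp (lay.code R')) =
        ⟨Function.update s.reg .tmp (lay.code R'), s.mem⟩ := by simp [Op.apply]
    by_cases hRR : R = R'
    · subst hRR
      have hb₂ := hb₁.update (r := .skip) (v := σ.arity R) (by omega)
      have hb₃ := hb₂.update (r := .ptr d) hw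
      refine ⟨_, ⟨5, by simp, Exec.op_eq hb₀ rfl heq (Exec.ifEq_pos hb₁ (by simp [hs])
        (Exec.op_eq hb₁ rfl rfl (Exec.op_eq hb₂ rfl (by simp [Op.apply]) (.nil _))))⟩, hb₃,
        rfl, ?_, ?_⟩
      · simp
      · intro r h1 h2 h3
        simp [h1, h2, h3]
    · obtain ⟨s', ⟨n, hn, h1⟩, h2⟩ := silent_skipCode hlay hb hs hw hc
        ((List.mem_cons.1 hR).resolve_left hRR) (hc R')
      obtain ⟨n', hn', h3⟩ := Exec.ifEq_neg (a := .sym) (b := .tmp) (yes := .op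
        (.const .skip (σ.arity R')) (.op (.add (.ptr d) (.ptr d) .skip) .nil)) hb₁
        (by simpa [hs] using fun h => hRR (hlay h)) h1
      refine ⟨s', ⟨1 + (n' + n), by simp; omega, ?_⟩, h2⟩
      rw [List.replicate_add, List.replicate_add]
      exact Exec.op_eq hb₀ rfl heq h3

theorem Inv.lookup (hI : lay.Inv dom L.length w M q s) (hf : lay.Fits dom L P w)
    (hv : lay.Valid) (he : Env dom d e h s) {t : Table σ X} (ht : t ∈ lay.tabs) :
    ∃ s', Silent w inp (lookupCode (t.keys.map e) (lay.num t)) (3 * t.keys.length + 5) s s' ∧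
      lay.Inv dom L.length w M q s' ∧ Keep d s s' ∧
      s'.reg .addr = keyval (dom + 2) (t.keys.map h) * lay.stride + lay.num t ∧
      s'.reg .tmp = open Classical in if (t, t.keys.map h) ∈ M then 1 else 0 := by
  have hkd : ∀ v ∈ t.keys.map h, v ≤ dom := by
    intro v hv
    obtain ⟨x, -, rfl⟩ := List.mem_map.1 hv
    exact (he x).2.2
  have hkP : keyval (dom + 2) (t.keys.map h) ≤ P := by
    refine le_trans (keyval_lt fun v hv => ?_).le (le_trans (le_of_eq ?_) (hf.keys_le t ht))
    · have := hkd v hv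
      omega
    · rw [List.length_map]
  have hn := hv.num_lt t ht
  have hnS : lay.num t ≤ lay.stride := by simp only [Layout.stride]; omega
  obtain ⟨s₁, h1, hm, ha, ht', hreg⟩ := silent_lookupCode (inp := inp) hI.bounded hI.one
    (by rw [hI.base]; omega) (by rw [hI.stride]; exact lay.stride_pos) (rs := t.keys.map e)
    (t := lay.num t) (fun r hr => by
      obtain ⟨x, -, rfl⟩ := List.mem_map.1 hr
      have := (he x).1
      rintro h
      rw [h] at this
      exact this) (by
      rw [hI.base, hI.stride, he.map_eq]
      exact hf.cell_le hkP hnS)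
  rw [hI.base, hI.stride, he.map_eq] at ha ht'
  rw [hI.table t ht _ hkd] at ht'
  have hk : ∀ d, Keep d s s₁ := fun d r hr => hreg r (by rintro rfl; exact hr)
    (by rintro rfl; exact hr)
  rw [List.length_map] at h1
  exact ⟨s₁, h1, hI.congr (hk 0) (fun r hr => hreg r (by rintro rfl; exact hr)
    (by rintro rfl; exact hr)) hm h1.2.1, hk d, ha, ht'⟩

theorem Inv.mark (hI : lay.Inv dom L.length w M q s) (hv : lay.Valid) {t : Table σ X}
    (ht : t ∈ lay.tabs) {ks : List ℕ} (hks : ∀ v ∈ ks, v ≤ dom) :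
    lay.Inv dom L.length w (insert (t, ks) M) q ⟨s.reg, Function.update s.mem
      (keyval (dom + 2) ks * lay.stride + lay.num t) 1⟩ := by
  have hn := hv.num_lt t ht
  have hS : lay.m < lay.stride := by simp only [Layout.stride]; omega
  exact
  { bounded := hI.bounded.store (hI.one ▸ hI.bounded.1 .one)
    zero := hI.zero
    one := hI.one
    size := hI.size
    base := hI.base
    stride := hI.stride
    qlen := hI.qlen
    qpos := hI.qpos
    qrem := hI.qrem
    pos_le := hI.pos_le
    rem_lt := hI.rem_lt
    nodup := hI.nodup
    items := hI.items
    table := by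
      intro t' ht' ks' hks'
      have hn' := hv.num_lt t' ht'
      simp only [Function.update_apply]
      by_cases h : (t', ks') = (t, ks)
      · simp only [Prod.mk.injEq] at h
        obtain ⟨rfl, rfl⟩ := h
        simp
      · rw [if_neg, hI.table t' ht' ks' hks']
        · rw [show ((t', ks') ∈ insert (t, ks) M) = ((t', ks') ∈ M) from
            propext (Set.mem_insert_iff.trans (or_iff_right h))]
        · intro he
          obtain ⟨h1, h2⟩ := cell_inj (by omega) (by omega) he
          refine h (Prod.ext (hv.num_injOn ht' ht h2) (keyval_injOn (fun v hv => ?_)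
            (fun v hv => ?_) h1))
          · have := hks' v hv; omega
          · have := hks v hv; omega
    dedup := by
      intro ks' hks'
      simp only
      rw [Function.update_of_ne, hI.dedup ks' hks']
      intro he
      have := cell_inj (by omega) (by omega) he
      omega
    queue := by
      intro j x hj i hi
      simp only
      rw [Function.update_of_ne, hI.queue j x hj i hi]
      intro he
      have := cell_inj (by simp only [Layout.stride]; omega) (by omega) he
      omega }

end Comp

end Layout

/-! ### Correctness of the code for generators -/

namespace Layout

section CompCorrect

variable {σ : Schema} {X : Type} {lay : Layout σ X} {dom w P d C : ℕ} {M : Marks σ X} {q : Queue}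
  {s s' : RamState Reg} {L : List (Atom σ ℕ)} {e : X → Reg} {h : X → ℕ}

/-- The words of the input for one fact. -/
def fact (lay : Layout σ X) (f : Atom σ ℕ) : List ℕ := lay.code f.1 :: List.ofFn f.2

/-- The address in the input of the fact after those in `pre`. -/
def inputPos (lay : Layout σ X) (pre : List (Atom σ ℕ)) : ℕ := 2 + (pre.flatMap lay.fact).length

theorem inputPos_concat (pre : List (Atom σ ℕ)) (f : Atom σ ℕ) :
    lay.inputPos (pre ++ [f]) = lay.inputPos pre + 1 + σ.arity f.1 := by
  simp [inputPos, fact]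
  omega

theorem encode_append (pre fs : List (Atom σ ℕ)) (f : Atom σ ℕ) :
    lay.encode dom (pre ++ f :: fs) =
      (dom :: (pre ++ f :: fs).length :: pre.flatMap lay.fact) ++
        (lay.code f.1 :: (List.ofFn f.2 ++ fs.flatMap lay.fact)) := by
  rw [encode]
  change _ :: _ :: List.flatMap lay.fact _ = _
  simp only [List.flatMap_append, List.flatMap_cons, fact, List.cons_append]

theorem encode_at (pre fs : List (Atom σ ℕ)) (f : Atom σ ℕ) :
    (lay.encode dom (pre ++ f :: fs)).getD (lay.inputPos pre) 0 = lay.code f.1 ∧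
    (∀ i : Fin (σ.arity f.1),
      (lay.encode dom (pre ++ f :: fs)).getD (lay.inputPos pre + 1 + i) 0 = f.2 i) ∧
    lay.inputPos pre + 1 + σ.arity f.1 ≤ (lay.encode dom (pre ++ f :: fs)).length := by
  have hl : (dom :: (pre ++ f :: fs).length :: pre.flatMap lay.fact).length =
      lay.inputPos pre := by
    simp only [List.length_cons, inputPos]
    omega
  rw [encode_append, ← hl]
  refine ⟨?_, fun i => ?_, ?_⟩
  · rw [List.getD_append_right _ _ _ _ le_rfl]
    simp
  · rw [List.getD_append_right _ _ _ _ (by omega), add_assoc, Nat.add_sub_cancel_left, add_comm,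
      List.getD_cons_succ, List.getD_append _ _ _ _ (by simp)]
    simp [List.getD_eq_getElem?_getD]
  · simp only [List.length_append, List.length_cons, List.length_ofFn]
    omega

/-- The code executes the generator. -/
def Implements (lay : Layout σ X) (dom w C d : ℕ) (L : List (Atom σ ℕ)) (e : X → Reg)
    (g : Gen σ X) (c : Code Reg) : Prop :=
  ∀ h M q s, lay.Inv dom L.length w M q s → Env dom d e h s → ∃ M' as tr q' s',
    g.Run L h M as M' ∧ Exec w (lay.encode dom L) c s tr s' ∧ lay.Inv dom L.length w M' q' s' ∧
    Keep d s s' ∧ Impl C lay.K (lay.xs.map ·) q as tr q'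

/-- A newly bound variable is represented by one of its positions. Comparing each argument with the
register of its variable then checks the variables already bound and the repeated occurrences alike.
-/
theorem bindEnv_spec {a : Atom σ X} {S : Finset X} {s₁ : RamState Reg} {v : Fin (σ.arity a.1) → ℕ}
    (he : Env dom d e h s) (hk : Keep d s s₁)
    (hv : ∀ i : Fin (σ.arity a.1), s₁.reg (.val d i) = v i)
    (hvd : ∀ i, v i ≤ dom) :
    Env dom (d + 1) (bindEnv d e a S) (fun x => s₁.reg (bindEnv d e a S x)) s₁ ∧
    ((∀ i, s₁.reg (bindEnv d e a S (a.2 i)) = v i) →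
      Matches h S a ⟨a.1, v⟩ fun x => s₁.reg (bindEnv d e a S x)) ∧
    ((∃ h', Matches h S a ⟨a.1, v⟩ h') → ∀ i, s₁.reg (bindEnv d e a S (a.2 i)) = v i) := by
  have he₁ := he.keep hk
  refine ⟨fun x => ⟨?_, rfl, ?_⟩, fun hc => ⟨?_, fun x hx => ?_⟩, ?_⟩
  · unfold bindEnv
    split_ifs with hx
    · exact Nat.lt_succ_self d
    · exact (he x).1.mono (Nat.le_succ d)
  · simp only [bindEnv]
    split_ifs with hx
    · rw [hv]
      exact hvd _
    · rw [(he₁ x).2.1]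
      exact (he x).2.2
  · simp only [Atom.map, hc]
  · simp only [bindEnv]
    rw [dif_neg (by tauto), (he₁ x).2.1]
  · rintro ⟨h', hm, hS⟩ i
    have hm' : ∀ i, h' (a.2 i) = v i := by
      intro i
      simp only [Atom.map, Sigma.mk.injEq, heq_eq_eq, true_and] at hm
      exact congrFun hm i
    by_cases hx : a.2 i ∈ S
    · rw [bindEnv, dif_neg (by tauto), (he₁ _).2.1, ← hS _ (.inl hx), hm']
    · have hx' : a.2 i ∉ S ∧ ∃ j, a.2 j = a.2 i := ⟨hx, i, rfl⟩
      rw [bindEnv, dif_pos hx', hv, ← hm', hx'.2.choose_spec, hm']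

/-- Four steps precede the comparison of symbols, which takes at most two. Then each argument costs
two steps to read and two to check, or else the search in `syms` takes at most `3 * lay.syms.length
+ 2` steps. -/
theorem exec_scanBody {a : Atom σ X} {S : Finset X} {g : Gen σ X} {c : Code Reg}
    (hf : lay.Fits dom L P w) (hv : lay.Valid)
    (hg : lay.Implements dom w C (d + 1) L (bindEnv d e a S) g c)
    {pre fs : List (Atom σ ℕ)} {f : Atom σ ℕ} (hL : pre ++ f :: fs = L)
    (hI : lay.Inv dom L.length w M q s) (he : Env dom d e h s)
    (hp : s.reg (.ptr d) = lay.inputPos pre) (hc : s.reg (.cnt d) = pre.length) :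
    ∃ M' as tr q' s', ∃ n ≤ 4 * σ.arity a.1 + 3 * lay.syms.length + 8,
      ((∃ h', Matches h S a f h' ∧ g.Run L h' M as M') ∨
        ((¬ ∃ h', Matches h S a f h') ∧ as = [] ∧ M' = M)) ∧
      Exec w (lay.encode dom L) (lay.scanBody d e a S c) s (List.replicate n none ++ tr) s' ∧
      lay.Inv dom L.length w M' q' s' ∧ Keep d s s' ∧
      s'.reg (.ptr d) = lay.inputPos (pre ++ [f]) ∧ s'.reg (.cnt d) = (pre ++ [f]).length ∧
      Impl C lay.K (lay.xs.map ·) q as tr q' := by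
  obtain ⟨h1, h2, h3⟩ := encode_at (lay := lay) (dom := dom) pre fs f
  rw [hL] at h1 h2 h3
  have hin : ∀ a, (lay.encode dom L).getD a 0 ≤ w := by
    intro a
    rw [List.getD_eq_getElem?_getD]
    cases hx : (lay.encode dom L)[a]? with
    | none => exact Nat.zero_le _
    | some v => exact hf.input_le v (List.mem_of_getElem? hx)
  have hlw := hf.length_le
  have hcw : pre.length + 1 ≤ w := by
    have : L.length ≤ w := hf.input_le _ (by simp [encode])
    rw [← hL] at this
    simp at this
    omega
  have hdw : dom ≤ w := hf.input_le _ (by simp [encode])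
  have hI₁ := hI.update (r := .sym) (by simp [Reg.Fixed]) (by simp [Reg.IsQueue])
    (hf.code_le f.1)
  have hI₂ := hI₁.update (r := .ptr d) (by simp [Reg.Fixed]) (by simp [Reg.IsQueue])
    (v := lay.inputPos pre + 1) (by omega)
  have hI₃ := hI₂.update (r := .cnt d) (by simp [Reg.Fixed]) (by simp [Reg.IsQueue]) hcw
  have hI₄ := hI₃.update (r := .tmp) (by simp [Reg.Fixed]) (by simp [Reg.IsQueue])
    (hf.code_le a.1)
  set s₁ : RamState Reg := ⟨Function.update s.reg .sym (lay.code f.1), s.mem⟩ with hs₁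
  set s₂ : RamState Reg := ⟨Function.update s₁.reg (.ptr d) (lay.inputPos pre + 1), s₁.mem⟩
    with hs₂
  set s₃ : RamState Reg := ⟨Function.update s₂.reg (.cnt d) (pre.length + 1), s₂.mem⟩ with hs₃
  set s₄ : RamState Reg := ⟨Function.update s₃.reg .tmp (lay.code a.1), s₃.mem⟩ with hs₄
  have hk₃ : Keep d s s₃ := (((Keep.refl d s).update (r := .sym) (by simp [Reg.Fixed]) _ _).update
    (r := .ptr d) (by simp [Reg.Fixed]) _ _).update (r := .cnt d) (by simp [Reg.Fixed]) _ _
  have hk₄ : Keep d s s₄ := hk₃.update (r := .tmp) (by simp [Reg.Fixed]) _ _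
  have hp₄ : s₄.reg (.ptr d) = lay.inputPos pre + 1 := by simp [hs₄, hs₃, hs₂]
  have hc₄ : s₄.reg (.cnt d) = pre.length + 1 := by simp [hs₄, hs₃]
  have hsym : s₄.reg .sym = lay.code f.1 := by simp [hs₄, hs₃, hs₂, hs₁]
  have htmp : s₄.reg .tmp = lay.code a.1 := by simp [hs₄]
  have hprefix : ∀ {t s'}, Exec w (lay.encode dom L) (ifEq .sym .tmp
      (readCode d 0 (σ.arity a.1) ++
        checkCode ((List.finRange (σ.arity a.1)).map fun i =>
          (bindEnv d e a S (a.2 i), .val d i)) c)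
      (lay.skipCode d lay.syms)) s₄ t s' → Exec w (lay.encode dom L) (lay.scanBody d e a S c) s
        (List.replicate 4 none ++ t) s' := by
    intro t s' ht
    refine Exec.op_eq hI.bounded rfl ?_ (Exec.op_eq hI₁.bounded rfl ?_
      (Exec.op_eq hI₂.bounded rfl ?_ (Exec.op_eq hI₃.bounded rfl ?_ ht)))
    · simp only [Op.apply, hp, h1, hs₁]
    · simp [Op.apply, hp, hI.one, hs₂, hs₁]
    · simp [Op.apply, hc, hI.one, hs₃, hs₂, hs₁]
    · rfl
  by_cases hR : f.1 = a.1
  · obtain ⟨R, v⟩ := f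
    dsimp only at hR
    subst hR
    dsimp only at h2 h3
    obtain ⟨s₅, hr, hval, hp₅, hm₅, hreg⟩ := silent_readCode (d := d) hin
      (n := σ.arity a.1) (i := 0)
      hI₄.bounded hI₄.one (by rw [hp₄]; omega)
    have hval' : ∀ i : Fin (σ.arity a.1), s₅.reg (.val d i) = v i := by
      intro i
      have := hval i i.2
      rw [zero_add, hp₄, h2] at this
      exact this
    have hvd : ∀ i, v i ≤ dom := hf.args ⟨a.1, v⟩ (by rw [← hL]; simp)
    have hk₅ : Keep d s s₅ := by
      refine hk₄.trans fun r hr => hreg r ?_ ?_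
      · rintro rfl
        exact lt_irrefl _ hr
      · rintro j - rfl
        exact lt_irrefl _ hr
    have hk₅₀ : Keep 0 s₄ s₅ := by
      refine fun r hr => hreg r ?_ ?_
      · rintro rfl
        exact Nat.not_lt_zero _ hr
      · rintro j - rfl
        exact Nat.not_lt_zero _ hr
    have hI₅ := hI₄.congr hk₅₀ (fun r hr => hreg r (by rintro rfl; exact hr)
      (by rintro j - rfl; exact hr)) hm₅ hr.2.1
    have hc₅ : s₅.reg (.cnt d) = pre.length + 1 :=
      (hreg _ (by simp) (by simp)).trans hc₄
    obtain ⟨hE, hE1, hE2⟩ := bindEnv_spec (S := S) he hk₅ hval' hvd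
    obtain ⟨n, hn, hr⟩ := hr.2.2
    by_cases hck : ∀ i, s₅.reg (bindEnv d e a S (a.2 i)) = v i
    · obtain ⟨M', as, tr, q', s', h4, h5, h6, h7, h8⟩ := hg _ M q s₅ hI₅ hE
      have hkd := h7.mono (Nat.le_succ d)
      have h9 := h5.check_pos hI₅.bounded (ps := (List.finRange (σ.arity a.1)).map fun i =>
          (bindEnv d e a S (a.2 i), .val d i)) (by
        intro p hp
        obtain ⟨i, -, rfl⟩ := List.mem_map.1 hp
        exact (hck i).trans (hval' i).symm)
      rw [List.length_map, List.length_finRange] at h9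
      refine ⟨M', as, tr, q', s', 4 + (2 + (n + 2 * σ.arity a.1)), by omega,
        .inl ⟨_, hE1 hck, h4⟩, ?_, h6, hk₅.trans hkd, ?_, ?_, h8⟩
      · have := hprefix (Exec.ifEq_pos (no := lay.skipCode d lay.syms) hI₄.bounded
          (hsym.trans htmp.symm) (hr.append h9))
        simp only [List.replicate_add, List.append_assoc] at this ⊢
        exact this
      · rw [inputPos_concat, h7 (.ptr d) (Nat.lt_succ_self d), hp₅, hp₄]
      · rw [h7 (.cnt d) (Nat.lt_succ_self d), hc₅, List.length_append, List.length_singleton]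
    · obtain ⟨n', hn', h9⟩ := Exec.check_neg (inp := lay.encode dom L) (c := c) hI₅.bounded
        (ps := (List.finRange (σ.arity a.1)).map fun i =>
          (bindEnv d e a S (a.2 i), .val d i)) (by
        refine fun hall => hck fun i => ?_
        exact (hall _ (List.mem_map.2 ⟨i, List.mem_finRange i, rfl⟩)).trans (hval' i))
      rw [List.length_map, List.length_finRange] at hn'
      refine ⟨M, [], [], q, s₅, 4 + (2 + (n + n')), by omega,
        .inr ⟨fun hx => hck (hE2 hx), rfl, rfl⟩, ?_, hI₅, hk₅, ?_, ?_, .nil _⟩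
      · have := hprefix (Exec.ifEq_pos (no := lay.skipCode d lay.syms) hI₄.bounded
          (hsym.trans htmp.symm) (hr.append h9))
        simp only [List.replicate_add, List.append_nil] at this ⊢
        exact this
      · rw [inputPos_concat, hp₅, hp₄]
      · rw [hc₅, List.length_append, List.length_singleton]
  · obtain ⟨s₅, ⟨n, hn, h4⟩, hb₅, hm₅, hp₅, hreg⟩ := silent_skipCode
      (inp := lay.encode dom L) (d := d) hv.code_injective (R := f.1) (s := s₃) hI₃.bounded
      (by simpa [hs₄] using hsym)
      (by
        have : s₃.reg (.ptr d) = lay.inputPos pre + 1 := by simpa [hs₄] using hp₄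
        rw [this]
        omega) hf.code_le (hv.mem_syms f.1) (hf.code_le a.1)
    have hk₅ : Keep d s s₅ := by
      refine hk₃.trans fun r hr => hreg r ?_ ?_ ?_
      · rintro rfl
        exact hr
      · rintro rfl
        exact hr
      · rintro rfl
        exact lt_irrefl _ hr
    have hk₅₀ : Keep 0 s₃ s₅ := by
      refine fun r hr => hreg r ?_ ?_ ?_
      · rintro rfl
        exact hr
      · rintro rfl
        exact hr
      · rintro rfl
        exact Nat.not_lt_zero _ hr
    have hI₅ := hI₃.congr hk₅₀ (fun r hr => hreg r (by rintro rfl; exact hr)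
      (by rintro rfl; exact hr) (by rintro rfl; exact hr)) hm₅ hb₅
    obtain ⟨n', hn', h5⟩ := Exec.ifEq_neg (a := .sym) (b := .tmp) (yes :=
      readCode d 0 (σ.arity a.1) ++ checkCode ((List.finRange (σ.arity a.1)).map fun i =>
        (bindEnv d e a S (a.2 i), .val d i)) c) hI₄.bounded
      (by rw [hsym, htmp]; exact fun h => hR (hv.code_injective h)) h4
    refine ⟨M, [], [], q, s₅, 4 + (n' + n), by omega, .inr ⟨?_, rfl, rfl⟩, ?_, hI₅, hk₅, ?_, ?_,
      .nil _⟩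
    · rintro ⟨h', hm, -⟩
      exact hR (congrArg Sigma.fst hm).symm
    · rw [List.append_nil, List.replicate_add, List.replicate_add]
      exact hprefix h5
    · rw [inputPos_concat, hp₅]
      simp [hs₃, hs₂]
    · rw [hreg _ (by simp) (by simp) (by simp)]
      simp [hs₃]

theorem exec_scanLoop {a : Atom σ X} {S : Finset X} {g : Gen σ X} {c : Code Reg}
    (hf : lay.Fits dom L P w) (hv : lay.Valid)
    (hg : lay.Implements dom w C (d + 1) L (bindEnv d e a S) g c) :
    ∀ {fs pre : List (Atom σ ℕ)} {M q s}, pre ++ fs = L → lay.Inv dom L.length w M q s →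
    Env dom d e h s → s.reg (.ptr d) = lay.inputPos pre → s.reg (.cnt d) = pre.length →
    ∃ M' as tr q' s', Loop (fun f M t M' =>
      (∃ h', Matches h S a f h' ∧ g.Run L h' M t M') ∨
      ((¬ ∃ h', Matches h S a f h') ∧ t = [] ∧ M' = M)) fs M as M' ∧
      Exec w (lay.encode dom L) (.loop (.cnt d) .size (lay.scanBody d e a S c) .nil) s tr s' ∧
      lay.Inv dom L.length w M' q' s' ∧ Keep d s s' ∧
      Impl (C + (4 * σ.arity a.1 + 3 * lay.syms.length + 9)) lay.K (lay.xs.map ·) q as tr q'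
  | [], pre, M, q, s, hL, hI, he, hp, hc => by
    refine ⟨M, [none], [none], q, s, ⟨rfl, rfl⟩, Exec.exit hI.bounded ?_ (.nil _), hI,
      Keep.refl d s, Impl.silent (n := 1) (by omega)⟩
    rw [hI.size, hc, ← hL, List.append_nil]
  | f :: fs, pre, M, q, s, hL, hI, he, hp, hc => by
    obtain ⟨M₁, as₁, t₁, q₁, s₁, n, hn, h1, h2, h3, h4, h5, h6, h7⟩ :=
      exec_scanBody hf hv hg hL hI he hp hc
    obtain ⟨M', as₂, t₂, q', s', h8, h9, h10, h11, h12⟩ := exec_scanLoop hf hv hg (fs := fs)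
      (pre := pre ++ [f]) (by simpa using hL) h3 (he.keep h4) h5 h6
    refine ⟨M', _, _, q', s', ⟨M₁, as₁, as₂, h1, h8, rfl⟩, Exec.iter hI.bounded ?_ h2 h9, h10,
      h4.trans h11, ?_⟩
    · rw [hI.size, hc, ← hL]
      simp
    · have := Impl.tick (n := n + 1) (by omega) ((h7.mono (Nat.le_add_right C _)).append h12)
      rw [List.append_assoc]
      exact this

/-- The tables of a generator. -/
def _root_.Gen.tables : Gen σ X → List (Table σ X)
  | .skip => []
  | .seq g₁ g₂ => g₁.tables ++ g₂.tables
  | .yield => []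
  | .rebind _ g => g.tables
  | .scan _ _ g => g.tables
  | .mark t => [t]
  | .test t g => t :: g.tables

/-- `C` is chosen before the database, so a unit of abstract time costs constantly many machine
steps. At `yield` the machine leaves the tables alone, which is one of the runs that `Gen.Run`
admits. -/
theorem exists_implements (hv : lay.Valid) : ∀ g : Gen σ X, (∀ t ∈ g.tables, t ∈ lay.tabs) →
    ∃ C, ∀ {dom w P L}, lay.Fits dom L P w → ∀ d e,
      lay.Implements dom w C d L e g (lay.comp g d e)
  | .skip, _ => ⟨0, fun _ d e h M q s hI _ =>
      ⟨M, [], [], q, s, ⟨rfl, rfl⟩, .nil s, hI, Keep.refl d s, .nil q⟩⟩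
  | .seq g₁ g₂, ht => by
    obtain ⟨C₁, h₁⟩ := exists_implements hv g₁ fun t h => ht t (List.mem_append_left _ h)
    obtain ⟨C₂, h₂⟩ := exists_implements hv g₂ fun t h => ht t (List.mem_append_right _ h)
    refine ⟨C₁ + C₂, fun hf d e h M q s hI he => ?_⟩
    obtain ⟨M₁, as₁, t₁, q₁, s₁, h1, h2, h3, h4, h5⟩ := h₁ hf d e h M q s hI he
    obtain ⟨M', as₂, t₂, q', s', h6, h7, h8, h9, h10⟩ := h₂ hf d e h M₁ q₁ s₁ h3 (he.keep h4)
    exact ⟨M', _, _, q', s', ⟨M₁, as₁, as₂, h1, h6, rfl⟩, h2.append h7, h8, h4.trans h9,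
      (h5.mono (Nat.le_add_right _ _)).append (h10.mono (Nat.le_add_left _ _))⟩
  | .yield, _ => by
    refine ⟨7 * lay.xs.length + 9 + (4 * lay.xs.length + 7),
      fun {dom w P L} hf d e h M q s hI he => ?_⟩
    obtain ⟨s₁, ⟨-, -, n, hn, h1⟩, h2, h3⟩ := hI.queue_insert (inp := lay.encode dom L)
      hf hv (d := d)
      (rs := lay.xs.map e) (by simp) (by
        intro r hr
        obtain ⟨x, -, rfl⟩ := List.mem_map.1 hr
        exact ⟨(he x).1, (he x).2.1.trans_le (he x).2.2⟩)
    rw [he.map_eq] at h2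
    obtain ⟨tr, s', h4, h5, h6, h7, h8⟩ := h2.queue_tick (inp := lay.encode dom L) hf d
    refine ⟨M, [some h], List.replicate n none ++ tr ++ [], _, s', ⟨rfl, Grow.refl M⟩, ?_, h7,
      h3.trans h8, .event ?_ ?_ (.nil _)⟩
    · rw [List.append_nil]
      exact h1.append h4
    · rw [List.length_append, List.length_replicate]
      omega
    · rw [List.reduceOption_append, List.reduceOption_replicate_none, List.nil_append, h6]
      simp only [Queue.tick]
      split_ifs <;> rfl
  | .rebind f g, ht => by
    obtain ⟨C, hC⟩ := exists_implements hv g ht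
    exact ⟨C, fun hf d e h M q s hI he => hC hf d (e ∘ f) (h ∘ f) M q s hI fun x => he (f x)⟩
  | .scan a S g, ht => by
    obtain ⟨C, hC⟩ := exists_implements hv g ht
    refine ⟨C + (4 * σ.arity a.1 + 3 * lay.syms.length + 9),
      fun {dom w P L} hf d e h M q s hI he => ?_⟩
    have h2w : 2 ≤ w := le_trans (by simp [encode]) hf.length_le
    have hI₁ := hI.update (r := .ptr d) (by simp [Reg.Fixed]) (by simp [Reg.IsQueue]) h2w
    have hI₂ := hI₁.update (r := .cnt d) (by simp [Reg.Fixed]) (by simp [Reg.IsQueue])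
      (Nat.zero_le w)
    have hk : Keep d s _ := ((Keep.refl d s).update (r := .ptr d) (by simp [Reg.Fixed]) 2
      s.mem).update (r := .cnt d) (by simp [Reg.Fixed]) 0 s.mem
    obtain ⟨M', as, tr, q', s', h1, h2, h3, h4, h5⟩ := exec_scanLoop hf hv
      (hC hf (d + 1) (bindEnv d e a S)) (fs := L) (pre := []) rfl hI₂ (he.keep hk)
      (by simp [inputPos]) (by simp)
    refine ⟨M', none :: as, List.replicate 2 none ++ tr, q', s', ⟨as, rfl, h1⟩, ?_, h3,
      hk.trans h4, .tick (by omega) h5⟩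
    rw [comp]
    exact Exec.op_eq (o := .const (.ptr d) 2) hI.bounded rfl rfl
      (Exec.op_eq (o := .const (.cnt d) 0) hI₁.bounded rfl rfl h2)
  | .mark t, ht => by
    refine ⟨3 * t.keys.length + 6, fun {dom w P L} hf d e h M q s hI he => ?_⟩
    have htt := ht t (List.mem_singleton.2 rfl)
    obtain ⟨s₁, ⟨-, -, n, hn, h1⟩, hI₁, hk, ha, -⟩ :=
      hI.lookup (inp := lay.encode dom L) hf hv he htt
    refine ⟨_, [none], List.replicate (n + 1) none, q, _, ⟨rfl, rfl⟩, ?_,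
      hI₁.mark hv htt (ks := t.keys.map h) ?_, hk, .silent (by omega)⟩
    · rw [List.replicate_succ']
      refine h1.append (Exec.op_eq hI₁.bounded rfl ?_ (.nil _))
      simp [Op.apply, ha, hI₁.one]
    · intro v hv
      obtain ⟨x, -, rfl⟩ := List.mem_map.1 hv
      exact (he x).2.2
  | .test t g, ht => by
    obtain ⟨C, hC⟩ := exists_implements hv g fun t' h => ht t' (List.mem_cons_of_mem _ h)
    refine ⟨C + (3 * t.keys.length + 6), fun {dom w P L} hf d e h M q s hI he => ?_⟩
    have htt := ht t List.mem_cons_self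
    obtain ⟨s₁, ⟨-, -, n, hn, h1⟩, hI₁, hk, -, ht'⟩ :=
      hI.lookup (inp := lay.encode dom L) hf hv he htt
    by_cases hm : (t, t.keys.map h) ∈ M
    · rw [if_pos hm] at ht'
      obtain ⟨M', as, tr, q', s', h2, h3, h4, h5, h6⟩ := hC hf d e h M q s₁ hI₁ (he.keep hk)
      refine ⟨M', none :: as, List.replicate (n + 1) none ++ tr, q', s',
        .inl ⟨hm, as, h2, rfl⟩, ?_, h4, hk.trans h5,
        .tick (by omega) (h6.mono (Nat.le_add_right _ _))⟩
      rw [List.replicate_succ', List.append_assoc]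
      have := Exec.yes (a := .zero) (b := .tmp) (n := .nil) hI₁.bounded
        (by rw [hI₁.zero, ht']; exact one_pos) h3 (.nil _)
      rw [List.append_nil] at this
      exact h1.append this
    · rw [if_neg hm] at ht'
      refine ⟨M, [none], List.replicate (n + 1) none, q, s₁, .inr ⟨hm, rfl, rfl⟩, ?_, hI₁, hk,
        .silent (by omega)⟩
      rw [List.replicate_succ']
      exact h1.append (Exec.no hI₁.bounded (by rw [ht']; exact Nat.zero_le _) (.nil _) (.nil _))

end CompCorrect

end Layout

/-! ### Consequences for the output -/

/-- The pigeonhole count behind the queue: events of multiplicity at most `K` supply at least a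
`K`-th of their number in different tuples. -/
theorem List.length_le_mul_of_count_le {α : Type*} [BEq α] [LawfulBEq α] {l l' : List α}
    {K : ℕ}
    (hs : ∀ x ∈ l, x ∈ l') (hc : ∀ x, l.count x ≤ K) : l.length ≤ K * l'.length := by
  classical
  obtain rfl : ‹BEq α› = instBEqOfDecidableEq := lawful_beq_subsingleton _ _
  have h1 : ∑ x ∈ l.toFinset, l.count x = l.length := List.sum_toFinset_count_eq_length l
  rw [← h1, mul_comm]
  refine (Finset.sum_le_card_nsmul _ _ K fun x _ => hc x).trans ?_
  rw [smul_eq_mul]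
  refine Nat.mul_le_mul_right _ ((Finset.card_le_card fun x hx => ?_).trans l'.toFinset_card_le)
  exact List.mem_toFinset.2 (hs x (List.mem_toFinset.1 hx))

theorem Queue.insert_prefix (q : Queue) (x : List ℕ) : q.items <+: (q.insert x).items := by
  simp only [Queue.insert]
  split_ifs
  · exact List.prefix_rfl
  · exact List.prefix_append _ _

theorem Queue.mem_insert {q : Queue} {x y : List ℕ} :
    y ∈ (q.insert x).items ↔ y ∈ q.items ∨ y = x := by
  simp only [Queue.insert]
  split_ifs with h
  · exact ⟨.inl, fun h' => h'.elim id fun h' => h' ▸ h⟩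
  · simp

theorem Queue.items_tick (K : ℕ) (q : Queue) : (q.tick K).items = q.items := by
  simp only [Queue.tick]
  split_ifs <;> rfl

theorem Queue.le_pos_tick (K : ℕ) (q : Queue) : q.pos ≤ (q.tick K).pos := by
  simp only [Queue.tick]
  split_ifs
  · exact le_rfl
  · exact Nat.le_succ _
  · exact le_rfl

theorem Queue.pos_tick_le {K : ℕ} {q : Queue} (h : q.pos ≤ q.items.length) :
    (q.tick K).pos ≤ q.items.length := by
  simp only [Queue.tick]
  split_ifs with h1 h2
  · exact h
  · exact h2
  · exact h

namespace Impl

variable {β : Type} {C K : ℕ} {f : β → List ℕ} {q q' : Queue} {as : Trace β}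
  {tr : Trace (List ℕ)}

theorem mem_items (h : Impl C K f q as tr q') {x : List ℕ} :
    x ∈ q'.items ↔ x ∈ q.items ∨ ∃ b, some b ∈ as ∧ f b = x := by
  induction h with
  | nil => simp
  | tick _ _ ih => simpa using ih
  | event _ _ _ ih =>
    rw [ih, Queue.items_tick, Queue.mem_insert]
    simp only [List.mem_cons, Option.some.injEq, or_and_right, exists_or, exists_eq_left, or_assoc]
    rw [eq_comm (a := x)]

/-- The outputs are consecutive segments of `items`, which grows only at its end; together they make
up the prefix of length `pos`. -/
theorem reduceOption_eq (h : Impl C K f q as tr q') (hq : q.pos ≤ q.items.length) :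
    q.items.take q.pos ++ tr.reduceOption = q'.items.take q'.pos := by
  induction h with
  | nil => simp
  | tick _ _ ih => simpa [List.reduceOption_append, List.reduceOption_replicate_none] using ih hq
  | @event q b t as tr q' _ h2 _ ih =>
    have h3 := q.insert_prefix (f b)
    have h4 : (q.insert (f b)).pos ≤ (q.insert (f b)).items.length := hq.trans h3.length_le
    rw [← ih (by rw [Queue.items_tick]; exact Queue.pos_tick_le h4), List.reduceOption_append, h2,
      ← List.append_assoc]
    congr 1
    have h6 : q.pos ≤ ((q.insert (f b)).tick K).pos := Queue.le_pos_tick K (q.insert (f b))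
    have h5 : q.items.take q.pos = (((q.insert (f b)).tick K).items.take
        ((q.insert (f b)).tick K).pos).take q.pos := by
      rw [List.take_take, Queue.items_tick, min_eq_left h6,
        (List.prefix_iff_eq_take.1 (List.IsPrefix.take h3 q.pos))]
      rw [List.length_take, min_eq_left hq, List.take_take, min_self]
    rw [h5, List.take_append_drop]

/-- Here `ev` lists the results of all events so far, `x` is the time since the last event and `y`
the machine time since the last output. Since that output `rem` events have occurred, each after at
most `δ` units, whence the bound on `y`; the extra unit covers what remained of the step that made
the output. -/
theorem gap {δ D : ℕ} {t' : Trace (List ℕ)} (h : Impl C K f q as tr q')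
    (ht' : ∀ y, y ≤ C * (K * (δ + 1)) → Trace.Gap D y t') (hD : C * (K * (δ + 1) + 1) ≤ D)
    {ev : List (List ℕ)} {x y : ℕ} (hK : q.rem < K) (hev : ev.length = K * q.pos + q.rem)
    (hmem : ∀ z ∈ ev, z ∈ q.items) (hcount : ∀ z, (ev ++ as.reduceOption.map f).count z ≤ K)
    (hgap : Trace.Gap δ x as) (hy : y ≤ C * (q.rem * (δ + 1) + x + 1)) :
    Trace.Gap D y (tr ++ t') := by
  induction h generalizing ev x y with
  | nil q =>
    refine ht' y (hy.trans (Nat.mul_le_mul_left _ ?_))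
    have : x ≤ δ := hgap
    nlinarith
  | @tick q as tr q' n hn _ ih =>
    rw [List.append_assoc]
    refine Trace.gap_silent_append (by simp) (ih hK hev hmem (by simpa using hcount) hgap ?_)
    rw [List.length_replicate]
    nlinarith
  | @event q b t as tr q' ht h2 _ ih =>
    rw [List.append_assoc]
    have hx : x ≤ δ := hgap.1
    have hmem' : ∀ z ∈ ev ++ [f b], z ∈ (q.insert (f b)).items := by
      intro z hz
      rw [Queue.mem_insert]
      rcases List.mem_append.1 hz with hz | hz
      · exact .inl (hmem z hz)
      · exact .inr (List.mem_singleton.1 hz)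
    have hcount' : ∀ z, (ev ++ [f b] ++ as.reduceOption.map f).count z ≤ K := by
      simpa using hcount
    have hyD : y ≤ C * (K * (δ + 1)) := by
      refine hy.trans (Nat.mul_le_mul_left _ ?_)
      nlinarith
    by_cases hr : q.rem + 1 < K
    · have hq : (q.insert (f b)).tick K = { q.insert (f b) with rem := q.rem + 1 } := if_pos hr
      rw [hq] at ih h2
      have ht0 : t.reduceOption = [] := by
        rw [h2]
        simp [Queue.insert]
      refine Trace.gap_silent_append (fun z hz => ?_) (ih hr (ev := ev ++ [f b]) ?_ hmem' hcount'
        hgap.2 ?_)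
      · rw [← List.reduceOption_mem_iff, ht0] at hz
        exact List.not_mem_nil hz
      · simp [hev, Queue.insert, add_assoc]
      · dsimp only
        nlinarith
    · have hr' : q.rem + 1 = K := by omega
      -- This is event number `K * (pos + 1)`, and no result occurs more than `K` times, so more
      -- than `pos` different tuples have been inserted.
      have hlt : q.pos < (q.insert (f b)).items.length := by
        have h3 := List.length_le_mul_of_count_le hmem' fun z =>
          (List.Sublist.count_le z (List.sublist_append_left _ _)).trans (hcount' z)
        rw [List.length_append, List.length_singleton, hev, add_assoc, hr', ← Nat.mul_succ] at h3
        exact Nat.lt_of_mul_lt_mul_left (a := K) (by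
          refine lt_of_lt_of_le ?_ h3
          exact Nat.mul_lt_mul_of_pos_left (Nat.lt_succ_self _) (by omega))
      have hq : (q.insert (f b)).tick K = { q.insert (f b) with pos := q.pos + 1, rem := 0 } :=
        (if_neg hr).trans (if_pos hlt)
      rw [hq] at ih h2
      have hD' : y + t.length ≤ D := by nlinarith
      refine (Trace.Gap.append (D₂ := t.length) (b := y) hD' (ih (by dsimp only; omega)
        (ev := ev ++ [f b]) ?_ hmem' hcount' hgap.2 ?_) (a := 0)
        (Trace.gap_of_length (by omega)) (Nat.zero_le _) ?_)
      · rw [List.length_append, List.length_singleton, hev, add_assoc, hr']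
        rfl
      · dsimp only
        nlinarith
      · refine ⟨(q.insert (f b)).items[q.pos], List.reduceOption_mem_iff.1 ?_⟩
        rw [h2, List.take_add_one, List.drop_append_of_le_length (by simp; omega)]
        simp [hlt]

end Impl

/-! ### The complete enumeration program -/

namespace Layout

section Main

variable {σ : Schema} {X : Type} {lay : Layout σ X} {dom w P : ℕ} {M : Marks σ X} {q : Queue}
  {s s' : RamState Reg} {L : List (Atom σ ℕ)} {inp : List ℕ}

/-- Outputs the rest of the queue. -/
def drainCode (lay : Layout σ X) : Code Reg := .loop .qpos .qlen lay.popCode .nil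

/-- `A` bounds the time since the last output when draining begins; from then on outputs follow at
constant intervals. -/
theorem Inv.drain {N A D : ℕ} (hD : A + 4 * lay.xs.length + 3 ≤ D) (hf : lay.Fits dom L P w) :
    ∀ {n : ℕ} {q : Queue} {s : RamState Reg}, lay.Inv dom N w M q s → q.pos + n = q.items.length →
    ∃ tr s', Exec w inp lay.drainCode s tr s' ∧ s'.Bounded w ∧
      tr.reduceOption = q.items.drop q.pos ∧ ∀ y ≤ A, Trace.Gap D y tr
  | 0, q, s, hI, hn => by
    refine ⟨[none], s, Exec.exit hI.bounded ?_ (.nil _), hI.bounded, ?_, fun y hy => ?_⟩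
    · rw [hI.qpos, hI.qlen]
      omega
    · rw [List.drop_eq_nil_of_le (by omega)]
      rfl
    · exact Trace.gap_of_length (by simp; omega)
  | n + 1, q, s, hI, hn => by
    have hlt : q.pos < q.items.length := by omega
    obtain ⟨m, hm, s₁, h1, h2, -⟩ := hI.pop (inp := inp) hf hlt 0
    obtain ⟨tr, s', h3, h4, h5, h6⟩ := Inv.drain hD hf h2 (n := n) (by dsimp only; omega)
    refine ⟨_, s', Exec.iter hI.bounded (by rw [hI.qpos, hI.qlen]; exact hlt) h1 h3, h4, ?_,
      fun y hy => ?_⟩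
    · rw [List.reduceOption_cons_of_none, List.reduceOption_append, List.reduceOption_append,
        List.reduceOption_replicate_none, h5, List.drop_eq_getElem_cons hlt]
      rfl
    · rw [List.append_assoc]
      refine Trace.gap_silent_append (t := none :: List.replicate m none) (by simp) ⟨?_, ?_⟩
      · simp
        omega
      · exact h6 0 (Nat.zero_le _)

/-- Initializes the registers. -/
def initCode (lay : Layout σ X) : Code Reg :=
  .op (.const .one 1) (.op (.input .size .one) (.op (.input .base .zero)
    (.op (.add .base .base .one) (.op (.add .base .base .one) (.op (.const .stride lay.stride)
      .nil)))))

theorem exec_initCode (hw : dom + 2 ≤ w) (hL : L.length ≤ w) (hS : lay.stride ≤ w)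
    (hK : 0 < lay.K) : ∃ s', Exec w (lay.encode dom L) lay.initCode ⟨fun _ => 0, fun _ => 0⟩
      (List.replicate 6 none) s' ∧ lay.Inv dom L.length w ∅ ⟨[], 0, 0⟩ s' := by
  have hb₀ : RamState.Bounded (ρ := Reg) w ⟨fun _ => 0, fun _ => 0⟩ :=
    ⟨fun _ => Nat.zero_le _, fun _ => Nat.zero_le _⟩
  have hb₁ := hb₀.update (r := .one) (v := 1) (by omega)
  have hb₂ := hb₁.update (r := .size) hL
  have hb₃ := hb₂.update (r := .base) (v := dom) (by omega)
  have hb₄ := hb₃.update (r := .base) (v := dom + 1) (by omega)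
  have hb₅ := hb₄.update (r := .base) hw
  have hb₆ := hb₅.update (r := .stride) hS
  refine ⟨_, Exec.op_eq hb₀ rfl (by rfl) (Exec.op_eq hb₁ rfl ?_ (Exec.op_eq hb₂ rfl ?_
    (Exec.op_eq hb₃ rfl ?_ (Exec.op_eq hb₄ rfl ?_ (Exec.op_eq hb₅ rfl (by rfl) (.nil _)))))), ?_⟩
  · simp [Op.apply, encode]
  · simp [Op.apply, encode]
  · simp [Op.apply]
  · simp [Op.apply]
  · exact
    { bounded := hb₆
      zero := by simp [Op.apply]
      one := by simp [Op.apply]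
      size := by simp [Op.apply]
      base := by simp [Op.apply]
      stride := by simp [Op.apply]
      qlen := by simp [Op.apply]
      qpos := by simp [Op.apply]
      qrem := by simp [Op.apply]
      pos_le := le_rfl
      rem_lt := hK
      nodup := List.nodup_nil
      items := by simp
      table := by simp [Op.apply]
      dedup := by simp [Op.apply]
      queue := by simp [Op.apply] }

/-- The code that enumerates the events of a generator. -/
noncomputable def mainCode (lay : Layout σ X) (g : Gen σ X) : Code Reg :=
  lay.initCode ++ (lay.comp g 0 (fun _ => .zero) ++ lay.drainCode)

theorem exists_enumerates (hv : lay.Valid) (hK : 0 < lay.K) (g : Gen σ X)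
    (hg : ∀ t ∈ g.tables, t ∈ lay.tabs) : ∃ C, ∀ {dom w P L}, lay.Fits dom L P w → dom + 2 ≤ w →
    ∀ (δ : ℕ) (S : Set (List ℕ)), (∀ as M', g.Run L (fun _ => 0) ∅ as M' → as.Gap δ 0 ∧
      (∀ x, x ∈ S ↔ ∃ h, some h ∈ as ∧ lay.xs.map h = x) ∧
      ∀ x, (as.reduceOption.map (lay.xs.map ·)).count x ≤ lay.K) →
    ∀ D pre, C * (lay.K * (δ + 1) + 1) < D →
      (lay.mainCode g).toProgram.Enumerates (lay.encode dom L) S pre D w := by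
  obtain ⟨C, hC⟩ := exists_implements hv g hg
  -- Besides `C`, the constant covers the six steps of initialization and the output of one tuple
  -- while draining.
  refine ⟨C + 4 * lay.xs.length + 6, fun {dom w P L} hf hw δ S hrun D pre hD => ?_⟩
  set C' := C + 4 * lay.xs.length + 6 with hC'
  obtain ⟨s₁, h1, hI₁⟩ := exec_initCode (lay := lay) hw (hf.input_le L.length (by simp [encode]))
    ((Nat.le_mul_of_pos_left _ (Nat.succ_pos P)).trans hf.words) hK
  -- Initially all variables are read from the register `zero`. Values are only required to be at
  -- most `dom`, so zero is admissible even for an empty domain.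
  obtain ⟨M', as, tr, q', s₂, h2, h3, hI₂, -, h4⟩ := hC hf 0 (fun _ => .zero) (fun _ => 0) ∅ _ s₁
    hI₁ fun x => ⟨trivial, hI₁.zero, Nat.zero_le _⟩
  obtain ⟨hgap, hS, hcount⟩ := hrun as M' h2
  obtain ⟨tr', s₃, h5, hb, h6, h7⟩ := hI₂.drain (inp := lay.encode dom L)
    (A := C' * (lay.K * (δ + 1))) (D := C' * (lay.K * (δ + 1) + 1)) (by
      rw [Nat.mul_succ C' (lay.K * (δ + 1))]
      omega) hf (n := q'.items.length - q'.pos) (by have := hI₂.pos_le; omega)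
  have hout : (List.replicate 6 none ++ (tr ++ tr')).reduceOption = q'.items := by
    have h8 := h4.reduceOption_eq (Nat.zero_le _)
    rw [List.reduceOption_append, List.reduceOption_append, List.reduceOption_replicate_none, h6]
    simp only [List.take_nil, List.nil_append] at h8 ⊢
    rw [h8, List.take_append_drop]
  have hmain := (h1.append (h3.append h5)) .nil
  rw [Code.append_nil] at hmain
  refine Code.enumerates_of_path hmain hb (D := C' * (lay.K * (δ + 1) + 1)) ?_ hD (fun x => ?_) ?_
  · refine Trace.gap_silent_append (by simp) ?_
    refine (h4.mono (by omega : C ≤ C')).gap (x := 0) (ev := []) h7 le_rfl hK rfl (by simp)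
      (by simpa using hcount) hgap ?_
    simp
    omega
  · rw [← List.reduceOption_mem_iff, hout, h4.mem_items, hS]
    simp
  · rw [hout]
    exact hI₂.nodup

end Main

end Layout

/-! ### Polynomial word size and conclusion -/

section Final

variable {σ : Schema} {X : Type}

open Classical in
/-- The layout for a generator. -/
noncomputable def Gen.layout (g : Gen σ X) (code : σ.Sym → ℕ) (syms : List σ.Sym) (xs : List X)
    (K : ℕ) : Layout σ X where
  code := code
  syms := syms
  tabs := {t | t ∈ g.tables}
  num t := g.tables.idxOf t
  m := g.tables.length
  xs := xs
  K := K

open Classical in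
theorem Gen.layout_valid (g : Gen σ X) {code : σ.Sym → ℕ} (hcode : Function.Injective code)
    {syms : List σ.Sym} (hsyms : ∀ R, R ∈ syms) (xs : List X) (K : ℕ) :
    (g.layout code syms xs K).Valid where
  code_injective := hcode
  mem_syms := hsyms
  num_injOn := fun _ ht _ _ h => (List.idxOf_inj ht).1 h
  num_lt := fun _ ht => List.idxOf_lt_length_of_mem ht

theorem List.count_reduceOption {α : Type*} [DecidableEq α] (x : α) : ∀ l : List (Option α),
    l.reduceOption.count x = l.count (some x)
  | [] => rfl
  | none :: l => by simpa using count_reduceOption x l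
  | some y :: l => by simp [List.count_cons, count_reduceOption x l]

theorem List.count_map_le_of_injOn {α β : Type*} [DecidableEq α] [BEq β] [LawfulBEq β]
    {f : α → β} {l : List α} {K : ℕ} (hf : ∀ x ∈ l, ∀ y ∈ l, f x = f y → x = y)
    (hK : ∀ x, l.count x ≤ K) (y : β) : (l.map f).count y ≤ K := by
  by_cases hy : y ∈ l.map f
  · obtain ⟨x, hx, rfl⟩ := List.mem_map.1 hy
    refine le_trans (le_of_eq ?_) (hK x)
    rw [List.count, List.count, List.countP_map]
    refine List.countP_congr fun z hz => ?_
    simp only [Function.comp_apply, beq_iff_eq]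
    exact ⟨hf z hz x hx, congrArg f⟩
  · rw [List.count_eq_zero_of_not_mem hy]
    exact Nat.zero_le _

/-- For constants large enough, all words are polynomially bounded. -/
theorem Layout.exists_fits [Finite σ.Sym] (lay : Layout σ X) (hfin : lay.tabs.Finite) : ∃ c, ∀ c',
    c ≤ c' → ∀ (dom : ℕ) (L : List (Atom σ ℕ)), (∀ f ∈ L, ∀ i, f.2 i ≤ dom) →
    (∃ P, lay.Fits dom L P (c' * (L.length + dom + 1) ^ c')) ∧
      dom + 2 ≤ c' * (L.length + dom + 1) ^ c' := by
  have := Fintype.ofFinite σ.Sym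
  -- `E` exceeds the length of every key and of the output tuples, so `P = (dom + 2) ^ E` bounds all
  -- their numbers.
  set E := ∑ t ∈ hfin.toFinset, t.keys.length + lay.xs.length + 1 with hE
  set A := ∑ R, σ.arity R with hA
  set B := ∑ R, lay.code R with hB
  have hAR : ∀ R, σ.arity R ≤ A := fun R =>
    Finset.single_le_sum (f := fun R => σ.arity R) (fun _ _ => Nat.zero_le _) (Finset.mem_univ R)
  have hBR : ∀ R, lay.code R ≤ B := fun R =>
    Finset.single_le_sum (f := fun R => lay.code R) (fun _ _ => Nat.zero_le _) (Finset.mem_univ R)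
  -- The summands serve the exponent, the length of the input (`A + 3`), the codes of symbols, the
  -- counter, and the addresses in memory.
  refine ⟨E + A + B + lay.K + 3 + 2 ^ (E + 1) * lay.stride, fun c' hc dom L hL => ?_⟩
  set Z := L.length + dom + 1 with hZ
  have hZ1 : 1 ≤ Z := by omega
  have hpos : 0 < 2 ^ (E + 1) * lay.stride := Nat.mul_pos (by positivity) lay.stride_pos
  have hconst : c' ≤ c' * Z ^ c' := Nat.le_mul_of_pos_right _ (by positivity)
  have hZZ : Z ≤ Z ^ c' := Nat.le_self_pow (by omega) Z
  have hlin : ∀ {k}, k ≤ c' → k * Z ≤ c' * Z ^ c' := fun hk => Nat.mul_le_mul hk hZZ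
  have hdom : dom + 2 ≤ 2 * Z := by omega
  have hlen : (lay.encode dom L).length ≤ (A + 3) * Z := by
    have h1 : ∀ l : List (Atom σ ℕ),
        (l.flatMap fun f => lay.code f.1 :: List.ofFn f.2).length ≤ (A + 1) * l.length := by
      intro l
      induction l with
      | nil => simp
      | cons f l ih =>
        rw [List.flatMap_cons, List.length_append, List.length_cons, List.length_cons,
          List.length_ofFn, Nat.mul_succ]
        have := hAR f.1
        omega
    have h2 := h1 L
    simp only [Layout.encode, List.length_cons]
    nlinarith
  refine ⟨⟨(dom + 2) ^ E, ?_⟩, hdom.trans (hlin (by omega))⟩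
  exact
  { args := hL
    input_le := by
      intro v hv
      simp only [Layout.encode, List.mem_cons, List.mem_flatMap, List.mem_ofFn] at hv
      rcases hv with rfl | rfl | ⟨f, hf, rfl | ⟨i, rfl⟩⟩
      · exact le_trans (by omega) (hlin (k := 1) (by omega))
      · exact le_trans (by omega) (hlin (k := 1) (by omega))
      · have := hBR f.1
        omega
      · have := hL f hf i
        exact le_trans (by omega) (hlin (k := 1) (by omega))
    length_le := hlen.trans (hlin (by omega))
    code_le := fun R => by have := hBR R; omega
    K_le := by omega
    keys_le := fun t ht => by
      refine Nat.pow_le_pow_right (by omega) ?_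
      have := Finset.single_le_sum (f := fun t : Table σ X => t.keys.length)
        (fun _ _ => Nat.zero_le _) (hfin.mem_toFinset.2 ht)
      omega
    vars_le := Nat.pow_le_pow_right (by omega) (by omega)
    words := by
      have h1 : (dom + 2) ^ E + 1 ≤ 2 ^ (E + 1) * Z ^ E := by
        have h2 : (dom + 2) ^ E ≤ 2 ^ E * Z ^ E :=
          (Nat.pow_le_pow_left hdom E).trans (mul_pow _ _ _).le
        have h3 : 0 < 2 ^ E * Z ^ E := by positivity
        rw [pow_succ 2 E]
        nlinarith
      calc ((dom + 2) ^ E + 1) * lay.stride ≤ 2 ^ (E + 1) * Z ^ E * lay.stride :=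
            Nat.mul_le_mul_right _ h1
        _ = 2 ^ (E + 1) * lay.stride * Z ^ E := by ring
        _ ≤ c' * Z ^ c' := Nat.mul_le_mul (by omega) (Nat.pow_le_pow_right hZ1 (by omega)) }

/-- Assignments are normalized to zero off the variables of `q`, as the generator produces them;
this makes the passage from assignments to answer tuples injective. -/
theorem FullCQ.answers_iff [DecidableEq X] {q : FullCQ σ X} {xs : List X}
    (hxs : xs.toFinset = q.vars) {D : Database σ} {L : List (Atom σ ℕ)} (hL : L.toFinset = D.facts)
    {x : List ℕ} : x ∈ q.answers xs D ↔
      ∃ h, ((∀ a ∈ q, Atom.map h a ∈ L) ∧ ChangesOnly (q : Set (Atom σ X)) ∅ (fun _ => 0) h) ∧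
        xs.map h = x := by
  have hD : ∀ a, a ∈ D.facts ↔ a ∈ L := fun a => by rw [← hL, List.mem_toFinset]
  simp only [FullCQ.answers, Set.mem_ofPred_eq, hD]
  constructor
  · rintro ⟨h, h1, rfl⟩
    refine ⟨fun x => if x ∈ q.vars then h x else 0, ⟨fun a ha => ?_, fun x hx => if_neg ?_⟩, ?_⟩
    · refine (?_ : Atom.map _ a = Atom.map h a) ▸ h1 a ha
      refine Sigma.ext rfl (heq_of_eq (funext fun i => if_pos ?_))
      exact FullCQ.mem_vars.2 ⟨a, ha, i, rfl⟩
    · rw [FullCQ.mem_vars]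
      simpa using hx
    · refine List.map_congr_left fun x hx => if_pos ?_
      rwa [← hxs, List.mem_toFinset]
  · rintro ⟨h, ⟨h1, -⟩, rfl⟩
    exact ⟨h, h1, rfl⟩

theorem mainTheorem5 (σ : Schema) [Finite σ.Sym] (X : Type) [DecidableEq X] (q : FullCQ σ X)
    (hq : q.CanBeUntangled) : q.EnumerableWithLinearDelay := by
  classical
  intro code hcode xs _ hxs
  obtain ⟨g, K, c, hg⟩ := hq.exists_gen id ∅
    ⟨by simp, by simp, by rintro a - b - ν rfl; simp, Set.injOn_id _⟩
  rw [Set.image_id] at hg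
  have := Fintype.ofFinite σ.Sym
  -- The counter of the queue needs a positive period, which `K + 1` ensures while still bounding
  -- the multiplicities.
  set lay := g.layout code Finset.univ.toList xs (K + 1) with hlay
  have hv : lay.Valid := g.layout_valid hcode (by simp) xs (K + 1)
  obtain ⟨C, hC⟩ := Layout.exists_enumerates hv (Nat.succ_pos K) g fun t ht => ht
  obtain ⟨c₁, hc₁⟩ := lay.exists_fits (List.finite_toSet g.tables)
  -- The delay of the generator is at most `c * (L.length + 1)`; the final `+ 1` makes the
  -- inequality for the delay strict.
  set c₂ := C * ((K + 1) * (c + 1) + 1) + 1 with hc₂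
  refine ⟨(lay.mainCode g).toProgram, c₁ + c₂, fun D L hL hLD => ?_⟩
  have hsize : D.size = L.length := by
    rw [Database.size, ← hLD, List.toFinset_card_of_nodup hL]
  obtain ⟨⟨P, hf⟩, hw⟩ := hc₁ (c₁ + c₂) (Nat.le_add_right _ _) D.dom L fun f hf i =>
    (D.facts_lt f (by rw [← hLD]; exact List.mem_toFinset.2 hf) i).le
  have henc : D.encode code L = lay.encode D.dom L := by
    rw [Database.encode, hsize]
    rfl
  rw [henc, hsize]
  refine hC hf hw (c * (L.length + 1)) _ (fun as M' hr => ?_) _ _ ?_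
  · obtain ⟨h1, h2, h3⟩ := (hg L hL).2 _ ∅ as M' (fun e he => absurd he (Set.notMem_empty e)) hr
    refine ⟨h3, fun x => ?_, ?_⟩
    · rw [FullCQ.answers_iff hxs hLD]
      simp only [h1, Finset.mem_coe]
      rfl
    · refine List.count_map_le_of_injOn ?_ fun h => ?_
      · intro h hh h' hh' he
        rw [List.reduceOption_mem_iff, h1] at hh hh'
        funext x
        by_cases hx : Occurs (q : Set (Atom σ X)) x
        · rw [← FullCQ.mem_vars, ← hxs, List.mem_toFinset] at hx
          exact List.map_inj_left.1 he x hx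
        · rw [hh.2 x (.inr hx), hh'.2 x (.inr hx)]
      · rw [List.count_reduceOption]
        refine le_trans (le_trans (le_of_eq ?_) (h2 h)) (Nat.le_succ K)
        congr!
  · have h1 : (K + 1) * (c * (L.length + 1) + 1) + 1 ≤
        ((K + 1) * (c + 1) + 1) * (L.length + 1) := by
      nlinarith
    calc C * ((K + 1) * (c * (L.length + 1) + 1) + 1)
        ≤ C * (((K + 1) * (c + 1) + 1) * (L.length + 1)) := Nat.mul_le_mul_left _ h1
      _ < C * (((K + 1) * (c + 1) + 1) * (L.length + 1)) + (L.length + 1) := by omega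
      _ = c₂ * (L.length + 1) := by rw [hc₂]; ring
      _ ≤ (c₁ + c₂) * (L.length + 1) := Nat.mul_le_mul_right _ (Nat.le_add_left _ _)

end Final
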